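/- Let $n\ge 2$ and let $\Omega\subset\mathbb R^n$ be a bounded Lipschitz domain (a bounded, connected, nonempty open set which near each of its boundary points is, after a rotation, the region above the graph of a Lipschitz function). Let $\sigma$ be the surface measure on $\partial\Omega$ and $N$ the outward unit normal, defined $\sigma$-a.e. on $\partial\Omega$. Let $u\in C^4(\overline\Omega)$ be real valued with $u=0$ and $\nabla u=0$ on $\partial\Omega$. Let $\alpha\in\mathbb R$ and $y\in\mathbb R^n$ be such that either $y\in\partial\Omega$ and $\alpha<n$, or $y\notin\overline\Omega$. Write $\rho=\rho(x)=|x-y|$ and, for a scalar or vector valued function $f$, let $\frac{\partial f}{\partial\rho}(x)$ be the derivative of $f$ at $x$ in the direction $\frac{x-y}{\rho}$; let $|\nabla^2u|^2=\sum_{i,j}\big|\frac{\partial^2u}{\partial x_i\partial x_j}\big|^2$. Then all the integrals below converge absolutely, and $$ \begin{aligned} &(\alpha+4-n)\int_\Omega \Delta u\;\Delta\Big(\frac{u}{\rho^\alpha}\Big)\,dx -2\int_\Omega \Delta^2u\;\frac{\partial u}{\partial\rho}\,\frac{dx}{\rho^{\alpha-1}}\\ &\quad=\int_{\partial\Omega}|\nabla^2u|^2\Big\langle\frac{x-y}{\rho},N\Big\rangle\frac{d\sigma}{\rho^{\alpha-1}}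 +4\alpha\int_\Omega\Big|\frac{\partial}{\partial\rho}\Big(\rho^{\frac{n-\alpha-2}{2}}\nabla u\Big)\Big|^2\frac{dx}{\rho^{n-2}}\\ &\qquad+2\alpha(\alpha+2)(n-\alpha-2)\int_\Omega\Big|\frac{\partial}{\partial\rho}\Big(\rho^{\frac{n-\alpha-4}{2}}u\Big)\Big|^2\frac{dx}{\rho^{n-2}} . \end{aligned} $$ -/

import Mathlib

open MeasureTheory Set
open scoped InnerProductSpace Gradient Laplacian

noncomputable section

/-- A bounded Lipschitz domain in `ℝⁿ`: a bounded, connected, nonempty open set such that near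
every boundary point `Q`, in suitable orthonormal coordinates with vertical direction `e`, the set
coincides with the region strictly above the graph of a Lipschitz function `φ` defined on the
hyperplane orthogonal to `e`. -/
structure IsBoundedLipschitzDomain {n : ℕ} (Ω : Set (EuclideanSpace ℝ (Fin n))) : Prop where
  isOpen : IsOpen Ω
  isConnected : IsConnected Ω
  isBounded : Bornology.IsBounded Ω
  lipschitz_boundary : ∀ Q ∈ frontier Ω, ∃ r : ℝ, 0 < r ∧
    ∃ e : EuclideanSpace ℝ (Fin n), ‖e‖ = 1 ∧
    ∃ (K : NNReal) (φ : (ℝ ∙ e)ᗮ → ℝ), LipschitzWith K φ ∧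
    ∀ x ∈ Metric.ball Q r, x ∈ Ω ↔ φ ((ℝ ∙ e)ᗮ.orthogonalProjectionOnto x) < ⟪e, x⟫_ℝ

/-- The surface measure `σ` on `∂Ω`: the `(n - 1)`-dimensional Hausdorff measure, normalized so as
to agree with `(n - 1)`-dimensional Lebesgue measure on hyperplanes, restricted to `∂Ω`. -/
def surfaceMeasure {n : ℕ} (Ω : Set (EuclideanSpace ℝ (Fin n))) :
    Measure (EuclideanSpace ℝ (Fin n)) :=
  (Measure.euclideanHausdorffMeasure (n - 1)).restrict (frontier Ω)

/-- `ν` is an outward unit normal to `Ω` at `x`: `ν` is a unit vector and, to first order at `x`,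
`Ω` is the half space `{z | ⟪z - x, ν⟫ < 0}`. Such a `ν` is unique. If `Ω` is the region
above the graph of `φ` near a point `x` of the graph over a point where `φ` is differentiable,
it is `(∇φ, -1) / √(1 + |∇φ|²)`. -/
def IsOutwardUnitNormal {n : ℕ} (Ω : Set (EuclideanSpace ℝ (Fin n)))
    (x ν : EuclideanSpace ℝ (Fin n)) : Prop :=
  ‖ν‖ = 1 ∧ ∀ ε : ℝ, 0 < ε → ∃ r : ℝ, 0 < r ∧ ∀ z ∈ Metric.ball x r,
    (⟪z - x, ν⟫_ℝ < -(ε * ‖z - x‖) → z ∈ Ω) ∧ (ε * ‖z - x‖ < ⟪z - x, ν⟫_ℝ → z ∉ Ω)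

open Classical in
/-- The outward unit normal `N` to `∂Ω`, with value `0` at the points where it does not exist. For a
Lipschitz domain these boundary points form a set of surface measure zero. -/
def outwardNormal {n : ℕ} (Ω : Set (EuclideanSpace ℝ (Fin n)))
    (x : EuclideanSpace ℝ (Fin n)) : EuclideanSpace ℝ (Fin n) :=
  if h : ∃ ν, IsOutwardUnitNormal Ω x ν then h.choose else 0

/-- `|∇²u|² = ∑ i, j, |∂²u/∂xᵢ∂xⱼ|²` at `x`, with derivatives taken within the set `s`. -/
def hessianNormSq {n : ℕ} (s : Set (EuclideanSpace ℝ (Fin n))) (u : EuclideanSpace ℝ (Fin n) → ℝ)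
    (x : EuclideanSpace ℝ (Fin n)) : ℝ :=
  ∑ i : Fin n, ∑ j : Fin n,
    (iteratedFDerivWithin ℝ 2 u s x
      ![EuclideanSpace.single i 1, EuclideanSpace.single j 1]) ^ 2

/-- The derivative `∂f/∂ρ` of a scalar or vector valued `f` at `x` in the radial direction
`(x - y) / ρ`, where `ρ = |x - y|`. -/
def radialDeriv {n : ℕ} {F : Type*} [NormedAddCommGroup F] [NormedSpace ℝ F]
    (y : EuclideanSpace ℝ (Fin n)) (f : EuclideanSpace ℝ (Fin n) → F)
    (x : EuclideanSpace ℝ (Fin n)) : F :=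
  fderiv ℝ f x (‖x - y‖⁻¹ • (x - y))

end

/-! ### Area formula for Lipschitz graphs -/

section GraphArea

open Measure Module
open scoped NNReal ENNReal

/-! Write ρ = |x - y|, h = (x - y)·∇u and s = ∇²u (x - y). The identity is of Rellich–Pohozaev type:
Δ²u is tested against ρ^(-α) h, and everything else is a finite combination of divergences. Nine
vector fields are used, each satisfying ∫_Ω div F = ∫_∂Ω ⟨F, N⟩.

The fields ρ^(-α) h ∇Δu and ∇²u ∇(ρ^(-α) h) together move two derivatives off Δ²u. This leaves ∇²u :
∇²(ρ^(-α) h), whose third-order part is removed by the radial field ρ^(-α) |∇²u|² (x - y). What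
remains at top order is (α + 4 - n) ρ^(-α) |∇²u|², and the field ρ^(-α) (Δu ∇u - ∇²u ∇u) exchanges
|∇²u|² for (Δu)². The remaining five fields, ρ^(-α-2) |∇u|² (x - y), ρ^(-α-2) h ∇u, ρ^(-α-2) u ∇u,
ρ^(-α-4) u² (x - y) and ρ^(-α-4) h² (x - y), rearrange the lower-order terms into the two squares of
radial derivatives. With the right coefficients the result is an identity of polynomials at each
point (`IsJet.hasFlux_rellich`).

On the boundary u = 0 and ∇u = 0. Each ∂ᵢu then has no tangential derivative, so by symmetry ∇²u = c
N ⊗ N almost everywhere (`exists_hessian_eq`). Only the second and third fields have nonzero flux.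
With coefficients 2 and -1 they contribute 2 - 1 = 1 times |∇²u|² ⟨x - y, N⟩ ρ^(-α).

If y lies on the boundary, u vanishes there to second order, so u, ∇u, ∇²u are O(ρ²), O(ρ), O(1).
All fields are then O(ρ^(1-α)) and all integrands over Ω are O(ρ^(-α)); both powers are integrable,
on ∂Ω and Ω respectively, exactly because α < n. `IsSymbol` records such orders of growth.
`IsSymbol.hasFlux` proves the flux identity by cutting out a small ball around y: the cutoff has
gradient O(1/ρ) uniformly, so dominated convergence applies.

The divergence theorem on a Lipschitz domain (`IsBoundedLipschitzDomain.integral_lineDeriv`) is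
proved for Lipschitz functions. Above a single graph one integrates by parts against a truncation of
the height and lets the boundary layer shrink. The area formula identifies the limit with a
Hausdorff surface integral, and cutoffs glue finitely many charts. It applies to the truncated
fields because a function with bounded gradient on a Lipschitz domain is Lipschitz up to the
boundary. -/

theorem euclideanHausdorffMeasure_image_le_of_dist_le {A X Y : Type*} [MetricSpace X]
    [MeasurableSpace X] [BorelSpace X] [MetricSpace Y] [MeasurableSpace Y] [BorelSpace Y]
    {d : ℕ} {f : A → X} {g : A → Y} {s : Set A} {C : ℝ≥0}
    (h : ∀ v ∈ s, ∀ w ∈ s, dist (f v) (f w) ≤ C * dist (g v) (g w)) :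
    μHE[d] (f '' s) ≤ (C : ℝ≥0∞) ^ d * μHE[d] (g '' s) := by
  rcases s.eq_empty_or_nonempty with rfl | ⟨a, ha⟩
  · simp
  have : Nonempty A := ⟨a⟩
  have hp : ∀ v ∈ s, Function.invFunOn g s (g v) ∈ s ∧ g (Function.invFunOn g s (g v)) = g v :=
    fun v hv => ⟨Function.invFunOn_mem ⟨v, hv, rfl⟩, Function.invFunOn_eq ⟨v, hv, rfl⟩⟩
  -- The hypothesis makes `f` constant on the fibres of `g` in `s`, so `f` factors through `g` by a
  -- `C`-Lipschitz map; neither map need be injective.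
  have hlip : LipschitzOnWith C (f ∘ Function.invFunOn g s) (g '' s) := by
    refine LipschitzOnWith.of_dist_le_mul ?_
    rintro _ ⟨v, hv, rfl⟩ _ ⟨w, hw, rfl⟩
    have := h _ (hp v hv).1 _ (hp w hw).1
    rwa [(hp v hv).2, (hp w hw).2] at this
  have himg : (f ∘ Function.invFunOn g s) '' (g '' s) = f '' s := by
    rw [image_image]
    refine image_congr fun v hv => ?_
    have := h _ (hp v hv).1 _ hv
    rw [(hp v hv).2, dist_self, mul_zero] at this
    exact dist_le_zero.1 this
  have := hlip.hausdorffMeasure_image_le (d := d) (by positivity)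
  rw [himg] at this
  simp only [euclideanHausdorffMeasure_def, Measure.smul_apply, ENNReal.smul_def, smul_eq_mul]
  rw [ENNReal.rpow_natCast] at this
  calc _ ≤ _ := mul_le_mul_right this _
    _ = _ := by ring

/-- The area element of the graph of a function with derivative `A`. -/
noncomputable def graphJacobian {V : Type*} [NormedAddCommGroup V] [NormedSpace ℝ V]
    (A : V →L[ℝ] ℝ) : ℝ := √(1 + ‖A‖ ^ 2)

variable {V : Type*} [NormedAddCommGroup V] [InnerProductSpace ℝ V]

theorem graphJacobian_sq (A : V →L[ℝ] ℝ) : graphJacobian A ^ 2 = 1 + ‖A‖ ^ 2 :=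
  Real.sq_sqrt (by positivity)

theorem one_le_graphJacobian (A : V →L[ℝ] ℝ) : 1 ≤ graphJacobian A :=
  Real.one_le_sqrt.2 (by nlinarith [sq_nonneg ‖A‖])

theorem continuous_graphJacobian : Continuous (graphJacobian : (V →L[ℝ] ℝ) → ℝ) := by
  unfold graphJacobian; fun_prop

/-- A change of height b by at most δ a stretches the hypotenuse of (a, b) by a factor at most 1 +
δ: expand (|b'| + δ a)² and use 2 a |b'| ≤ a² + b'². -/
theorem sqrt_one_add_sq_le {a b b' δ : ℝ} (hδ : 0 ≤ δ)
    (h : |b - b'| ≤ δ * a) : a ^ 2 + b ^ 2 ≤ (1 + δ) ^ 2 * (a ^ 2 + b' ^ 2) := by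
  have h1 : b ^ 2 ≤ (|b'| + δ * a) ^ 2 := by
    rw [← sq_abs b]
    have : |b| ≤ |b'| + δ * a := by
      have := abs_add_le (b - b') b'; rw [sub_add_cancel] at this; linarith
    gcongr
  have h2 : 0 ≤ (|b'| - a) ^ 2 := sq_nonneg _
  have h3 := sq_abs b'
  nlinarith [mul_nonneg hδ h2, mul_nonneg hδ (sq_nonneg b'), mul_nonneg (mul_nonneg hδ hδ) (sq_nonneg b')]

theorem graphJacobian_le {A B : V →L[ℝ] ℝ} {δ : ℝ} (h : ‖A - B‖ ≤ δ) :
    graphJacobian A ≤ (1 + δ) * graphJacobian B := by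
  have hδ : 0 ≤ δ := (norm_nonneg _).trans h
  have h1 : |‖A‖ - ‖B‖| ≤ δ * 1 := by
    rw [mul_one]; exact (abs_norm_sub_norm_le A B).trans h
  have := sqrt_one_add_sq_le hδ h1
  rw [one_pow, ← graphJacobian_sq, ← graphJacobian_sq, ← mul_pow] at this
  exact le_of_sq_le_sq this (by have := one_le_graphJacobian B; positivity)

variable [FiniteDimensional ℝ V]

/-- A linear map with the same metric distortion as the graph map of `A`. -/
theorem exists_linearMap_graph (A : V →L[ℝ] ℝ) :
    ∃ T : V →ₗ[ℝ] V, LinearMap.det T = graphJacobian A ∧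
      ∀ h, ‖T h‖ ^ 2 = ‖h‖ ^ 2 + (A h) ^ 2 := by
  set J := graphJacobian A
  have hJ := one_le_graphJacobian A
  have hJ2 := graphJacobian_sq A
  set a := (InnerProductSpace.toDual ℝ V).symm A with ha
  have hA : ∀ h, ⟪a, h⟫_ℝ = A h := fun h => by
    rw [ha, InnerProductSpace.toDual_symm_apply]
  have hn : ‖a‖ ^ 2 = J ^ 2 - 1 := by
    rw [ha, LinearIsometryEquiv.norm_map, hJ2]; ring
  have hAa : A a = J ^ 2 - 1 := by rw [← hA, real_inner_self_eq_norm_sq, hn]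
  have hJ1 : J + 1 ≠ 0 := by positivity
  -- With a the gradient of A, this is the positive square root of I + a ⊗ a: it fixes the
  -- complement of a and, since |a|² = J² - 1, multiplies a by 1 + (J² - 1)/(J + 1) = J.
  refine ⟨LinearMap.transvection (A : V →ₗ[ℝ] ℝ) ((J + 1)⁻¹ • a), ?_, fun h => ?_⟩
  · rw [LinearMap.transvection.det]
    simp [hAa]
    field_simp
    ring
  · rw [LinearMap.transvection.apply]
    simp only [ContinuousLinearMap.coe_coe]
    rw [norm_add_sq_real, norm_smul, norm_smul, inner_smul_right, inner_smul_right,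
      real_inner_comm, hA, mul_pow, mul_pow, hn]
    simp only [Real.norm_eq_abs, sq_abs]
    field_simp
    ring

variable [MeasurableSpace V] [BorelSpace V]

variable {X : Type*} [MetricSpace X] [MeasurableSpace X] [BorelSpace X]

/-- Where φ is within δ of the linear form A, distances on the graph and distances after the linear
map of `exists_linearMap_graph` agree up to a factor 1 + δ in both directions. The linear map scales
volume by its determinant, the graph Jacobian. -/
theorem graph_image_piece {φ : V → ℝ} {Ψ : V → X}
    (hΨ : ∀ v w, dist (Ψ v) (Ψ w) ^ 2 = ‖v - w‖ ^ 2 + (φ v - φ w) ^ 2)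
    {A : V →L[ℝ] ℝ} {δ : ℝ≥0} {s : Set V} (hA : ApproximatesLinearOn φ A s δ) :
    μHE[finrank ℝ V] (Ψ '' s) ≤
        (1 + δ : ℝ≥0) ^ finrank ℝ V * (ENNReal.ofReal (graphJacobian A) * volume s) ∧
      ENNReal.ofReal (graphJacobian A) * volume s ≤
        (1 + δ : ℝ≥0) ^ finrank ℝ V * μHE[finrank ℝ V] (Ψ '' s) := by
  obtain ⟨T, hdet, hT⟩ := exists_linearMap_graph A
  have hvol : μHE[finrank ℝ V] (T '' s) = ENNReal.ofReal (graphJacobian A) * volume s := by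
    rw [InnerProductSpace.euclideanHausdorffMeasure_eq_volume, addHaar_image_linearMap, hdet,
      abs_of_nonneg (zero_le_one.trans (one_le_graphJacobian A))]
  rw [← hvol]
  have key : ∀ v ∈ s, ∀ w ∈ s, |(φ v - φ w) - A (v - w)| ≤ δ * ‖v - w‖ := fun v hv w hw => by
    simpa using hA v hv w hw
  have hTd : ∀ v w, dist (T v) (T w) ^ 2 = ‖v - w‖ ^ 2 + (A (v - w)) ^ 2 := fun v w => by
    rw [dist_eq_norm, ← map_sub, hT]
  constructor <;> apply euclideanHausdorffMeasure_image_le_of_dist_le <;> intro v hv w hw <;>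
    refine le_of_sq_le_sq ?_ (by positivity) <;> rw [mul_pow, hTd, hΨ] <;> push_cast
  · exact sqrt_one_add_sq_le δ.2 (key v hv w hw)
  · exact sqrt_one_add_sq_le δ.2 (by rw [abs_sub_comm]; exact key v hv w hw)


theorem exists_partition_graph [Nontrivial V] {φ : V → ℝ} {s : Set V} (hs : MeasurableSet s)
    (hd : ∀ x ∈ s, DifferentiableAt ℝ φ x) {δ : ℝ≥0} (hδ : δ ≠ 0) :
    ∃ (t : ℕ → Set V) (A : ℕ → V →L[ℝ] ℝ), Pairwise (Function.onFun Disjoint t) ∧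
      (∀ n, MeasurableSet (t n)) ∧ s = ⋃ n, t n ∧ (∀ n, ApproximatesLinearOn φ (A n) (t n) δ) ∧
      ∀ n, ∀ᵐ x ∂volume.restrict (t n), ‖fderiv ℝ φ x - A n‖ ≤ δ := by
  obtain ⟨t, A, hdisj, hmeas, hcov, happ, -⟩ :=
    exists_partition_approximatesLinearOn_of_hasFDerivWithinAt φ s (fderiv ℝ φ)
      (fun x hx => (hd x hx).hasFDerivAt.hasFDerivWithinAt) (fun _ => δ) (fun _ => hδ)
  refine ⟨fun n => s ∩ t n, A, fun i j hij => ?_, fun n => hs.inter (hmeas n), ?_, happ, fun n => ?_⟩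
  · exact (hdisj hij).mono inter_subset_right inter_subset_right
  · rw [← inter_iUnion, inter_eq_left.2 hcov]
  -- The estimate for derivatives of approximately linear maps concerns maps from a space to itself;
  -- multiplying φ by a unit vector puts it in that form without changing norms.
  obtain ⟨w, hw⟩ := exists_norm_eq V zero_le_one
  have h1 : ApproximatesLinearOn (fun x => φ x • w) ((A n).smulRight w) (s ∩ t n) δ := by
    intro x hx y hy
    have := happ n x hx y hy
    rw [← sub_smul, ContinuousLinearMap.smulRight_apply, ← sub_smul, norm_smul, hw, mul_one]
    exact this
  have := h1.norm_fderiv_sub_le volume (hs.inter (hmeas n))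
    (fun x => (fderiv ℝ φ x).smulRight w)
    (fun x hx => ((hd x hx.1).hasFDerivAt.smul_const w).hasFDerivWithinAt)
  filter_upwards [this] with x hx
  have h2 : (fderiv ℝ φ x).smulRight w - (A n).smulRight w = (fderiv ℝ φ x - A n).smulRight w := by
    ext; simp [sub_smul]
  rw [h2, ← NNReal.coe_le_coe, coe_nnnorm, ContinuousLinearMap.norm_smulRight_apply, hw,
    mul_one] at hx
  exact hx

/-- The area formula for the graph of a Lipschitz function. -/
theorem euclideanHausdorffMeasure_image_graph [Nontrivial V] {φ : V → ℝ} {K : ℝ≥0}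
    (hφ : LipschitzWith K φ) {Ψ : V → X} (hΨe : MeasurableEmbedding Ψ)
    (hΨ : ∀ v w, dist (Ψ v) (Ψ w) ^ 2 = ‖v - w‖ ^ 2 + (φ v - φ w) ^ 2)
    {s : Set V} (hs : MeasurableSet s) :
    μHE[finrank ℝ V] (Ψ '' s) = ∫⁻ v in s, ENNReal.ofReal (graphJacobian (fderiv ℝ φ v)) := by
  set m := finrank ℝ V
  have hcomap : ∀ s, μHE[m] (Ψ '' s) = (μHE[m] : Measure X).comap Ψ s :=
    fun s => (hΨe.comap_apply _ s).symm
  -- the set of points of nondifferentiability does not contribute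
  set D := {x | DifferentiableAt ℝ φ x} with hD
  have hDm : MeasurableSet D := measurableSet_of_differentiableAt ℝ φ
  have hD0 : volume (s \ D) = 0 := measure_mono_null (sdiff_subset_compl _ _) hφ.ae_differentiableAt
  have hI0 : μHE[m] (Ψ '' (s \ D)) = 0 := by
    have h1 : μHE[m] (Ψ '' (s \ D)) ≤ ((1 + K : ℝ≥0) : ℝ≥0∞) ^ m * μHE[m] (id '' (s \ D)) := by
      apply euclideanHausdorffMeasure_image_le_of_dist_le
      intro v _ w _
      refine le_of_sq_le_sq ?_ (by positivity)
      rw [hΨ, mul_pow, id, id, dist_eq_norm]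
      have := hφ.dist_le_mul v w
      rw [Real.dist_eq, dist_eq_norm] at this
      have := sqrt_one_add_sq_le (b := φ v - φ w) (b' := 0) K.2 (by simpa using this)
      simpa using this
    rw [image_id, InnerProductSpace.euclideanHausdorffMeasure_eq_volume, hD0, mul_zero] at h1
    exact le_antisymm h1 zero_le
  have hsplit : μHE[m] (Ψ '' s) = μHE[m] (Ψ '' (s ∩ D)) := by
    rw [hcomap, hcomap, ← measure_inter_add_sdiff s hDm, ← hcomap (s \ D), hI0, add_zero]
  have hsplit2 : ∫⁻ v in s, ENNReal.ofReal (graphJacobian (fderiv ℝ φ v)) =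
      ∫⁻ v in s ∩ D, ENNReal.ofReal (graphJacobian (fderiv ℝ φ v)) := by
    rw [← lintegral_inter_add_sdiff _ s hDm, setLIntegral_measure_zero (s \ D) _ hD0, add_zero]
  rw [hsplit, hsplit2]
  set I := ∫⁻ v in s ∩ D, ENNReal.ofReal (graphJacobian (fderiv ℝ φ v))
  -- The exponent m + 1 collects m factors 1 + δ from the distortion of distances and one from
  -- replacing the Jacobian of φ by that of the linear approximation. Letting δ tend to 0 gives
  -- equality.
  have main : ∀ δ : ℝ≥0, δ ≠ 0 → μHE[m] (Ψ '' (s ∩ D)) ≤ ((1 + δ : ℝ≥0) : ℝ≥0∞) ^ (m + 1) * I ∧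
      I ≤ ((1 + δ : ℝ≥0) : ℝ≥0∞) ^ (m + 1) * μHE[m] (Ψ '' (s ∩ D)) := by
    intro δ hδ
    obtain ⟨t, A, hdisj, hmeas, hcov, happ, hae⟩ :=
      exists_partition_graph (hs.inter hDm) (fun x hx => hx.2) hδ
    have hIs : I = ∑' k, ∫⁻ v in t k, ENNReal.ofReal (graphJacobian (fderiv ℝ φ v)) := by
      simp only [I]
      rw [hcov, lintegral_iUnion hmeas hdisj]
    have hMs : μHE[m] (Ψ '' (s ∩ D)) = ∑' k, μHE[m] (Ψ '' t k) := by
      rw [hcomap, hcov, measure_iUnion hdisj hmeas]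
      simp only [hcomap]
    have hofReal : ENNReal.ofReal (1 + δ) = ((1 + δ : ℝ≥0) : ℝ≥0∞) := by
      rw [← ENNReal.ofReal_coe_nnreal]; simp
    have h1 : ∀ k, ENNReal.ofReal (graphJacobian (A k)) * volume (t k) ≤
        ((1 + δ : ℝ≥0) : ℝ≥0∞) * ∫⁻ v in t k, ENNReal.ofReal (graphJacobian (fderiv ℝ φ v)) := by
      intro k
      rw [← setLIntegral_const, ← lintegral_const_mul' _ _ ENNReal.coe_ne_top]
      refine lintegral_mono_ae ?_
      filter_upwards [hae k] with x hx
      rw [← hofReal, ← ENNReal.ofReal_mul (by positivity)]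
      exact ENNReal.ofReal_le_ofReal (graphJacobian_le (by rwa [norm_sub_rev]))
    have h2 : ∀ k, ∫⁻ v in t k, ENNReal.ofReal (graphJacobian (fderiv ℝ φ v)) ≤
        ((1 + δ : ℝ≥0) : ℝ≥0∞) * (ENNReal.ofReal (graphJacobian (A k)) * volume (t k)) := by
      intro k
      rw [← setLIntegral_const, ← lintegral_const_mul' _ _ ENNReal.coe_ne_top]
      refine lintegral_mono_ae ?_
      filter_upwards [hae k] with x hx
      rw [← hofReal, ← ENNReal.ofReal_mul (by positivity)]
      exact ENNReal.ofReal_le_ofReal (graphJacobian_le hx)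
    rw [hMs, hIs, ← ENNReal.tsum_mul_left, ← ENNReal.tsum_mul_left]
    constructor <;> refine ENNReal.tsum_le_tsum fun k => ?_
    · calc _ ≤ _ := (graph_image_piece hΨ (happ k)).1
        _ ≤ _ := mul_le_mul_right (h1 k) _
        _ = _ := by rw [← mul_assoc, pow_succ]
    · calc _ ≤ _ := h2 k
        _ ≤ _ := mul_le_mul_right (graph_image_piece hΨ (happ k)).2 _
        _ = _ := by rw [← mul_assoc, pow_succ']
  have lim : ∀ a : ℝ≥0∞, Filter.Tendsto
      (fun δ : ℝ≥0 => ((1 + δ : ℝ≥0) : ℝ≥0∞) ^ (m + 1) * a) (nhdsWithin 0 {0}ᶜ) (nhds a) := by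
    intro a
    have h1 : Filter.Tendsto (fun δ : ℝ≥0 => (1 + δ) ^ (m + 1)) (nhdsWithin 0 {0}ᶜ) (nhds 1) := by
      have : Continuous (fun δ : ℝ≥0 => (1 + δ) ^ (m + 1)) := by fun_prop
      exact (by simpa using this.tendsto 0 : Filter.Tendsto (fun δ : ℝ≥0 => (1 + δ) ^ (m + 1))
        (nhds 0) (nhds 1)).mono_left nhdsWithin_le_nhds
    have h2 := ENNReal.Tendsto.mul_const (b := a) (ENNReal.tendsto_coe.2 h1) (Or.inl (by simp))
    simpa using h2
  have hne : (nhdsWithin (0 : ℝ≥0) {0}ᶜ).NeBot := by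
    have := nhdsGT_neBot (0 : ℝ≥0)
    exact this.mono (nhdsWithin_mono _ fun x hx => (ne_of_gt hx))
  have hev : ∀ᶠ δ : ℝ≥0 in nhdsWithin 0 {0}ᶜ, δ ≠ 0 := self_mem_nhdsWithin
  exact le_antisymm (ge_of_tendsto (lim I) (hev.mono fun δ hδ => (main δ hδ).1))
    (ge_of_tendsto (lim _) (hev.mono fun δ hδ => (main δ hδ).2))

end GraphArea

/-! ### Integration by parts above a Lipschitz graph -/

section GraphDomain

set_option linter.unusedSectionVars false

open Measure Module Filter
open scoped NNReal ENNReal Topology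

/-- Truncation of a real number to the unit interval. -/
noncomputable def unitClamp (r : ℝ) : ℝ := max 0 (min 1 r)

theorem lipschitzWith_unitClamp : LipschitzWith 1 unitClamp :=
  (LipschitzWith.id.const_min 1).const_max 0

theorem unitClamp_nonneg (r : ℝ) : 0 ≤ unitClamp r := le_max_left _ _

theorem unitClamp_le_one (r : ℝ) : unitClamp r ≤ 1 := max_le zero_le_one (min_le_left _ _)

theorem unitClamp_of_nonpos {r : ℝ} (h : r ≤ 0) : unitClamp r = 0 :=
  max_eq_left ((min_le_right _ _).trans h)

theorem unitClamp_of_one_le {r : ℝ} (h : 1 ≤ r) : unitClamp r = 1 := by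
  simp [unitClamp, h]

theorem unitClamp_of_mem {r : ℝ} (h : r ∈ Icc (0 : ℝ) 1) : unitClamp r = r := by
  simp [unitClamp, h.1, h.2]

theorem hasDerivAt_unitClamp {r : ℝ} (h0 : r ≠ 0) (h1 : r ≠ 1) :
    HasDerivAt unitClamp ((Ioo (0 : ℝ) 1).indicator 1 r) r := by
  rcases lt_or_gt_of_ne h0 with h | h
  · rw [indicator_of_notMem (by simp [h.le])]
    refine (hasDerivAt_const r (0 : ℝ)).congr_of_eventuallyEq ?_
    filter_upwards [Iio_mem_nhds h] with s hs using unitClamp_of_nonpos (le_of_lt hs)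
  rcases lt_or_gt_of_ne h1 with h' | h'
  · rw [indicator_of_mem (mem_Ioo.2 ⟨h, h'⟩)]
    refine (hasDerivAt_id r).congr_of_eventuallyEq ?_
    filter_upwards [Ioo_mem_nhds h h'] with s hs using unitClamp_of_mem ⟨hs.1.le, hs.2.le⟩
  · rw [indicator_of_notMem (by simp [h'.le])]
    refine (hasDerivAt_const r (1 : ℝ)).congr_of_eventuallyEq ?_
    filter_upwards [Ioi_mem_nhds h'] with s hs using unitClamp_of_one_le (le_of_lt hs)

variable {E : Type*} [NormedAddCommGroup E] [InnerProductSpace ℝ E] [FiniteDimensional ℝ E]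

theorem inner_add_smul_unit {e : E} (he : ‖e‖ = 1) (v : (ℝ ∙ e)ᗮ) (s : ℝ) :
    ⟪e, (v : E) + s • e⟫_ℝ = s := by
  have : ⟪e, (v : E)⟫_ℝ = 0 := Submodule.mem_orthogonal_singleton_iff_inner_right.1 v.2
  rw [inner_add_right, this, inner_smul_right, real_inner_self_eq_norm_sq, he]; simp

theorem orthogonalProjection_add_smul_unit {e : E} (v : (ℝ ∙ e)ᗮ) (s : ℝ) :
    (ℝ ∙ e)ᗮ.orthogonalProjectionOnto ((v : E) + s • e) = v := by
  rw [map_add, Submodule.orthogonalProjectionOnto_mem_subspace_eq_self,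
    map_smul, Submodule.orthogonalProjectionOnto_orthogonalComplement_singleton_eq_zero]
  simp

theorem eq_orthogonalProjection_add_smul {e : E} (he : ‖e‖ = 1) (x : E) :
    x = ((ℝ ∙ e)ᗮ.orthogonalProjectionOnto x : E) + ⟪e, x⟫_ℝ • e := by
  have h := Submodule.starProjection_add_starProjection_orthogonal (K := ℝ ∙ e) x
  rw [Submodule.starProjection_unit_singleton ℝ he x] at h
  rw [add_comm]; exact h.symm

theorem norm_orthogonalProjection_le (e x : E) :
    ‖(ℝ ∙ e)ᗮ.orthogonalProjectionOnto x‖ ≤ ‖x‖ :=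
  Submodule.norm_orthogonalProjectionOnto_apply_le _ _

variable [MeasurableSpace E] [BorelSpace E]

theorem measurePreserving_add_smul_unit {e : E} (he : ‖e‖ = 1) :
    MeasurePreserving (fun p : (ℝ ∙ e)ᗮ × ℝ => (p.1 : E) + p.2 • e) := by
  have h1 := (Submodule.measurePreserving_measurableEquivProd (ℝ ∙ e) (0 : E)).symm
  rw [InnerProductSpace.euclideanHausdorffMeasure_eq_volume] at h1
  have h2 : MeasurePreserving (LinearIsometryEquiv.toSpanUnitSingleton (𝕜 := ℝ) e he) :=
    LinearIsometryEquiv.measurePreserving _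
  have h3 := h1.comp ((h2.prod (MeasurePreserving.id (volume : Measure (ℝ ∙ e)ᗮ))).comp
    (measurePreserving_swap (μ := (volume : Measure (ℝ ∙ e)ᗮ)) (ν := (volume : Measure ℝ))))
  convert h3 using 1
  · ext p
    simp [add_comm]
  · exact volume_eq_prod _ _

/-- The point at height `t` above the graph of `φ` over `v`. -/
def graphFlow (e : E) (φ : (ℝ ∙ e)ᗮ → ℝ) (p : (ℝ ∙ e)ᗮ × ℝ) : E := (p.1 : E) + (p.2 + φ p.1) • e

theorem measurePreserving_graphFlow {e : E} (he : ‖e‖ = 1) {φ : (ℝ ∙ e)ᗮ → ℝ}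
    (hφ : Continuous φ) : MeasurePreserving (graphFlow e φ) := by
  have h1 : MeasurePreserving (fun p : (ℝ ∙ e)ᗮ × ℝ => (p.1, p.2 + φ p.1)) := by
    refine (MeasurePreserving.id _).skew_product (g := fun v t => t + φ v) ?_ ?_
    · exact (by fun_prop : Continuous fun p : (ℝ ∙ e)ᗮ × ℝ => p.2 + φ p.1).measurable
    · exact Eventually.of_forall fun v => map_add_right_eq_self _ _
  exact (measurePreserving_add_smul_unit he).comp h1

theorem continuous_graphFlow {e : E} {φ : (ℝ ∙ e)ᗮ → ℝ} (hφ : Continuous φ) :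
    Continuous (graphFlow e φ) := by
  unfold graphFlow; fun_prop

theorem measurableEmbedding_graphFlow_mul {e : E} (he : ‖e‖ = 1) {φ : (ℝ ∙ e)ᗮ → ℝ}
    (hφ : Continuous φ) {ε : ℝ} (hε : ε ≠ 0) :
    MeasurableEmbedding fun p : (ℝ ∙ e)ᗮ × ℝ => graphFlow e φ (p.1, ε * p.2) := by
  refine Continuous.measurableEmbedding ((continuous_graphFlow hφ).comp (by fun_prop)) ?_
  rintro ⟨v, t⟩ ⟨v', t'⟩ h
  simp only [graphFlow] at h
  have h1 := congrArg (ℝ ∙ e)ᗮ.orthogonalProjectionOnto h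
  rw [orthogonalProjection_add_smul_unit, orthogonalProjection_add_smul_unit] at h1
  subst h1
  have h2 := congrArg (fun x => ⟪e, x⟫_ℝ) h
  simp only [inner_add_smul_unit he] at h2
  simp only [Prod.mk.injEq, true_and]
  exact mul_left_cancel₀ hε (add_right_cancel h2)

/-- The shear along `e` preserves volume, so only the dilation of heights contributes the factor ε.
In these coordinates the layer of height ε above the graph becomes a slab of height 1, independent
of ε. -/
theorem map_graphFlow_mul {e : E} (he : ‖e‖ = 1) {φ : (ℝ ∙ e)ᗮ → ℝ}
    (hφ : Continuous φ) {ε : ℝ} (hε : 0 < ε) :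
    (volume : Measure E) = ENNReal.ofReal ε •
      (volume : Measure ((ℝ ∙ e)ᗮ × ℝ)).map (fun p => graphFlow e φ (p.1, ε * p.2)) := by
  have h1 : (volume : Measure ((ℝ ∙ e)ᗮ × ℝ)) = ENNReal.ofReal ε •
      (volume : Measure ((ℝ ∙ e)ᗮ × ℝ)).map (Prod.map id (ε * ·)) := by
    have h0 := Real.smul_map_volume_mul_left hε.ne'
    rw [abs_of_pos hε] at h0
    rw [volume_eq_prod, ← Measure.map_prod_map _ _ measurable_id (by fun_prop), Measure.map_id,
      ← Measure.prod_smul_right, h0]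
  have h2 := (measurePreserving_graphFlow he hφ).map_eq
  rw [← h2]
  conv_lhs => rw [h1, Measure.map_smul]
  rw [Measure.map_map (continuous_graphFlow hφ).measurable (by fun_prop)]
  rfl

theorem integral_eq_integral_graphFlow_mul {e : E} (he : ‖e‖ = 1) {φ : (ℝ ∙ e)ᗮ → ℝ}
    (hφ : Continuous φ) {ε : ℝ} (hε : 0 < ε) (F : E → ℝ) :
    ∫ x, F x = ∫ p : (ℝ ∙ e)ᗮ × ℝ, ε * F (graphFlow e φ (p.1, ε * p.2)) := by
  conv_lhs => rw [map_graphFlow_mul he hφ hε]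
  rw [integral_smul_measure, (measurableEmbedding_graphFlow_mul he hφ hε.ne').integral_map,
    ENNReal.toReal_ofReal hε.le, integral_const_mul, smul_eq_mul]

theorem ae_differentiableAt_fst {e : E} {φ : (ℝ ∙ e)ᗮ → ℝ} {K : ℝ≥0}
    (hφ : LipschitzWith K φ) :
    ∀ᵐ p : (ℝ ∙ e)ᗮ × ℝ, DifferentiableAt ℝ φ p.1 :=
  quasiMeasurePreserving_fst.ae hφ.ae_differentiableAt

theorem hasLineDerivAt_height {e : E} {φ : (ℝ ∙ e)ᗮ → ℝ} {x : E}
    (hd : DifferentiableAt ℝ φ ((ℝ ∙ e)ᗮ.orthogonalProjectionOnto x)) (v : E) :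
    HasLineDerivAt ℝ (fun z => ⟪e, z⟫_ℝ - φ ((ℝ ∙ e)ᗮ.orthogonalProjectionOnto z))
      (⟪e, v⟫_ℝ - fderiv ℝ φ ((ℝ ∙ e)ᗮ.orthogonalProjectionOnto x)
        ((ℝ ∙ e)ᗮ.orthogonalProjectionOnto v)) x v := by
  have h1 : HasFDerivAt (fun z => ⟪e, z⟫_ℝ) (innerSL ℝ e) x := (innerSL ℝ e).hasFDerivAt
  have h2 := hd.hasFDerivAt.comp x ((ℝ ∙ e)ᗮ.orthogonalProjectionOnto).hasFDerivAt
  exact (h1.sub h2).hasLineDerivAt v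

theorem lipschitzWith_height {e : E} (he : ‖e‖ = 1) {φ : (ℝ ∙ e)ᗮ → ℝ} {K : ℝ≥0}
    (hφ : LipschitzWith K φ) :
    LipschitzWith (1 + K) (fun z => ⟪e, z⟫_ℝ - φ ((ℝ ∙ e)ᗮ.orthogonalProjectionOnto z)) := by
  refine LipschitzWith.sub ?_ ?_
  · refine LipschitzWith.of_dist_le_mul fun x y => ?_
    rw [Real.dist_eq, ← inner_sub_right, dist_eq_norm]
    simpa [he] using abs_real_inner_le_norm e (x - y)
  · refine LipschitzWith.of_dist_le_mul fun x y => (hφ.dist_le_mul _ _).trans ?_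
    rw [dist_eq_norm, dist_eq_norm, ← map_sub]
    exact mul_le_mul_of_nonneg_left (norm_orthogonalProjection_le _ _) K.2

theorem height_graphFlow {e : E} (he : ‖e‖ = 1) (φ : (ℝ ∙ e)ᗮ → ℝ) (p : (ℝ ∙ e)ᗮ × ℝ) :
    ⟪e, graphFlow e φ p⟫_ℝ - φ ((ℝ ∙ e)ᗮ.orthogonalProjectionOnto (graphFlow e φ p)) = p.2 := by
  rw [graphFlow, inner_add_smul_unit he, orthogonalProjection_add_smul_unit]; ring

/-- Let τ be the height above the graph. The clamp of τ/ε to [0, 1] tends to the indicator of the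
supergraph, and integrating by parts against it produces no boundary term on the whole space. Its
derivative lives in the layer 0 < τ < ε and has size 1/ε, which cancels the volume factor of the
rescaled layer; as ε tends to 0 the layer collapses onto the graph. -/
theorem integral_supergraph_lineDeriv {e : E} (he : ‖e‖ = 1) {φ : (ℝ ∙ e)ᗮ → ℝ} {K : ℝ≥0}
    (hφ : LipschitzWith K φ) {f : E → ℝ} {C : ℝ≥0} (hf : LipschitzWith C f)
    (hfc : HasCompactSupport f) (v : E) :
    ∫ x in {x | φ ((ℝ ∙ e)ᗮ.orthogonalProjectionOnto x) < ⟪e, x⟫_ℝ}, lineDeriv ℝ f x v =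
      ∫ w : (ℝ ∙ e)ᗮ, (fderiv ℝ φ w ((ℝ ∙ e)ᗮ.orthogonalProjectionOnto v) - ⟪e, v⟫_ℝ) *
        f ((w : E) + φ w • e) := by
  set P := (ℝ ∙ e)ᗮ.orthogonalProjectionOnto with hP
  set τ : E → ℝ := fun z => ⟪e, z⟫_ℝ - φ (P z) with hτ
  have hτL : LipschitzWith (1 + K) τ := lipschitzWith_height he hφ
  set U := {x | φ (P x) < ⟪e, x⟫_ℝ} with hU
  have hUm : MeasurableSet U := by
    have : U = τ ⁻¹' Ioi 0 := by ext x; simp [hU, hτ]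
    rw [this]; exact hτL.continuous.measurable measurableSet_Ioi
  have hfcont := hf.continuous
  obtain ⟨M, hM⟩ := hfcont.bounded_above_of_compact_support hfc
  have hintf : Integrable f := hfcont.integrable_of_hasCompactSupport hfc
  set ε : ℕ → ℝ := fun k => ((k : ℝ) + 1)⁻¹ with hεdef
  have hε : ∀ k, 0 < ε k := fun k => by positivity
  have hε0 : Tendsto ε atTop (𝓝 0) := by
    have := tendsto_one_div_add_atTop_nhds_zero_nat (𝕜 := ℝ)
    simpa [hεdef] using this
  set χ : ℕ → E → ℝ := fun k x => unitClamp ((ε k)⁻¹ * τ x) with hχ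
  have hχL : ∀ k, ∃ D, LipschitzWith D (χ k) := fun k =>
    ⟨_, lipschitzWith_unitClamp.comp ((lipschitzWith_smul (ε k)⁻¹).comp hτL)⟩
  set kk : (ℝ ∙ e)ᗮ → ℝ := fun w => ⟪e, v⟫_ℝ - fderiv ℝ φ w (P v) with hkk
  have hkm : Measurable kk :=
    measurable_const.sub ((measurable_fderiv ℝ φ).apply_continuousLinearMap _)
  have hkb : ∀ w, |kk w| ≤ ‖v‖ + K * ‖v‖ := fun w => by
    have h1 : |⟪e, v⟫_ℝ| ≤ ‖v‖ := by simpa [he] using abs_real_inner_le_norm e v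
    have h2 : ‖fderiv ℝ φ w (P v)‖ ≤ K * ‖v‖ :=
      ((fderiv ℝ φ w).le_opNorm _).trans (mul_le_mul (norm_fderiv_le_of_lipschitz ℝ hφ)
        (norm_orthogonalProjection_le _ _) (norm_nonneg _) K.2)
    exact (abs_sub _ _).trans (add_le_add h1 h2)
  -- integration by parts against the truncation
  have hibp : ∀ k, ∫ x, lineDeriv ℝ f x v * χ k x = ∫ p : (ℝ ∙ e)ᗮ × ℝ,
      -((Ioo (0 : ℝ) 1).indicator 1 p.2 * kk p.1 * f (graphFlow e φ (p.1, ε k * p.2))) := by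
    intro k
    obtain ⟨D, hD⟩ := hχL k
    have h1 := hD.integral_lineDeriv_mul_eq (μ := volume) hf hfc v
    simp only [lineDeriv_neg, neg_mul, integral_neg] at h1
    rw [← neg_eq_iff_eq_neg] at h1
    rw [← h1, integral_neg, neg_inj, integral_eq_integral_graphFlow_mul he hφ.continuous (hε k)]
    refine integral_congr_ae ?_
    have hne : ∀ a : ℝ, ∀ᵐ p : (ℝ ∙ e)ᗮ × ℝ, p.2 ≠ a := fun a =>
      quasiMeasurePreserving_snd.ae (Measure.ae_ne volume a)
    filter_upwards [ae_differentiableAt_fst hφ, hne 0, hne 1] with p hp hp0 hp1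
    have hPx : P (graphFlow e φ (p.1, ε k * p.2)) = p.1 :=
      orthogonalProjection_add_smul_unit _ _
    have hτx : τ (graphFlow e φ (p.1, ε k * p.2)) = ε k * p.2 := height_graphFlow he φ _
    have h2 := hasLineDerivAt_height (φ := φ) (x := graphFlow e φ (p.1, ε k * p.2))
      (by rw [← hP, hPx]; exact hp) v
    rw [← hP, hPx] at h2
    -- The chain rule is available off the heights 0 and 1, where the clamp has its kinks; these
    -- heights form a null set.
    have h3 : HasLineDerivAt ℝ (χ k) ((Ioo (0 : ℝ) 1).indicator 1 p.2 * ((ε k)⁻¹ * kk p.1))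
        (graphFlow e φ (p.1, ε k * p.2)) v := by
      have h4 : HasDerivAt (fun t : ℝ => (ε k)⁻¹ * τ (graphFlow e φ (p.1, ε k * p.2) + t • v))
        ((ε k)⁻¹ * kk p.1) 0 := HasDerivAt.const_mul _ h2
      have h5 : (ε k)⁻¹ * τ (graphFlow e φ (p.1, ε k * p.2) + (0 : ℝ) • v) = p.2 := by
        rw [zero_smul, add_zero, hτx, inv_mul_cancel_left₀ (hε k).ne']
      have h6 := hasDerivAt_unitClamp hp0 hp1
      rw [← h5] at h6
      have := h6.comp (0 : ℝ) h4
      rw [h5] at this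
      exact this
    rw [h3.lineDeriv]
    have := (hε k).ne'
    field_simp
  -- pass to the limit
  have hlim1 : Tendsto (fun k => ∫ x, lineDeriv ℝ f x v * χ k x) atTop
      (𝓝 (∫ x in U, lineDeriv ℝ f x v)) := by
    rw [← integral_indicator hUm]
    have hsupp : ∀ x, x ∉ tsupport f → lineDeriv ℝ f x v = 0 := by
      intro x hx
      have : f =ᶠ[𝓝 x] fun _ => 0 := notMem_tsupport_iff_eventuallyEq.1 hx
      rw [this.lineDeriv_eq]
      simp [lineDeriv]
    have hb : Integrable ((tsupport f).indicator fun _ => (C : ℝ) * ‖v‖) :=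
      (integrable_indicator_iff (isClosed_tsupport f).measurableSet).2
        (integrableOn_const hfc.isCompact.measure_lt_top.ne)
    refine tendsto_integral_of_dominated_convergence _ (fun k => ?_) hb (fun k => ?_) ?_
    · obtain ⟨D, hD⟩ := hχL k
      exact (aestronglyMeasurable_lineDeriv hfcont _).mul hD.continuous.aestronglyMeasurable
    · refine Eventually.of_forall fun x => ?_
      by_cases hx : x ∈ tsupport f
      · rw [indicator_of_mem hx, norm_mul]
        have h1 : ‖lineDeriv ℝ f x v‖ ≤ C * ‖v‖ := norm_lineDeriv_le_of_lipschitz ℝ hf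
        have h2 : ‖χ k x‖ ≤ 1 := by
          rw [Real.norm_eq_abs, abs_of_nonneg (unitClamp_nonneg _)]; exact unitClamp_le_one _
        nlinarith [norm_nonneg (lineDeriv ℝ f x v), norm_nonneg (χ k x)]
      · rw [indicator_of_notMem hx, hsupp x hx]; simp
    · refine Eventually.of_forall fun x => ?_
      by_cases hx : x ∈ U
      · rw [indicator_of_mem hx]
        have hx0 : 0 < τ x := sub_pos.2 hx
        refine tendsto_const_nhds.congr' ?_
        filter_upwards [hε0.eventually_lt_const hx0] with k hk
        have : χ k x = 1 := unitClamp_of_one_le (by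
          rw [← div_eq_inv_mul, le_div_iff₀ (hε k)]; linarith)
        rw [this, mul_one]
      · rw [indicator_of_notMem hx]
        have hx0 : τ x ≤ 0 := by
          have : ¬ (φ (P x) < ⟪e, x⟫_ℝ) := hx
          simp only [hτ]; linarith
        refine tendsto_const_nhds.congr fun k => ?_
        have : χ k x = 0 := unitClamp_of_nonpos
          (mul_nonpos_of_nonneg_of_nonpos (by have := hε k; positivity) hx0)
        rw [this, mul_zero]
  have hlim2 : Tendsto (fun k => ∫ p : (ℝ ∙ e)ᗮ × ℝ,
      -((Ioo (0 : ℝ) 1).indicator 1 p.2 * kk p.1 * f (graphFlow e φ (p.1, ε k * p.2)))) atTop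
      (𝓝 (∫ p : (ℝ ∙ e)ᗮ × ℝ,
        -((Ioo (0 : ℝ) 1).indicator 1 p.2 * kk p.1 * f (graphFlow e φ (p.1, 0))))) := by
    set B : Set ((ℝ ∙ e)ᗮ) := P '' tsupport f with hB
    have hBc : IsCompact B := hfc.isCompact.image P.continuous
    -- Flowing vertically does not change the projection, so for every ε the integrand is supported
    -- over the projection of the support of `f`.
    have hb : Integrable ((B ×ˢ Ioo (0 : ℝ) 1).indicator fun _ => (‖v‖ + K * ‖v‖) * M) := by
      refine (integrable_indicator_iff (hBc.measurableSet.prod measurableSet_Ioo)).2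
        (integrableOn_const ?_)
      rw [volume_eq_prod, prod_prod]
      exact (ENNReal.mul_lt_top hBc.measure_lt_top (by simp)).ne
    have hmeas : ∀ δ : ℝ, AEStronglyMeasurable (fun p : (ℝ ∙ e)ᗮ × ℝ =>
        -((Ioo (0 : ℝ) 1).indicator (1 : ℝ → ℝ) p.2 * kk p.1 *
          f (graphFlow e φ (p.1, δ * p.2)))) := by
      intro δ
      refine (((((measurable_one.indicator measurableSet_Ioo).comp measurable_snd).mul
        (hkm.comp measurable_fst)).mul ?_).neg).aestronglyMeasurable
      exact (hfcont.comp ((continuous_graphFlow hφ.continuous).comp (by fun_prop))).measurable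
    refine tendsto_integral_of_dominated_convergence _ (fun k => hmeas _) hb (fun k => ?_) ?_
    · refine Eventually.of_forall fun p => ?_
      rw [norm_neg, norm_mul, norm_mul]
      by_cases hp : p ∈ B ×ˢ Ioo (0 : ℝ) 1
      · rw [indicator_of_mem hp, indicator_of_mem hp.2]
        simp only [Pi.one_apply, norm_one, one_mul]
        exact mul_le_mul (hkb _) (hM _) (norm_nonneg _) (by positivity)
      · rw [indicator_of_notMem hp]
        refine le_of_eq ?_
        by_cases hp2 : p.2 ∈ Ioo (0 : ℝ) 1
        · have hx : graphFlow e φ (p.1, ε k * p.2) ∉ tsupport f := fun hx =>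
            hp ⟨⟨_, hx, orthogonalProjection_add_smul_unit _ _⟩, hp2⟩
          rw [image_eq_zero_of_notMem_tsupport hx]; simp
        · rw [indicator_of_notMem hp2]; simp
    · refine Eventually.of_forall fun p => ?_
      refine ((tendsto_const_nhds.mul ?_)).neg
      have hc : Continuous fun s : ℝ => f (graphFlow e φ (p.1, s * p.2)) :=
        hfcont.comp ((continuous_graphFlow hφ.continuous).comp (by fun_prop))
      have := (hc.tendsto 0).comp hε0
      simpa [Function.comp_def] using this
  have h := tendsto_nhds_unique (hlim1.congr hibp) hlim2
  rw [h, volume_eq_prod]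
  have : ∀ p : (ℝ ∙ e)ᗮ × ℝ,
      -((Ioo (0 : ℝ) 1).indicator (1 : ℝ → ℝ) p.2 * kk p.1 * f (graphFlow e φ (p.1, 0))) =
      (-kk p.1 * f ((p.1 : E) + φ p.1 • e)) * (Ioo (0 : ℝ) 1).indicator (1 : ℝ → ℝ) p.2 := by
    intro p
    simp only [graphFlow, zero_add]; ring
  simp_rw [this]
  rw [integral_prod_mul (fun w : (ℝ ∙ e)ᗮ => -kk w * f ((w : E) + φ w • e)),
    integral_indicator_one measurableSet_Ioo]
  simp [kk]

end GraphDomain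

/-! ### Surface measure and normal on a graph -/

section LocalDivergence

set_option linter.unusedSectionVars false

open Measure Module Filter Metric
open scoped NNReal ENNReal Topology

variable {E : Type*} [NormedAddCommGroup E] [InnerProductSpace ℝ E] [FiniteDimensional ℝ E]

/-- The parametrization of the graph of `φ`. -/
def graphMap (e : E) (φ : (ℝ ∙ e)ᗮ → ℝ) (w : (ℝ ∙ e)ᗮ) : E := (w : E) + φ w • e

/-- The downward unit normal to the graph of `φ` above `w`. -/
noncomputable def graphNormal (e : E) (φ : (ℝ ∙ e)ᗮ → ℝ) (w : (ℝ ∙ e)ᗮ) : E :=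
  (graphJacobian (fderiv ℝ φ w))⁻¹ •
    ((((InnerProductSpace.toDual ℝ (ℝ ∙ e)ᗮ).symm (fderiv ℝ φ w) : (ℝ ∙ e)ᗮ) : E) - e)

/-- The Jacobian cancels the normalization of the normal; this converts the boundary integrand over
the hyperplane into an integrand against surface measure. -/
theorem graphJacobian_mul_inner_graphNormal {e : E} (φ : (ℝ ∙ e)ᗮ → ℝ)
    (w : (ℝ ∙ e)ᗮ) (v : E) :
    graphJacobian (fderiv ℝ φ w) * ⟪v, graphNormal e φ w⟫_ℝ =
      fderiv ℝ φ w ((ℝ ∙ e)ᗮ.orthogonalProjectionOnto v) - ⟪e, v⟫_ℝ := by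
  have hJ : graphJacobian (fderiv ℝ φ w) ≠ 0 :=
    (zero_lt_one.trans_le (one_le_graphJacobian _)).ne'
  rw [graphNormal, inner_smul_right, mul_inv_cancel_left₀ hJ, inner_sub_right,
    real_inner_comm v e, ← InnerProductSpace.toDual_symm_apply (𝕜 := ℝ), real_inner_comm]
  congr 1
  exact (Submodule.inner_orthogonalProjectionOnto_eq_of_mem_left _ v).symm

theorem norm_graphNormal {e : E} (he : ‖e‖ = 1) (φ : (ℝ ∙ e)ᗮ → ℝ) (w : (ℝ ∙ e)ᗮ) :
    ‖graphNormal e φ w‖ = 1 := by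
  have hJ := one_le_graphJacobian (fderiv ℝ φ w)
  set a := (InnerProductSpace.toDual ℝ (ℝ ∙ e)ᗮ).symm (fderiv ℝ φ w) with ha
  have hn : ‖(a : E)‖ = ‖fderiv ℝ φ w‖ := by
    rw [Submodule.norm_coe, ha, LinearIsometryEquiv.norm_map]
  have hae : ⟪(a : E), e⟫_ℝ = 0 := Submodule.mem_orthogonal_singleton_iff_inner_left.1 a.2
  have h2 : ‖(a : E) - e‖ = graphJacobian (fderiv ℝ φ w) := by
    rw [← sq_eq_sq₀ (norm_nonneg _) (by linarith), norm_sub_sq_real, hae, hn, he,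
      graphJacobian_sq]
    ring
  rw [graphNormal, norm_smul, norm_inv, Real.norm_eq_abs, abs_of_nonneg (by linarith), ← ha, h2]
  exact inv_mul_cancel₀ (by linarith)

theorem dist_graphMap_sq {e : E} (he : ‖e‖ = 1) (φ : (ℝ ∙ e)ᗮ → ℝ) (v w : (ℝ ∙ e)ᗮ) :
    dist (graphMap e φ v) (graphMap e φ w) ^ 2 = ‖v - w‖ ^ 2 + (φ v - φ w) ^ 2 := by
  have h1 : graphMap e φ v - graphMap e φ w = ((v - w : (ℝ ∙ e)ᗮ) : E) + (φ v - φ w) • e := by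
    simp only [graphMap, Submodule.coe_sub, sub_smul]; abel
  have h2 : ⟪((v - w : (ℝ ∙ e)ᗮ) : E), e⟫_ℝ = 0 :=
    Submodule.mem_orthogonal_singleton_iff_inner_left.1 (v - w).2
  rw [dist_eq_norm, h1, norm_add_sq_real, inner_smul_right, h2, norm_smul, he, mul_one,
    Real.norm_eq_abs, sq_abs, Submodule.norm_coe]
  ring

theorem orthogonalProjection_graphMap {e : E} (φ : (ℝ ∙ e)ᗮ → ℝ) (w : (ℝ ∙ e)ᗮ) :
    (ℝ ∙ e)ᗮ.orthogonalProjectionOnto (graphMap e φ w) = w :=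
  orthogonalProjection_add_smul_unit w _

theorem inner_graphMap {e : E} (he : ‖e‖ = 1) (φ : (ℝ ∙ e)ᗮ → ℝ) (w : (ℝ ∙ e)ᗮ) :
    ⟪e, graphMap e φ w⟫_ℝ = φ w :=
  inner_add_smul_unit he w _

theorem graphMap_orthogonalProjection {e : E} (he : ‖e‖ = 1) {φ : (ℝ ∙ e)ᗮ → ℝ} {x : E}
    (h : φ ((ℝ ∙ e)ᗮ.orthogonalProjectionOnto x) = ⟪e, x⟫_ℝ) :
    graphMap e φ ((ℝ ∙ e)ᗮ.orthogonalProjectionOnto x) = x := by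
  rw [graphMap, h]; exact (eq_orthogonalProjection_add_smul he x).symm

theorem continuous_graphMap {e : E} {φ : (ℝ ∙ e)ᗮ → ℝ} (hφ : Continuous φ) :
    Continuous (graphMap e φ) := by
  unfold graphMap; fun_prop

variable [MeasurableSpace E] [BorelSpace E]

theorem measurableEmbedding_graphMap {e : E} {φ : (ℝ ∙ e)ᗮ → ℝ} (hφ : Continuous φ) :
    MeasurableEmbedding (graphMap e φ) :=
  (continuous_graphMap hφ).measurableEmbedding
    (Function.LeftInverse.injective (orthogonalProjection_graphMap φ))

/-- Surface measure on the graph of `φ`. -/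
noncomputable def graphMeasure (e : E) (φ : (ℝ ∙ e)ᗮ → ℝ) : Measure E :=
  ((volume : Measure (ℝ ∙ e)ᗮ).withDensity
    fun w => ENNReal.ofReal (graphJacobian (fderiv ℝ φ w))).map (graphMap e φ)

theorem measurable_graphJacobian_fderiv {e : E} (φ : (ℝ ∙ e)ᗮ → ℝ) :
    Measurable fun w => graphJacobian (fderiv ℝ φ w) :=
  continuous_graphJacobian.measurable.comp (measurable_fderiv ℝ φ)

theorem measurable_graphNormal {e : E} (φ : (ℝ ∙ e)ᗮ → ℝ) : Measurable (graphNormal e φ) := by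
  refine (measurable_graphJacobian_fderiv φ).inv.smul (Measurable.sub_const ?_ e)
  exact (continuous_subtype_val.comp
    (InnerProductSpace.toDual ℝ (ℝ ∙ e)ᗮ).symm.continuous).measurable.comp (measurable_fderiv ℝ φ)

theorem integral_graphMeasure {e : E} {φ : (ℝ ∙ e)ᗮ → ℝ} (hφ : Continuous φ) (F : E → ℝ) :
    ∫ x, F x ∂graphMeasure e φ = ∫ w, graphJacobian (fderiv ℝ φ w) * F (graphMap e φ w) := by
  rw [graphMeasure, (measurableEmbedding_graphMap hφ).integral_map]
  have := integral_withDensity_eq_integral_smul (μ := (volume : Measure (ℝ ∙ e)ᗮ))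
    (measurable_graphJacobian_fderiv φ).real_toNNReal (fun w => F (graphMap e φ w))
  refine this.trans ?_
  · refine integral_congr_ae (Eventually.of_forall fun w => ?_)
    simp only [NNReal.smul_def, smul_eq_mul]
    rw [Real.coe_toNNReal _ (zero_le_one.trans (one_le_graphJacobian _))]

theorem graphMeasure_eq [Nontrivial E] {e : E} (he : ‖e‖ = 1) (hE : 2 ≤ finrank ℝ E)
    {φ : (ℝ ∙ e)ᗮ → ℝ} {K : ℝ≥0} (hφ : LipschitzWith K φ) :
    graphMeasure e φ = (μHE[finrank ℝ E - 1]).restrict (range (graphMap e φ)) := by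
  have hrank : finrank ℝ (ℝ ∙ e)ᗮ = finrank ℝ E - 1 := by
    have h1 := (ℝ ∙ e).finrank_add_finrank_orthogonal
    rw [finrank_span_singleton (by rintro rfl; simp at he)] at h1
    omega
  have : Nontrivial (ℝ ∙ e)ᗮ := nontrivial_of_finrank_pos (R := ℝ) (by omega)
  have hemb := measurableEmbedding_graphMap hφ.continuous
  rw [graphMeasure, ← hemb.map_comap]
  congr 1
  ext s hs
  rw [withDensity_apply _ hs, hemb.comap_apply, ← hrank,
    euclideanHausdorffMeasure_image_graph hφ hemb (dist_graphMap_sq he φ) hs]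

/-- In the ball Ω is where the height τ is positive. Points with τ ≠ 0 have a neighbourhood on one
side, while moving from a zero of τ by t along `e` raises τ by exactly t. -/
theorem frontier_inter_ball {e : E} (he : ‖e‖ = 1) {φ : (ℝ ∙ e)ᗮ → ℝ} (hφ : Continuous φ)
    {Ω : Set E} {Q : E} {r : ℝ}
    (h : ∀ x ∈ ball Q r, x ∈ Ω ↔ φ ((ℝ ∙ e)ᗮ.orthogonalProjectionOnto x) < ⟪e, x⟫_ℝ) :
    ∀ x ∈ ball Q r, x ∈ frontier Ω ↔ x ∈ range (graphMap e φ) := by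
  intro x hx
  set τ : E → ℝ := fun z => ⟪e, z⟫_ℝ - φ ((ℝ ∙ e)ᗮ.orthogonalProjectionOnto z) with hτ
  have hτc : Continuous τ := by
    have := (ℝ ∙ e)ᗮ.orthogonalProjectionOnto.continuous
    simp only [hτ]; fun_prop
  have hiff : ∀ z ∈ ball Q r, z ∈ Ω ↔ 0 < τ z := fun z hz => by rw [h z hz]; simp [hτ]
  have hball := isOpen_ball.mem_nhds hx
  have hrange : x ∈ range (graphMap e φ) ↔ τ x = 0 := by
    constructor
    · rintro ⟨w, rfl⟩
      simp only [hτ]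
      rw [inner_graphMap he, orthogonalProjection_graphMap, sub_self]
    · intro h0
      exact ⟨_, graphMap_orthogonalProjection he (by simp only [hτ] at h0; linarith)⟩
  rw [hrange]
  constructor
  · intro hf
    rcases lt_trichotomy (τ x) 0 with h0 | h0 | h0
    · exfalso
      have : ∀ᶠ z in 𝓝 x, z ∉ Ω := by
        filter_upwards [hball, (isOpen_Iio.preimage hτc).mem_nhds h0] with z hz hz0
        rw [hiff z hz]; exact not_lt.2 (le_of_lt hz0)
      exact (mem_closure_iff_frequently.1 (frontier_subset_closure hf)) this
    · exact h0
    · exfalso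
      have : Ω ∈ 𝓝 x := by
        filter_upwards [hball, (isOpen_Ioi.preimage hτc).mem_nhds h0] with z hz hz0
        exact (hiff z hz).2 hz0
      exact hf.2 (mem_interior_iff_mem_nhds.2 this)
  · intro h0
    refine ⟨?_, fun hi => ?_⟩
    · rw [mem_closure_iff_seq_limit]
      have hcont : Tendsto (fun t : ℝ => x + t • e) (𝓝[>] 0) (𝓝 x) := by
        have : Continuous fun t : ℝ => x + t • e := by fun_prop
        simpa using (this.tendsto 0).mono_left nhdsWithin_le_nhds
      rw [← mem_closure_iff_seq_limit]
      refine mem_closure_of_tendsto hcont ?_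
      filter_upwards [hcont hball, self_mem_nhdsWithin] with t ht ht0
      rw [hiff _ ht]
      have : τ (x + t • e) = τ x + t := by
        simp only [hτ]
        rw [map_add, map_smul,
          Submodule.orthogonalProjectionOnto_orthogonalComplement_singleton_eq_zero, inner_add_right,
          inner_smul_right, real_inner_self_eq_norm_sq, he]
        simp; ring
      rw [this, h0, zero_add]; exact ht0
    · have := (hiff x hx).1 (interior_subset hi)
      exact this.ne' h0

end LocalDivergence

/-! ### Outward normals and boundary charts -/

section Normal

open Measure Module Filter Metric
open scoped NNReal ENNReal Topology

variable {n : ℕ}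

/-- For distinct unit vectors, ν' - ν has negative product with ν and positive product with ν'. A
short step from x in this direction would land both inside and outside Ω. -/
theorem IsOutwardUnitNormal.unique {Ω : Set (EuclideanSpace ℝ (Fin n))}
    {x ν ν' : EuclideanSpace ℝ (Fin n)} (h : IsOutwardUnitNormal Ω x ν)
    (h' : IsOutwardUnitNormal Ω x ν') : ν = ν' := by
  by_contra hne
  set d := ν' - ν with hd
  have hd0 : 0 < ‖d‖ := norm_pos_iff.2 (sub_ne_zero.2 (Ne.symm hne))
  have hdsq : ‖d‖ ^ 2 = 2 - 2 * ⟪ν', ν⟫_ℝ := by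
    rw [hd, norm_sub_sq_real, h.1, h'.1]; ring
  set c := 1 - ⟪ν', ν⟫_ℝ with hc
  have hc0 : 0 < c := by nlinarith
  have h1 : ⟪d, ν⟫_ℝ = -c := by
    rw [hd, inner_sub_left, real_inner_self_eq_norm_sq, h.1, hc]; ring
  have h2 : ⟪d, ν'⟫_ℝ = c := by
    rw [hd, inner_sub_left, real_inner_self_eq_norm_sq, h'.1, hc, real_inner_comm]; ring
  set ε := c / (2 * ‖d‖) with hε
  have hε0 : 0 < ε := by positivity
  have hεd : ε * ‖d‖ = c / 2 := by rw [hε]; field_simp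
  obtain ⟨r, hr, hr1⟩ := h.2 ε hε0
  obtain ⟨r', hr', hr2⟩ := h'.2 ε hε0
  set t := min r r' / (2 * ‖d‖) with ht
  have ht0 : 0 < t := by have := lt_min hr hr'; positivity
  have htd : t * ‖d‖ = min r r' / 2 := by rw [ht]; field_simp
  have hmin := lt_min hr hr'
  have hz : ‖x + t • d - x‖ = t * ‖d‖ := by
    rw [add_sub_cancel_left, norm_smul, Real.norm_eq_abs, abs_of_pos ht0]
  have hz1 : x + t • d ∈ ball x r := by
    rw [mem_ball, dist_eq_norm, hz, htd]; linarith [min_le_left r r']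
  have hz2 : x + t • d ∈ ball x r' := by
    rw [mem_ball, dist_eq_norm, hz, htd]; linarith [min_le_right r r']
  have hnorm : ε * ‖x + t • d - x‖ = t * (c / 2) := by rw [hz, ← hεd]; ring
  refine (hr2 _ hz2).2 ?_ ((hr1 _ hz1).1 ?_)
  · rw [hnorm, add_sub_cancel_left, real_inner_smul_left, h2]
    exact mul_lt_mul_of_pos_left (by linarith) ht0
  · rw [hnorm, add_sub_cancel_left, real_inner_smul_left, h1]
    nlinarith

theorem IsOutwardUnitNormal.outwardNormal_eq {Ω : Set (EuclideanSpace ℝ (Fin n))}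
    {x ν : EuclideanSpace ℝ (Fin n)} (h : IsOutwardUnitNormal Ω x ν) : outwardNormal Ω x = ν := by
  have hex : ∃ ν, IsOutwardUnitNormal Ω x ν := ⟨ν, h⟩
  rw [outwardNormal, dif_pos hex]
  exact hex.choose_spec.unique h

theorem norm_outwardNormal_le (Ω : Set (EuclideanSpace ℝ (Fin n)))
    (x : EuclideanSpace ℝ (Fin n)) : ‖outwardNormal Ω x‖ ≤ 1 := by
  by_cases hex : ∃ ν, IsOutwardUnitNormal Ω x ν
  · obtain ⟨ν, h⟩ := hex
    rw [h.outwardNormal_eq, h.1]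
  · rw [outwardNormal, dif_neg hex]; simp

/-- The data describing `Ω` inside a ball as a strict supergraph. -/
structure IsGraphChart (Ω : Set (EuclideanSpace ℝ (Fin n))) (Q : EuclideanSpace ℝ (Fin n))
    (r : ℝ) (e : EuclideanSpace ℝ (Fin n)) (K : ℝ≥0) (φ : (ℝ ∙ e)ᗮ → ℝ) : Prop where
  norm_eq_one : ‖e‖ = 1
  lipschitz : LipschitzWith K φ
  mem_iff : ∀ x ∈ ball Q r,
    x ∈ Ω ↔ φ ((ℝ ∙ e)ᗮ.orthogonalProjectionOnto x) < ⟪e, x⟫_ℝ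

namespace IsGraphChart

variable {Ω : Set (EuclideanSpace ℝ (Fin n))} {Q : EuclideanSpace ℝ (Fin n)}
    {r : ℝ} {e : EuclideanSpace ℝ (Fin n)} {K : ℝ≥0} {φ : (ℝ ∙ e)ᗮ → ℝ}

theorem mem_frontier_iff (h : IsGraphChart Ω Q r e K φ) {x} (hx : x ∈ ball Q r) :
    x ∈ frontier Ω ↔ x ∈ range (graphMap e φ) :=
  frontier_inter_ball h.norm_eq_one h.lipschitz.continuous h.mem_iff x hx

/-- The Jacobian times ⟨z - x, N⟩ is minus the height of z above the graph, up to the error in the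
first-order expansion of φ. That error is at most ε |z - x|, and the Jacobian is at least 1. -/
theorem isOutwardUnitNormal (h : IsGraphChart Ω Q r e K φ) {w : (ℝ ∙ e)ᗮ}
    (hw : graphMap e φ w ∈ ball Q r) (hd : DifferentiableAt ℝ φ w) :
    IsOutwardUnitNormal Ω (graphMap e φ w) (graphNormal e φ w) := by
  refine ⟨norm_graphNormal h.norm_eq_one φ w, fun ε hε => ?_⟩
  set x := graphMap e φ w with hx
  set P := (ℝ ∙ e)ᗮ.orthogonalProjectionOnto with hP
  have hPx : P x = w := orthogonalProjection_graphMap φ w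
  have hex : ⟪e, x⟫_ℝ = φ w := inner_graphMap h.norm_eq_one φ w
  have h1 : HasFDerivAt (fun z => φ (P z)) ((fderiv ℝ φ w).comp P) x := by
    have := hd.hasFDerivAt
    rw [← hPx] at this ⊢
    exact this.comp x P.hasFDerivAt
  have h2 := h1.isLittleO.def hε
  obtain ⟨δ, hδ, hδ'⟩ := Metric.eventually_nhds_iff_ball.1
    (h2.and (isOpen_ball.mem_nhds hw))
  refine ⟨δ, hδ, fun z hz => ?_⟩
  obtain ⟨h3, h4⟩ := hδ' z hz
  have hJ := one_le_graphJacobian (fderiv ℝ φ w)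
  have h5 := graphJacobian_mul_inner_graphNormal φ w (z - x)
  simp only [ContinuousLinearMap.comp_apply, Real.norm_eq_abs] at h3
  rw [hPx] at h3
  rw [← hP, inner_sub_right, hex] at h5
  rw [abs_le] at h3
  set J := graphJacobian (fderiv ℝ φ w)
  rw [h.mem_iff z h4, ← hP]
  have hn := mul_nonneg hε.le (norm_nonneg (z - x))
  constructor
  · intro hlt
    nlinarith [h3.1, h3.2]
  · intro hlt
    rw [not_lt]
    nlinarith [h3.1, h3.2]

theorem graphMeasure_restrict (h : IsGraphChart Ω Q r e K φ) (hn : 2 ≤ n) :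
    (surfaceMeasure Ω).restrict (ball Q r) = (graphMeasure e φ).restrict (ball Q r) := by
  have : Nontrivial (EuclideanSpace ℝ (Fin n)) :=
    nontrivial_of_finrank_pos (R := ℝ) (by simp; omega)
  rw [graphMeasure_eq h.norm_eq_one (by simpa using hn) h.lipschitz, surfaceMeasure,
    restrict_restrict measurableSet_ball, restrict_restrict measurableSet_ball,
    finrank_euclideanSpace_fin]
  congr 1
  ext x
  simp only [mem_inter_iff]
  exact and_congr_right fun hx => h.mem_frontier_iff hx

theorem ae_graphMeasure (h : IsGraphChart Ω Q r e K φ) :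
    ∀ᵐ x ∂graphMeasure e φ, graphMap e φ ((ℝ ∙ e)ᗮ.orthogonalProjectionOnto x) = x ∧
      DifferentiableAt ℝ φ ((ℝ ∙ e)ᗮ.orthogonalProjectionOnto x) := by
  rw [graphMeasure, (measurableEmbedding_graphMap h.lipschitz.continuous).ae_map_iff]
  refine (withDensity_absolutelyContinuous _ _).ae_le ?_
  filter_upwards [h.lipschitz.ae_differentiableAt (μ := volume)] with w hw
  rw [orthogonalProjection_graphMap]
  exact ⟨rfl, hw⟩

theorem ae_isOutwardUnitNormal (h : IsGraphChart Ω Q r e K φ) (hn : 2 ≤ n) :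
    ∀ᵐ x ∂(surfaceMeasure Ω).restrict (ball Q r), IsOutwardUnitNormal Ω x
      (graphNormal e φ ((ℝ ∙ e)ᗮ.orthogonalProjectionOnto x)) := by
  rw [h.graphMeasure_restrict hn]
  filter_upwards [ae_restrict_of_ae h.ae_graphMeasure, ae_restrict_mem measurableSet_ball]
    with x hx hxb
  have := h.isOutwardUnitNormal (w := (ℝ ∙ e)ᗮ.orthogonalProjectionOnto x) (by rwa [hx.1]) hx.2
  rwa [hx.1] at this

theorem aestronglyMeasurable_outwardNormal (h : IsGraphChart Ω Q r e K φ) (hn : 2 ≤ n) :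
    AEStronglyMeasurable (outwardNormal Ω) ((surfaceMeasure Ω).restrict (ball Q r)) := by
  refine ⟨fun x => graphNormal e φ ((ℝ ∙ e)ᗮ.orthogonalProjectionOnto x), ?_, ?_⟩
  · exact ((measurable_graphNormal φ).comp
      (ℝ ∙ e)ᗮ.orthogonalProjectionOnto.continuous.measurable).stronglyMeasurable
  · filter_upwards [h.ae_isOutwardUnitNormal hn] with x hx using hx.outwardNormal_eq

/-- The divergence theorem for Lipschitz functions supported in a chart. -/
theorem integral_lineDeriv (h : IsGraphChart Ω Q r e K φ) (hn : 2 ≤ n) (hΩ : MeasurableSet Ω)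
    {f : EuclideanSpace ℝ (Fin n) → ℝ} {C : ℝ≥0} (hf : LipschitzWith C f)
    (hfc : HasCompactSupport f) (hsupp : tsupport f ⊆ ball Q r) (v : EuclideanSpace ℝ (Fin n)) :
    ∫ x in Ω, lineDeriv ℝ f x v = ∫ x, f x * ⟪v, outwardNormal Ω x⟫_ℝ ∂surfaceMeasure Ω := by
  set P := (ℝ ∙ e)ᗮ.orthogonalProjectionOnto with hP
  have hzero : ∀ x ∉ ball Q r, f x = 0 := fun x hx =>
    image_eq_zero_of_notMem_tsupport fun hx' => hx (hsupp hx')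
  have hzero' : ∀ x ∉ ball Q r, lineDeriv ℝ f x v = 0 := fun x hx => by
    have : f =ᶠ[𝓝 x] fun _ => 0 :=
      notMem_tsupport_iff_eventuallyEq.1 fun hx' => hx (hsupp hx')
    rw [this.lineDeriv_eq]; simp [lineDeriv]
  have hU : MeasurableSet {x | φ (P x) < ⟪e, x⟫_ℝ} :=
    (isOpen_lt (h.lipschitz.continuous.comp P.continuous) (by fun_prop)).measurableSet
  have h1 : ∫ x in Ω, lineDeriv ℝ f x v =
      ∫ x in {x | φ (P x) < ⟪e, x⟫_ℝ}, lineDeriv ℝ f x v := by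
    rw [← integral_indicator hΩ, ← integral_indicator hU]
    refine integral_congr_ae (Eventually.of_forall fun x => ?_)
    by_cases hx : x ∈ ball Q r
    · simp only [indicator, h.mem_iff x hx]; rfl
    · simp only [indicator, hzero' x hx, ite_self]
  have h2 : ∫ x, f x * ⟪v, outwardNormal Ω x⟫_ℝ ∂surfaceMeasure Ω =
      ∫ x in ball Q r, f x * ⟪v, graphNormal e φ (P x)⟫_ℝ ∂graphMeasure e φ := by
    rw [← setIntegral_eq_integral_of_forall_compl_eq_zero (s := ball Q r)
      (fun x hx => by rw [hzero x hx, zero_mul]), ← h.graphMeasure_restrict hn]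
    refine integral_congr_ae ?_
    filter_upwards [h.ae_isOutwardUnitNormal hn] with x hx
    rw [hx.outwardNormal_eq]
  rw [h1, h2, setIntegral_eq_integral_of_forall_compl_eq_zero (s := ball Q r)
      (fun x hx => by rw [hzero x hx, zero_mul]), integral_graphMeasure h.lipschitz.continuous,
    integral_supergraph_lineDeriv h.norm_eq_one h.lipschitz hf hfc]
  refine integral_congr_ae (Eventually.of_forall fun w => ?_)
  simp only
  rw [orthogonalProjection_graphMap, mul_left_comm, graphJacobian_mul_inner_graphNormal, mul_comm]
  rfl

/-- A singular power of the distance to a point of the graph is integrable on the graph. -/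
theorem graphMeasure_lintegral_lt_top (h : IsGraphChart Ω Q r e K φ) {F : EuclideanSpace ℝ (Fin n) → ℝ≥0∞}
    (hF : Measurable F) {G : (ℝ ∙ e)ᗮ → ℝ≥0∞} (hG : Measurable G)
    (hFG : ∀ w, graphMap e φ w ∈ ball Q r → F (graphMap e φ w) ≤ G w)
    (hGint : ∫⁻ w in ball ((ℝ ∙ e)ᗮ.orthogonalProjectionOnto Q) r, G w < ⊤) :
    ∫⁻ x in ball Q r, F x ∂graphMeasure e φ < ⊤ := by
  have hemb := measurableEmbedding_graphMap h.lipschitz.continuous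
  rw [graphMeasure, hemb.restrict_map, hemb.lintegral_map,
    restrict_withDensity (hemb.measurable measurableSet_ball),
    lintegral_withDensity_eq_lintegral_mul _ (measurable_graphJacobian_fderiv φ).ennreal_ofReal
      (g := fun w => F (graphMap e φ w)) (hF.comp hemb.measurable)]
  -- The density is at most √(1 + K²), and the projection is a contraction, so the part of the graph
  -- in the ball lies over a ball of the same radius.
  calc _ ≤ ∫⁻ w in graphMap e φ ⁻¹' ball Q r, ENNReal.ofReal √(1 + K ^ 2) * G w := by
        refine setLIntegral_mono (measurable_const.mul hG) fun w hw => ?_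
        refine mul_le_mul' (ENNReal.ofReal_le_ofReal (Real.sqrt_le_sqrt ?_)) (hFG w hw)
        have := norm_fderiv_le_of_lipschitz ℝ h.lipschitz (x₀ := w)
        gcongr
    _ ≤ ∫⁻ w in ball ((ℝ ∙ e)ᗮ.orthogonalProjectionOnto Q) r,
          ENNReal.ofReal √(1 + K ^ 2) * G w := by
        refine lintegral_mono_set fun w hw => ?_
        rw [mem_preimage, mem_ball, dist_eq_norm] at hw
        rw [mem_ball, dist_eq_norm]
        refine lt_of_le_of_lt ?_ hw
        conv_lhs => rw [← orthogonalProjection_graphMap φ w, ← map_sub]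
        exact norm_orthogonalProjection_le _ _
    _ < ⊤ := by
        rw [lintegral_const_mul _ hG]
        exact ENNReal.mul_lt_top ENNReal.ofReal_lt_top hGint

end IsGraphChart

theorem IsBoundedLipschitzDomain.exists_chart {Ω : Set (EuclideanSpace ℝ (Fin n))}
    (hΩ : IsBoundedLipschitzDomain Ω) {Q : EuclideanSpace ℝ (Fin n)} (hQ : Q ∈ frontier Ω) :
    ∃ r : ℝ, 0 < r ∧ ∃ e K φ, IsGraphChart Ω Q r e K φ := by
  obtain ⟨r, hr, e, he, K, φ, hφ, h⟩ := hΩ.lipschitz_boundary Q hQ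
  exact ⟨r, hr, e, K, φ, he, hφ, h⟩

end Normal

/-! ### Divergence theorem on bounded Lipschitz domains -/

section GlobalDivergence

open Measure Module Filter Metric
open scoped NNReal ENNReal Topology

theorem integrableOn_ball_norm_sub_rpow {E : Type*} [NormedAddCommGroup E] [NormedSpace ℝ E]
    [FiniteDimensional ℝ E] [MeasurableSpace E] [BorelSpace E] {μ : Measure E}
    [μ.IsAddHaarMeasure] (hd : 1 ≤ finrank ℝ E) {β : ℝ} (hβ : -(finrank ℝ E : ℝ) < β)
    (y : E) (r : ℝ) : IntegrableOn (fun x => ‖x - y‖ ^ β) (ball y r) μ := by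
  have h0 : IntegrableOn (fun x : E => ‖x‖ ^ β) (ball 0 r) μ := by
    refine integrableOn_ball_of_norm_le_rpow (C := 1) (α := -β) hd (by linarith)
      (Eventually.of_forall fun x => ?_) ?_
    · rw [neg_neg, one_mul, Real.norm_of_nonneg (by positivity)]
    · exact (measurable_norm.pow_const β).aestronglyMeasurable
  have h1 := (measurePreserving_sub_right μ y).integrableOn_comp_preimage
    (MeasurableEquiv.subRight y).measurableEmbedding (f := fun x => ‖x‖ ^ β) (s := ball 0 r)
  have h2 : (fun x => x - y) ⁻¹' ball 0 r = ball y r := by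
    ext x; simp [dist_eq_norm]
  rw [h2] at h1
  exact h1.2 h0

theorem exists_mem_segment_frontier {E : Type*} [NormedAddCommGroup E] [NormedSpace ℝ E]
    {Ω : Set E} (hΩ : IsOpen Ω) {x z : E} (hx : x ∈ Ω) (hz : z ∉ Ω) :
    ∃ p ∈ segment ℝ x z, p ∈ frontier Ω := by
  by_contra! hcon
  have hseg : IsPreconnected (segment ℝ x z) := (convex_segment x z).isPreconnected
  have hcov : segment ℝ x z ⊆ Ω ∪ (closure Ω)ᶜ := fun p hp => by
    by_cases hpc : p ∈ closure Ω
    · left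
      by_contra hpo
      exact hcon p hp ⟨hpc, by rwa [hΩ.interior_eq]⟩
    · exact Or.inr hpc
  have hz' : z ∈ (closure Ω)ᶜ :=
    (hcov (right_mem_segment ℝ x z)).resolve_left hz
  obtain ⟨p, -, hp1, hp2⟩ := hseg Ω (closure Ω)ᶜ hΩ isClosed_closure.isOpen_compl hcov
    ⟨x, left_mem_segment ℝ x z, hx⟩ ⟨z, right_mem_segment ℝ x z, hz'⟩
  exact hp2 (subset_closure hp1)

/-- A segment from inside Ω to outside meets the frontier, where the function vanishes, so the value
at the inner end is controlled by the length of the segment. -/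
theorem LipschitzWith.indicator_of_frontier {E : Type*} [NormedAddCommGroup E] [NormedSpace ℝ E]
    {Ω : Set E} (hΩ : IsOpen Ω) {f : E → ℝ} {C : ℝ≥0} (hf : LipschitzWith C f)
    (h0 : ∀ x ∈ frontier Ω, f x = 0) : LipschitzWith C (Ω.indicator f) := by
  have key : ∀ x ∈ Ω, ∀ z ∉ Ω, |f x| ≤ C * ‖x - z‖ := fun x hx z hz => by
    obtain ⟨p, hp, hpf⟩ := exists_mem_segment_frontier hΩ hx hz
    have h1 := hf.dist_le_mul x p
    rw [h0 p hpf, dist_eq_norm, sub_zero, dist_eq_norm] at h1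
    refine h1.trans (mul_le_mul_of_nonneg_left ?_ C.2)
    obtain ⟨a, b, ha, hb, hab, rfl⟩ := hp
    have h2 : x - (a • x + b • z) = b • (x - z) := by
      rw [← eq_sub_iff_add_eq] at hab; rw [hab]; module
    rw [h2, norm_smul, Real.norm_of_nonneg hb]
    exact mul_le_of_le_one_left (norm_nonneg _) (by linarith)
  refine LipschitzWith.of_dist_le_mul fun x z => ?_
  by_cases hx : x ∈ Ω <;> by_cases hz : z ∈ Ω
  · rw [indicator_of_mem hx, indicator_of_mem hz]; exact hf.dist_le_mul x z
  · rw [indicator_of_mem hx, indicator_of_notMem hz, dist_eq_norm, dist_eq_norm, sub_zero]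
    exact key x hx z hz
  · rw [indicator_of_notMem hx, indicator_of_mem hz, dist_comm, dist_comm x, dist_eq_norm,
      dist_eq_norm, sub_zero]
    exact key z hz x hx
  · rw [indicator_of_notMem hx, indicator_of_notMem hz, dist_self]; positivity

/-- A Lipschitz `f` may be unbounded, but only its values on the bounded support of `b` matter. The
product difference is split so that `f` is evaluated at a point of that ball. -/
theorem LipschitzWith.exists_mul_cutoff {X : Type*} [MetricSpace X] {f b : X → ℝ} {C D : ℝ≥0}
    (hf : LipschitzWith C f) (hb : LipschitzWith D b) (hb1 : ∀ x, |b x| ≤ 1) {Q : X} {R : ℝ}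
    (hR : 0 ≤ R) (hb0 : ∀ x ∉ ball Q R, b x = 0) : ∃ C', LipschitzWith C' fun x => f x * b x := by
  set M : ℝ := |f Q| + C * R with hM
  have hM0 : 0 ≤ M := by positivity
  have hfM : ∀ x ∈ ball Q R, |f x| ≤ M := fun x hx => by
    have h1 := hf.dist_le_mul x Q
    rw [Real.dist_eq] at h1
    have h2 : |f x| ≤ |f x - f Q| + |f Q| := by
      have := abs_add_le (f x - f Q) (f Q); rwa [sub_add_cancel] at this
    have h3 : (C : ℝ) * dist x Q ≤ C * R := mul_le_mul_of_nonneg_left (le_of_lt hx) C.2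
    linarith
  have key : ∀ x z, x ∈ ball Q R → |f x * b x - f z * b z| ≤ (M * D + C) * dist x z := by
    intro x z hx
    have h1 := hf.dist_le_mul x z
    have h2 := hb.dist_le_mul x z
    rw [Real.dist_eq] at h1 h2
    have h3 : f x * b x - f z * b z = f x * (b x - b z) + (f x - f z) * b z := by ring
    rw [h3]
    refine (abs_add_le _ _).trans ?_
    rw [abs_mul, abs_mul]
    have h4 := mul_le_mul (hfM x hx) h2 (abs_nonneg _) hM0
    have h5 := mul_le_mul h1 (hb1 z) (abs_nonneg _) (by positivity)
    linarith
  refine ⟨(M * D + C).toNNReal, LipschitzWith.of_dist_le_mul fun x z => ?_⟩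
  rw [Real.dist_eq, Real.coe_toNNReal _ (by positivity)]
  by_cases hx : x ∈ ball Q R
  · exact key x z hx
  by_cases hz : z ∈ ball Q R
  · rw [abs_sub_comm, dist_comm]; exact key z x hz
  · rw [hb0 x hx, hb0 z hz]; simp; positivity

variable {n : ℕ} {Ω : Set (EuclideanSpace ℝ (Fin n))}

namespace IsBoundedLipschitzDomain

theorem isCompact_closure (hΩ : IsBoundedLipschitzDomain Ω) : IsCompact (closure Ω) :=
  hΩ.isBounded.isCompact_closure

theorem isCompact_frontier (hΩ : IsBoundedLipschitzDomain Ω) : IsCompact (frontier Ω) :=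
  hΩ.isCompact_closure.of_isClosed_subset isClosed_frontier frontier_subset_closure

theorem disjoint_frontier (hΩ : IsBoundedLipschitzDomain Ω) {x} (hx : x ∈ frontier Ω) : x ∉ Ω := by
  have := hx.2; rwa [hΩ.isOpen.interior_eq] at this

theorem surfaceMeasure_restrict_frontier (Ω : Set (EuclideanSpace ℝ (Fin n))) :
    (surfaceMeasure Ω).restrict (frontier Ω) = surfaceMeasure Ω := by
  rw [surfaceMeasure, restrict_restrict isClosed_frontier.measurableSet, inter_self]

theorem isFiniteMeasure_surfaceMeasure (hΩ : IsBoundedLipschitzDomain Ω) (hn : 2 ≤ n) :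
    IsFiniteMeasure (surfaceMeasure Ω) := by
  refine ⟨?_⟩
  have h : surfaceMeasure Ω (frontier Ω) < ⊤ := by
    refine hΩ.isCompact_frontier.measure_lt_top_of_nhdsWithin fun Q hQ => ?_
    obtain ⟨r, hr, e, K, φ, hc⟩ := hΩ.exists_chart hQ
    refine ⟨ball Q r, mem_nhdsWithin_of_mem_nhds (ball_mem_nhds Q hr), ?_⟩
    have h1 := hc.graphMeasure_lintegral_lt_top (F := 1) measurable_one (G := 1) measurable_one
      (fun _ _ => le_rfl) (by simpa using measure_ball_lt_top)
    rw [← hc.graphMeasure_restrict hn] at h1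
    simpa using h1
  rw [← surfaceMeasure_restrict_frontier]
  simpa using h

/-- A set of finite (n - 1)-dimensional measure is null in dimension n. -/
theorem volume_frontier (hΩ : IsBoundedLipschitzDomain Ω) (hn : 2 ≤ n) :
    volume (frontier Ω) = 0 := by
  have := hΩ.isFiniteMeasure_surfaceMeasure hn
  have h1 : μHE[n - 1] (frontier Ω) ≠ ⊤ := by
    have := measure_ne_top (surfaceMeasure Ω) univ
    simpa [surfaceMeasure] using this
  have h2 := (euclideanHausdorffMeasure_zero_or_top (by omega : n - 1 < n) (frontier Ω)).resolve_right h1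
  rwa [EuclideanSpace.euclideanHausdorffMeasure_eq_volume] at h2

theorem surfaceMeasure_singleton (hn : 2 ≤ n) (Ω : Set (EuclideanSpace ℝ (Fin n)))
    (y : EuclideanSpace ℝ (Fin n)) : surfaceMeasure Ω {y} = 0 := by
  refine le_antisymm ((restrict_apply_le _ _).trans ?_) zero_le
  rw [euclideanHausdorffMeasure_def, Measure.smul_apply]
  have := nullSingletonClass_hausdorff (EuclideanSpace ℝ (Fin n)) (d := ((n - 1 : ℕ) : ℝ))
    (by exact_mod_cast (by omega : 0 < n - 1))
  rw [measure_singleton]; simp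

theorem ae_ne_surfaceMeasure (hn : 2 ≤ n) (Ω : Set (EuclideanSpace ℝ (Fin n)))
    (y : EuclideanSpace ℝ (Fin n)) : ∀ᵐ x ∂surfaceMeasure Ω, x ≠ y := by
  rw [ae_iff]; simpa using surfaceMeasure_singleton hn Ω y

theorem ae_mem_frontier (Ω : Set (EuclideanSpace ℝ (Fin n))) :
    ∀ᵐ x ∂surfaceMeasure Ω, x ∈ frontier Ω :=
  ae_restrict_mem isClosed_frontier.measurableSet

theorem aestronglyMeasurable_outwardNormal (hΩ : IsBoundedLipschitzDomain Ω) (hn : 2 ≤ n) :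
    AEStronglyMeasurable (outwardNormal Ω) (surfaceMeasure Ω) := by
  rw [← surfaceMeasure_restrict_frontier]
  refine hΩ.isCompact_frontier.induction_on
    (p := fun s => AEStronglyMeasurable (outwardNormal Ω) ((surfaceMeasure Ω).restrict s))
    (by simp) (fun s t hst h => h.mono_measure (restrict_mono hst le_rfl))
    (fun s t hs ht => aestronglyMeasurable_union_iff.2 ⟨hs, ht⟩) fun Q hQ => ?_
  obtain ⟨r, hr, e, K, φ, hc⟩ := hΩ.exists_chart hQ
  exact ⟨ball Q r, mem_nhdsWithin_of_mem_nhds (ball_mem_nhds Q hr),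
    hc.aestronglyMeasurable_outwardNormal hn⟩

theorem ae_isOutwardUnitNormal (hΩ : IsBoundedLipschitzDomain Ω) (hn : 2 ≤ n) :
    ∀ᵐ x ∂surfaceMeasure Ω, IsOutwardUnitNormal Ω x (outwardNormal Ω x) := by
  rw [← surfaceMeasure_restrict_frontier]
  refine hΩ.isCompact_frontier.induction_on
    (p := fun s => ∀ᵐ x ∂(surfaceMeasure Ω).restrict s,
      IsOutwardUnitNormal Ω x (outwardNormal Ω x))
    (by simp) (fun s t hst h => ae_restrict_of_ae_restrict_of_subset hst h)
    (fun s t hs ht => (ae_restrict_union_iff s t _).2 ⟨hs, ht⟩) fun Q hQ => ?_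
  obtain ⟨r, hr, e, K, φ, hc⟩ := hΩ.exists_chart hQ
  refine ⟨ball Q r, mem_nhdsWithin_of_mem_nhds (ball_mem_nhds Q hr), ?_⟩
  filter_upwards [hc.ae_isOutwardUnitNormal hn] with x hx
  rwa [hx.outwardNormal_eq]

theorem integrable_mul_inner_outwardNormal (hΩ : IsBoundedLipschitzDomain Ω) (hn : 2 ≤ n)
    {f : EuclideanSpace ℝ (Fin n) → ℝ} (hf : Integrable f (surfaceMeasure Ω))
    (v : EuclideanSpace ℝ (Fin n)) :
    Integrable (fun x => f x * ⟪v, outwardNormal Ω x⟫_ℝ) (surfaceMeasure Ω) := by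
  refine hf.mul_bdd (c := ‖v‖) ?_ (Eventually.of_forall fun x => ?_)
  · exact aestronglyMeasurable_const.inner (hΩ.aestronglyMeasurable_outwardNormal hn)
  · refine (norm_inner_le_norm _ _).trans ?_
    exact mul_le_of_le_one_right (norm_nonneg _) (norm_outwardNormal_le Ω x)

theorem integrable_of_continuousOn (hΩ : IsBoundedLipschitzDomain Ω) (hn : 2 ≤ n)
    {f : EuclideanSpace ℝ (Fin n) → ℝ} (hf : ContinuousOn f (frontier Ω)) :
    Integrable f (surfaceMeasure Ω) := by
  have := hΩ.isFiniteMeasure_surfaceMeasure hn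
  rw [← surfaceMeasure_restrict_frontier]
  exact hf.integrableOn_compact' hΩ.isCompact_frontier isClosed_frontier.measurableSet

theorem volume_lt_top (hΩ : IsBoundedLipschitzDomain Ω) : volume Ω < ⊤ :=
  hΩ.isBounded.measure_lt_top

theorem integrableOn_lineDeriv (hΩ : IsBoundedLipschitzDomain Ω)
    {f : EuclideanSpace ℝ (Fin n) → ℝ} {C : ℝ≥0} (hf : LipschitzWith C f)
    (v : EuclideanSpace ℝ (Fin n)) : IntegrableOn (fun x => lineDeriv ℝ f x v) Ω :=
  Measure.integrableOn_of_bounded hΩ.volume_lt_top.ne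
    (aestronglyMeasurable_lineDeriv hf.continuous _)
    (Eventually.of_forall fun _ => norm_lineDeriv_le_of_lipschitz ℝ hf)

/-- The extension by zero is Lipschitz with compact support on the whole space, so its derivative
integrates to zero; the frontier, where the two derivatives may differ, is null. -/
theorem integral_lineDeriv_of_frontier (hΩ : IsBoundedLipschitzDomain Ω) (hn : 2 ≤ n)
    {f : EuclideanSpace ℝ (Fin n) → ℝ} {C : ℝ≥0} (hf : LipschitzWith C f)
    (h0 : ∀ x ∈ frontier Ω, f x = 0) (v : EuclideanSpace ℝ (Fin n)) :
    ∫ x in Ω, lineDeriv ℝ f x v = 0 := by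
  set g := Ω.indicator f with hg
  have hgL : LipschitzWith C g := hf.indicator_of_frontier hΩ.isOpen h0
  have hgc : HasCompactSupport g := by
    refine HasCompactSupport.intro hΩ.isCompact_closure fun x hx => ?_
    exact indicator_of_notMem (fun hx' => hx (subset_closure hx')) _
  -- Integration by parts against the constant 1, in direction -v because the formula reverses the
  -- direction.
  have h2 := (LipschitzWith.const (1 : ℝ) : LipschitzWith 0 fun _ : EuclideanSpace ℝ (Fin n) =>
    (1 : ℝ)).integral_lineDeriv_mul_eq (μ := volume) hgL hgc (-v)
  have hconst : ∀ (c : ℝ) (x w : EuclideanSpace ℝ (Fin n)), lineDeriv ℝ (fun _ => c) x w = 0 :=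
    fun c x w => by simp [lineDeriv]
  simp only [hconst, zero_mul, integral_zero, neg_neg, mul_one] at h2
  rw [h2, ← integral_indicator hΩ.isOpen.measurableSet]
  refine integral_congr_ae ?_
  have hfr : ∀ᵐ x : EuclideanSpace ℝ (Fin n), x ∉ frontier Ω :=
    measure_eq_zero_iff_ae_notMem.1 (hΩ.volume_frontier hn)
  filter_upwards [hfr] with x hx
  by_cases hxΩ : x ∈ Ω
  · rw [indicator_of_mem hxΩ]
    refine EventuallyEq.lineDeriv_eq ?_
    filter_upwards [hΩ.isOpen.mem_nhds hxΩ] with z hz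
    rw [hg, indicator_of_mem hz]
  · rw [indicator_of_notMem hxΩ]
    have hxc : x ∈ (closure Ω)ᶜ := fun hxc => hx ⟨hxc, by rwa [hΩ.isOpen.interior_eq]⟩
    have : g =ᶠ[𝓝 x] fun _ => 0 := by
      filter_upwards [isClosed_closure.isOpen_compl.mem_nhds hxc] with z hz
      exact indicator_of_notMem (fun hz' => hz (subset_closure hz')) _
    rw [this.lineDeriv_eq, hconst]

/-- The divergence theorem on a bounded Lipschitz domain for Lipschitz functions. -/
theorem integral_lineDeriv (hΩ : IsBoundedLipschitzDomain Ω) (hn : 2 ≤ n)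
    {f : EuclideanSpace ℝ (Fin n) → ℝ} {C : ℝ≥0} (hf : LipschitzWith C f)
    (v : EuclideanSpace ℝ (Fin n)) :
    ∫ x in Ω, lineDeriv ℝ f x v = ∫ x, f x * ⟪v, outwardNormal Ω x⟫_ℝ ∂surfaceMeasure Ω := by
  have hex : ∀ Q, ∃ r : ℝ, Q ∈ frontier Ω → 0 < r ∧ ∃ e K φ, IsGraphChart Ω Q r e K φ := fun Q => by
    by_cases hQ : Q ∈ frontier Ω
    · obtain ⟨r, h⟩ := hΩ.exists_chart hQ
      exact ⟨r, fun _ => h⟩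
    · exact ⟨0, fun h => absurd h hQ⟩
  choose R hR using hex
  -- Induction on a finite family of half-radius balls outside which `f` vanishes on the frontier.
  -- One cutoff splits `f` into a piece supported in a chart and a remainder needing one ball fewer.
  -- With no ball left, the extension by zero applies.
  have main : ∀ (s : Finset (EuclideanSpace ℝ (Fin n))), (∀ Q ∈ s, Q ∈ frontier Ω) →
      ∀ (f : EuclideanSpace ℝ (Fin n) → ℝ) (C : ℝ≥0), LipschitzWith C f →
      (∀ x ∈ frontier Ω, (∀ Q ∈ s, x ∉ ball Q (R Q / 2)) → f x = 0) →
      ∫ x in Ω, lineDeriv ℝ f x v =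
        ∫ x, f x * ⟪v, outwardNormal Ω x⟫_ℝ ∂surfaceMeasure Ω := by
    intro s
    induction s using Finset.induction_on with
    | empty =>
      intro _ f C hf h0
      have h0' : ∀ x ∈ frontier Ω, f x = 0 := fun x hx => h0 x hx (by simp)
      rw [hΩ.integral_lineDeriv_of_frontier hn hf h0']
      symm
      refine integral_eq_zero_of_ae ?_
      filter_upwards [ae_mem_frontier Ω] with x hx
      rw [h0' x hx]; simp
    | insert Q s hQs ih =>
      intro hs f C hf h0
      obtain ⟨hr, e, K, φ, hc⟩ := hR Q (hs Q (Finset.mem_insert_self _ _))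
      set r := R Q
      -- The clamped affine function of the distance equals 1 up to r/2 and 0 beyond 3r/4, so the
      -- closed support stays inside the chart.
      set b : EuclideanSpace ℝ (Fin n) → ℝ := fun x => unitClamp (3 - 4 / r * dist x Q) with hb
      have hbL : LipschitzWith (1 * (0 + ‖(4 / r : ℝ)‖₊ * 1)) b :=
        lipschitzWith_unitClamp.comp ((LipschitzWith.const (3 : ℝ)).sub
          ((lipschitzWith_smul (4 / r : ℝ)).comp (LipschitzWith.dist_left Q)))
      have hb1 : ∀ x, |b x| ≤ 1 := fun x => by
        rw [abs_of_nonneg (unitClamp_nonneg _)]; exact unitClamp_le_one _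
      have hbin : ∀ x ∈ ball Q (r / 2), b x = 1 := fun x hx => by
        refine unitClamp_of_one_le ?_
        have : 4 / r * dist x Q ≤ 4 / r * (r / 2) :=
          mul_le_mul_of_nonneg_left (le_of_lt hx) (by positivity)
        have h2 : 4 / r * (r / 2) = 2 := by field_simp; norm_num
        linarith
      have hbout : ∀ x ∉ ball Q (3 / 4 * r), b x = 0 := fun x hx => by
        refine unitClamp_of_nonpos ?_
        rw [mem_ball, not_lt] at hx
        have : 4 / r * (3 / 4 * r) ≤ 4 / r * dist x Q :=
          mul_le_mul_of_nonneg_left hx (by positivity)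
        have h2 : 4 / r * (3 / 4 * r) = 3 := by field_simp
        linarith
      obtain ⟨C₁, h₁⟩ := hf.exists_mul_cutoff hbL hb1 (by positivity) hbout
      have h₂ := hf.sub h₁
      have hts : tsupport (fun x => f x * b x) ⊆ closedBall Q (3 / 4 * r) := by
        refine closure_minimal (fun x hx => ?_) isClosed_closedBall
        by_contra hx'
        exact hx (by
          simp only
          rw [hbout x (fun h => hx' (ball_subset_closedBall h)), mul_zero])
      have e₁ := hc.integral_lineDeriv hn hΩ.isOpen.measurableSet h₁
        ((isCompact_closedBall Q (3 / 4 * r)).of_isClosed_subset (isClosed_tsupport _) hts)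
        (hts.trans (closedBall_subset_ball (by linarith))) v
      have e₂ := ih (fun Q hQ => hs Q (Finset.mem_insert_of_mem hQ)) _ _ h₂ (fun x hx hxs => by
        by_cases hxQ : x ∈ ball Q (r / 2)
        · simp [hbin x hxQ]
        · rw [h0 x hx ?_]; · simp
          intro Q' hQ'
          rcases Finset.mem_insert.1 hQ' with rfl | hQ'
          · exact hxQ
          · exact hxs Q' hQ')
      have i₁ := hΩ.integrable_mul_inner_outwardNormal hn
        (hΩ.integrable_of_continuousOn hn h₁.continuous.continuousOn) v
      have i₂ := hΩ.integrable_mul_inner_outwardNormal hn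
        (hΩ.integrable_of_continuousOn hn h₂.continuous.continuousOn) v
      have hL : ∫ x in Ω, lineDeriv ℝ f x v = (∫ x in Ω, lineDeriv ℝ (fun x => f x * b x) x v) +
          ∫ x in Ω, lineDeriv ℝ (fun x => f x - f x * b x) x v := by
        rw [← integral_add (hΩ.integrableOn_lineDeriv h₁ v) (hΩ.integrableOn_lineDeriv h₂ v)]
        refine integral_congr_ae (ae_restrict_of_ae ?_)
        filter_upwards [h₁.ae_lineDifferentiableAt (μ := volume) v,
          h₂.ae_lineDifferentiableAt (μ := volume) v] with x hx1 hx2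
        have h3 : HasLineDerivAt ℝ (fun x => f x * b x + (f x - f x * b x)) _ x v :=
          HasDerivAt.add hx1.hasLineDerivAt hx2.hasLineDerivAt
        rw [← h3.lineDeriv]
        congr 1
        ext z; ring
      rw [hL, e₁, e₂, ← integral_add i₁ i₂]
      refine integral_congr_ae (Eventually.of_forall fun x => ?_)
      simp only; ring
  obtain ⟨s, hs, hcov⟩ := hΩ.isCompact_frontier.elim_nhds_subcover (fun Q => ball Q (R Q / 2))
    (fun Q hQ => ball_mem_nhds Q (half_pos (hR Q hQ).1))
  refine main s hs f C hf fun x hx hxs => ?_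
  obtain ⟨Q, hQ, hxQ⟩ := mem_iUnion₂.1 (hcov hx)
  exact absurd hxQ (hxs Q hQ)

/-- Powers of the distance to a point are integrable on the boundary. -/
theorem integrable_norm_sub_rpow (hΩ : IsBoundedLipschitzDomain Ω) (hn : 2 ≤ n) {β : ℝ}
    {y : EuclideanSpace ℝ (Fin n)} (hy : y ∈ frontier Ω → -((n : ℝ) - 1) < β) :
    Integrable (fun x => ‖x - y‖ ^ β) (surfaceMeasure Ω) := by
  have := hΩ.isFiniteMeasure_surfaceMeasure hn
  have hmeas : Measurable fun x : EuclideanSpace ℝ (Fin n) => ‖x - y‖ ^ β :=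
    (measurable_id.sub_const y).norm.pow_const β
  rw [← surfaceMeasure_restrict_frontier]
  refine LocallyIntegrableOn.integrableOn_isCompact (fun Q hQ => ?_) hΩ.isCompact_frontier
  by_cases hQy : Q = y
  · subst hQy
    obtain ⟨r, hr, e, K, φ, hc⟩ := hΩ.exists_chart hQ
    refine ⟨ball Q r, mem_nhdsWithin_of_mem_nhds (ball_mem_nhds Q hr), hmeas.aestronglyMeasurable, ?_⟩
    rw [hasFiniteIntegral_iff_enorm, hc.graphMeasure_restrict hn]
    set P := (ℝ ∙ e)ᗮ.orthogonalProjectionOnto with hP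
    obtain ⟨w₀, hw₀⟩ := (hc.mem_frontier_iff (mem_ball_self hr)).1 hQ
    have hPQ : P Q = w₀ := by rw [← hw₀]; exact orthogonalProjection_graphMap φ w₀
    have hnorm : ∀ w, ‖w - P Q‖ ≤ ‖graphMap e φ w - Q‖ := fun w => by
      conv_lhs => rw [← orthogonalProjection_graphMap φ w, ← map_sub]
      exact norm_orthogonalProjection_le _ _
    -- For β < 0 the singularity only grows when distances shrink under projection, so the power on
    -- the graph is dominated by the same power on a hyperplane of dimension n - 1. For β ≥ 0 the
    -- power is bounded.
    rcases lt_or_ge β 0 with hβ | hβ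
    · refine hc.graphMeasure_lintegral_lt_top hmeas.enorm (G := fun w => ‖‖w - P Q‖ ^ β‖ₑ)
        ((measurable_id.sub_const _).norm.pow_const β).enorm (fun w hw => ?_) ?_
      · rw [enorm_le_iff_norm_le, Real.norm_of_nonneg (by positivity),
          Real.norm_of_nonneg (by positivity)]
        by_cases hw0 : w = P Q
        · rw [hw0, hPQ, hw₀]; simp
        · exact Real.rpow_le_rpow_of_nonpos (norm_pos_iff.2 (sub_ne_zero.2 hw0)) (hnorm w) hβ.le
      · have hrank : finrank ℝ (ℝ ∙ e)ᗮ = n - 1 := by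
          have h1 := (ℝ ∙ e).finrank_add_finrank_orthogonal
          rw [finrank_span_singleton (by rintro rfl; simpa using hc.norm_eq_one),
            finrank_euclideanSpace_fin] at h1
          omega
        have := integrableOn_ball_norm_sub_rpow (μ := (volume : Measure (ℝ ∙ e)ᗮ)) (β := β)
          (by omega) (by rw [hrank, Nat.cast_sub (by omega)]; simpa using hy hQ) (P Q) r
        exact hasFiniteIntegral_iff_enorm.1 this.2
    · refine hc.graphMeasure_lintegral_lt_top hmeas.enorm (G := fun _ => ‖r ^ β‖ₑ)
        measurable_const (fun w hw => ?_) ?_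
      · rw [enorm_le_iff_norm_le, Real.norm_of_nonneg (by positivity),
          Real.norm_of_nonneg (by positivity)]
        refine Real.rpow_le_rpow (norm_nonneg _) ?_ hβ
        rw [← dist_eq_norm]; exact le_of_lt hw
      · rw [setLIntegral_const]
        exact ENNReal.mul_lt_top (by simp) measure_ball_lt_top
  · have hcont : ContinuousAt (fun x : EuclideanSpace ℝ (Fin n) => ‖x - y‖ ^ β) Q :=
      (by fun_prop : Continuous fun x : EuclideanSpace ℝ (Fin n) => ‖x - y‖).continuousAt.rpow_const
        (Or.inl (norm_ne_zero_iff.2 (sub_ne_zero.2 hQy)))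
    exact ((finiteAt_nhds _ Q).integrableAtFilter_of_tendsto
      (hmeas.stronglyMeasurable.stronglyMeasurableAtFilter) hcont).filter_mono nhdsWithin_le_nhds

theorem integrableOn_norm_sub_rpow (hΩ : IsBoundedLipschitzDomain Ω) (hn : 2 ≤ n) {β : ℝ}
    {y : EuclideanSpace ℝ (Fin n)} (hy : y ∈ frontier Ω ∧ -(n : ℝ) < β ∨ y ∉ closure Ω) :
    IntegrableOn (fun x => ‖x - y‖ ^ β) Ω := by
  rcases hy with ⟨-, hβ⟩ | hy
  · obtain ⟨r, hr⟩ := hΩ.isBounded.subset_ball y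
    exact (integrableOn_ball_norm_sub_rpow (by simp; omega) (by simpa using hβ) y r).mono_set hr
  · refine IntegrableOn.mono_set ?_ (subset_closure (s := Ω))
    refine ContinuousOn.integrableOn_compact hΩ.isCompact_closure fun x hx => ?_
    refine ContinuousAt.continuousWithinAt ?_
    exact (by fun_prop : Continuous fun x : EuclideanSpace ℝ (Fin n) =>
      ‖x - y‖).continuousAt.rpow_const
      (Or.inl (norm_ne_zero_iff.2 (sub_ne_zero.2 (by rintro rfl; exact hy hx))))

end IsBoundedLipschitzDomain

end GlobalDivergence

/-! ### Regularity up to the boundary from the cone property -/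

section LipschitzUpToBoundary

open Measure Module Filter Metric
open scoped NNReal ENNReal Topology

variable {n : ℕ} {Ω : Set (EuclideanSpace ℝ (Fin n))}

theorem norm_sub_le_of_segment_subset {E : Type*} [NormedAddCommGroup E] [NormedSpace ℝ E]
    {s : Set E} {f : E → ℝ} {f' : E → E →L[ℝ] ℝ} {M : ℝ}
    (hf : ∀ x ∈ s, HasFDerivAt f (f' x) x) (hM : ∀ x ∈ s, ‖f' x‖ ≤ M) {x z : E}
    (h : segment ℝ x z ⊆ s) : ‖f z - f x‖ ≤ M * ‖z - x‖ :=
  (convex_segment x z).norm_image_sub_le_of_norm_hasFDerivWithin_le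
    (fun p hp => (hf p (h hp)).hasFDerivWithinAt) (fun p hp => hM p (h hp))
    (left_mem_segment ℝ x z) (right_mem_segment ℝ x z)

namespace IsGraphChart

variable {Q : EuclideanSpace ℝ (Fin n)}
    {r : ℝ} {e : EuclideanSpace ℝ (Fin n)} {K : ℝ≥0} {φ : (ℝ ∙ e)ᗮ → ℝ}

/-- Moving inside the upward cone with vertex in the supergraph stays in the supergraph. -/
theorem add_mem (h : IsGraphChart Ω Q r e K φ) {x z : EuclideanSpace ℝ (Fin n)}
    (hx : φ ((ℝ ∙ e)ᗮ.orthogonalProjectionOnto x) ≤ ⟪e, x⟫_ℝ)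
    (hz : x + z ∈ ball Q r) 
    (hcone : K * ‖(ℝ ∙ e)ᗮ.orthogonalProjectionOnto z‖ < ⟪e, z⟫_ℝ) : x + z ∈ Ω := by
  rw [h.mem_iff _ hz, map_add, inner_add_right]
  set P := (ℝ ∙ e)ᗮ.orthogonalProjectionOnto with hP
  have h1 := h.lipschitz.dist_le_mul (P x + P z) (P x)
  rw [Real.dist_eq, dist_eq_norm, add_sub_cancel_left] at h1
  have h3 := (abs_le.1 h1).2
  linarith

theorem inner_ge_of_mem_closure (h : IsGraphChart Ω Q r e K φ) {x : EuclideanSpace ℝ (Fin n)}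
    (hx : x ∈ closure Ω) (hb : x ∈ ball Q r) :
    φ ((ℝ ∙ e)ᗮ.orthogonalProjectionOnto x) ≤ ⟪e, x⟫_ℝ := by
  have hc : IsClosed {z | φ ((ℝ ∙ e)ᗮ.orthogonalProjectionOnto z) ≤ ⟪e, z⟫_ℝ} :=
    isClosed_le (h.lipschitz.continuous.comp (ContinuousLinearMap.continuous _)) (by fun_prop)
  have h1 : Ω ∩ ball Q r ⊆ {z | φ ((ℝ ∙ e)ᗮ.orthogonalProjectionOnto z) ≤ ⟪e, z⟫_ℝ} :=
    fun z hz => ((h.mem_iff z hz.2).1 hz.1).le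
  have h2 : x ∈ closure (Ω ∩ ball Q r) := by
    rw [inter_comm]
    exact isOpen_ball.inter_closure ⟨hb, hx⟩
  exact closure_minimal h1 hc h2

/-- Two nearby points of Ω are joined by a path going up, across and down. At height t = (K + 1)|x -
z| the crossing clears a graph of slope K, and the path has length (2K + 3)|x - z|. It stays within
(2K + 3) r' of Q, hence in the ball of radius r = (2K + 5) r'. -/
theorem lipschitzOnWith (h : IsGraphChart Ω Q r e K φ) (hr : 0 < r)
    {f : EuclideanSpace ℝ (Fin n) → ℝ}
    {f' : EuclideanSpace ℝ (Fin n) → EuclideanSpace ℝ (Fin n) →L[ℝ] ℝ} {M : ℝ≥0}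
    (hf : ∀ x ∈ Ω, HasFDerivAt f (f' x) x) (hM : ∀ x ∈ Ω, ‖f' x‖ ≤ M) :
    LipschitzOnWith (M * (2 * K + 5)) f (Ω ∩ ball Q (r / (2 * K + 5))) := by
  have hK : (0 : ℝ) ≤ K := K.2
  set r' := r / (2 * K + 5) with hr'
  have hr'r : (2 * K + 5) * r' = r := by rw [hr']; field_simp
  have hr'0 : 0 < r' := by positivity
  have key : ∀ x ∈ Ω, x ∈ ball Q r → ∀ s : ℝ, ∀ z, x + (s • e + z) ∈ ball Q r →
      (K + 1) * ‖z‖ ≤ s → x + (s • e + z) ∈ Ω := by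
    intro x hx hxb s z hb hs
    rw [h.mem_iff _ hb, map_add, map_add, map_smul, inner_add_right, inner_add_right,
      Submodule.orthogonalProjectionOnto_orthogonalComplement_singleton_eq_zero, smul_zero,
      zero_add, inner_smul_right, real_inner_self_eq_norm_sq, h.norm_eq_one]
    have h0 := (h.mem_iff x hxb).1 hx
    set P := (ℝ ∙ e)ᗮ.orthogonalProjectionOnto with hP
    have h1 := h.lipschitz.dist_le_mul (P x + P z) (P x)
    rw [Real.dist_eq, dist_eq_norm, add_sub_cancel_left] at h1
    have h2 : (K : ℝ) * ‖P z‖ ≤ K * ‖z‖ :=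
      mul_le_mul_of_nonneg_left (norm_orthogonalProjection_le e z) hK
    have h3 := (abs_le.1 h1).2
    have h4 := (abs_le.1 (abs_real_inner_le_norm e z)).1
    rw [h.norm_eq_one] at h4
    linarith
  refine LipschitzOnWith.of_dist_le_mul ?_
  rintro x ⟨hx, hxb⟩ z ⟨hz, hzb⟩
  rw [mem_ball, dist_eq_norm] at hxb hzb
  set t := (K + 1) * ‖x - z‖ with ht
  have ht0 : 0 ≤ t := by positivity
  have hxz : ‖x - z‖ ≤ 2 * r' := by
    have : x - z = (x - Q) - (z - Q) := by abel
    rw [this]; refine (norm_sub_le _ _).trans ?_; linarith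
  have htr : t ≤ (K + 1) * (2 * r') := mul_le_mul_of_nonneg_left hxz (by positivity)
  have hsr : ∀ s ∈ Icc 0 t, ‖s • e‖ ≤ (K + 1) * (2 * r') := fun s hs => by
    rw [norm_smul, h.norm_eq_one, mul_one, Real.norm_of_nonneg hs.1]; exact hs.2.trans htr
  have hmem : ∀ p : EuclideanSpace ℝ (Fin n), ‖p - Q‖ < r' → ∀ s ∈ Icc 0 t,
      p + s • e ∈ ball Q r := fun p hp s hs => by
    rw [mem_ball, dist_eq_norm, add_sub_right_comm]
    refine (norm_add_le _ _).trans_lt ?_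
    have := hsr s hs
    nlinarith
  have hball : ∀ p : EuclideanSpace ℝ (Fin n), ‖p - Q‖ < r' → p ∈ ball Q r := fun p hp => by
    have := hmem p hp 0 ⟨le_rfl, ht0⟩
    simpa using this
  have vert : ∀ p ∈ Ω, ‖p - Q‖ < r' → segment ℝ p (p + t • e) ⊆ Ω := by
    rintro p hp hpb _ ⟨a, b, ha, hb, hab, rfl⟩
    have hb' : b * t ∈ Icc 0 t := ⟨by positivity, mul_le_of_le_one_left ht0 (by linarith)⟩
    have h1 : a • p + b • (p + t • e) = p + ((b * t) • e + 0) := by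
      have : a = 1 - b := by linarith
      rw [this]; module
    rw [h1]
    refine key p hp (hball p hpb) _ 0 ?_ (by simpa using hb'.1)
    rw [add_zero]; exact hmem p hpb _ hb'
  have horiz : segment ℝ (x + t • e) (z + t • e) ⊆ Ω := by
    rintro _ ⟨a, b, ha, hb, hab, rfl⟩
    have h1 : a • (x + t • e) + b • (z + t • e) = x + (t • e + b • (z - x)) := by
      have : a = 1 - b := by linarith
      rw [this]; module
    have h2 : x + (t • e + b • (z - x)) = (a • x + b • z) + t • e := by
      have : a = 1 - b := by linarith
      rw [this]; module
    rw [h1]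
    refine key x hx (hball x hxb) t _ ?_ ?_
    · rw [h2]
      refine hmem _ ?_ t ⟨ht0, le_rfl⟩
      have := convex_ball Q r' (by simpa [dist_eq_norm] using hxb)
        (by simpa [dist_eq_norm] using hzb) ha hb hab
      simpa [dist_eq_norm] using this
    · rw [ht]
      refine mul_le_mul_of_nonneg_left ?_ (by positivity)
      rw [norm_smul, Real.norm_of_nonneg hb, norm_sub_rev]
      exact mul_le_of_le_one_left (norm_nonneg _) (by linarith)
  have hte : ‖t • e‖ = t := by rw [norm_smul, h.norm_eq_one, mul_one, Real.norm_of_nonneg ht0]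
  have h1 := norm_sub_le_of_segment_subset hf hM (vert x hx hxb)
  have h2 := norm_sub_le_of_segment_subset hf hM horiz
  have h3 := norm_sub_le_of_segment_subset hf hM (vert z hz hzb)
  rw [add_sub_cancel_left, hte] at h1 h3
  rw [add_sub_add_right_eq_sub, norm_sub_rev z x] at h2
  rw [dist_eq_norm, dist_eq_norm]
  have h4 : f x - f z = -(f (x + t • e) - f x) - (f (z + t • e) - f (x + t • e)) +
    (f (z + t • e) - f z) := by ring
  rw [h4]
  refine (norm_add_le _ _).trans ?_
  have h5 := norm_sub_le (-(f (x + t • e) - f x)) (f (z + t • e) - f (x + t • e))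
  rw [norm_neg] at h5
  push_cast
  have hM0 : (0 : ℝ) ≤ M * ‖x - z‖ := by positivity
  have h6 : (M : ℝ) * t = M * ‖x - z‖ * (K + 1) := by rw [ht]; ring
  nlinarith

end IsGraphChart

namespace IsBoundedLipschitzDomain

/-- Local Lipschitz bounds pass from Ω to its closure by continuity and become global by
compactness. The extension to the whole space is what the divergence theorem requires. -/
theorem exists_lipschitzWith_eqOn (hΩ : IsBoundedLipschitzDomain Ω)
    {f : EuclideanSpace ℝ (Fin n) → ℝ}
    {f' : EuclideanSpace ℝ (Fin n) → EuclideanSpace ℝ (Fin n) →L[ℝ] ℝ} {M : ℝ}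
    (hfc : ContinuousOn f (closure Ω))
    (hf : ∀ x ∈ Ω, HasFDerivAt f (f' x) x) (hM : ∀ x ∈ Ω, ‖f' x‖ ≤ M) :
    ∃ (C : ℝ≥0) (g : EuclideanSpace ℝ (Fin n) → ℝ), LipschitzWith C g ∧ EqOn f g (closure Ω) := by
  have hM' : ∀ x ∈ Ω, ‖f' x‖ ≤ M.toNNReal := fun x hx => (hM x hx).trans (Real.le_coe_toNNReal M)
  have hloc : LocallyLipschitzOn (closure Ω) f := by
    intro x hx
    have hopen : ∃ (C : ℝ≥0) (δ : ℝ), 0 < δ ∧ LipschitzOnWith C f (Ω ∩ ball x δ) := by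
      by_cases hxΩ : x ∈ Ω
      · obtain ⟨δ, hδ, hsub⟩ := Metric.isOpen_iff.1 hΩ.isOpen x hxΩ
        refine ⟨M.toNNReal, δ, hδ, LipschitzOnWith.mono ?_ inter_subset_right⟩
        exact (convex_ball x δ).lipschitzOnWith_of_nnnorm_hasFDerivWithin_le
          (fun p hp => (hf p (hsub hp)).hasFDerivWithinAt) (fun p hp => hM' p (hsub hp))
      · obtain ⟨r, hr, e, K, φ, hc⟩ := hΩ.exists_chart
          (⟨hx, by rwa [hΩ.isOpen.interior_eq]⟩ : x ∈ frontier Ω)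
        exact ⟨_, _, by have := K.2; positivity, hc.lipschitzOnWith hr hf hM'⟩
    obtain ⟨C, δ, hδ, hL⟩ := hopen
    refine ⟨C, closure Ω ∩ ball x δ, inter_mem_nhdsWithin _ (ball_mem_nhds x hδ), ?_⟩
    have h2 : closure Ω ∩ ball x δ ⊆ closure (Ω ∩ ball x δ) := by
      rw [inter_comm, inter_comm Ω]; exact isOpen_ball.inter_closure
    refine LipschitzOnWith.mono (LipschitzOnWith.closure ?_ hL) h2
    exact hfc.mono (closure_mono inter_subset_left)
  obtain ⟨C, hC⟩ := hloc.exists_lipschitzOnWith_of_compact hΩ.isCompact_closure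
  obtain ⟨g, hg, hfg⟩ := hC.extend_real
  exact ⟨C, g, hg, hfg⟩

/-- At a boundary point the closure contains a truncated open convex cone around `e` with vertex
there. Hence derivatives within the closure are well determined up to the boundary. -/
theorem uniqueDiffOn_closure (hΩ : IsBoundedLipschitzDomain Ω) : UniqueDiffOn ℝ (closure Ω) := by
  intro x hx
  by_cases hxΩ : x ∈ Ω
  · exact (hΩ.isOpen.uniqueDiffWithinAt hxΩ).mono subset_closure
  obtain ⟨r, hr, e, K, φ, hc⟩ := hΩ.exists_chart
    (⟨hx, by rwa [hΩ.isOpen.interior_eq]⟩ : x ∈ frontier Ω)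
  set P := (ℝ ∙ e)ᗮ.orthogonalProjectionOnto with hP
  set T : Set (EuclideanSpace ℝ (Fin n)) := {p | K * ‖P (p - x)‖ < ⟪e, p - x⟫_ℝ} ∩ ball x r with hT
  have hTo : IsOpen T := by
    refine IsOpen.inter (isOpen_lt ?_ (by fun_prop)) isOpen_ball
    have := P.continuous
    fun_prop
  have hTΩ : T ⊆ closure Ω := fun p hp => by
    have h1 := hc.add_mem (z := p - x) (hc.inner_ge_of_mem_closure hx (mem_ball_self hr))
      (by simpa using hp.2) hp.1
    rw [add_sub_cancel] at h1
    exact subset_closure h1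
  have hTc : Convex ℝ T := by
    refine Convex.inter ?_ (convex_ball x r)
    intro p hp q hq a b ha hb hab
    simp only [mem_ofPred_eq] at hp hq ⊢
    have h1 : a • p + b • q - x = a • (p - x) + b • (q - x) := by
      have : a = 1 - b := by linarith
      rw [this]; module
    rw [h1, map_add, map_smul, map_smul, inner_add_right, inner_smul_right, inner_smul_right]
    have h2 := norm_add_le (a • P (p - x)) (b • P (q - x))
    rw [norm_smul, norm_smul, Real.norm_of_nonneg ha, Real.norm_of_nonneg hb] at h2
    have h3 := mul_le_mul_of_nonneg_left h2 K.2
    rcases ha.eq_or_lt with rfl | ha'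
    · have hb1 : b = 1 := by linarith
      subst hb1
      simpa using hq
    · have h4 := mul_lt_mul_of_pos_left hp ha'
      have h5 := mul_le_mul_of_nonneg_left hq.le hb
      change (K : ℝ) * _ ≤ K * _ at h3
      nlinarith
  have hxT : x ∈ closure T := by
    have hcont : Tendsto (fun t : ℝ => x + t • e) (𝓝[>] 0) (𝓝 x) := by
      have : Continuous fun t : ℝ => x + t • e := by fun_prop
      simpa using (this.tendsto 0).mono_left nhdsWithin_le_nhds
    refine mem_closure_of_tendsto hcont ?_
    filter_upwards [hcont (ball_mem_nhds x hr), self_mem_nhdsWithin] with t ht ht0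
    refine ⟨?_, ht⟩
    simp only [mem_ofPred_eq, add_sub_cancel_left, map_smul]
    rw [Submodule.orthogonalProjectionOnto_orthogonalComplement_singleton_eq_zero, inner_smul_right,
      real_inner_self_eq_norm_sq, hc.norm_eq_one]
    simpa using ht0
  have hTn : (interior T).Nonempty := by
    rw [hTo.interior_eq]; exact closure_nonempty_iff.1 ⟨x, hxT⟩
  exact (uniqueDiffWithinAt_convex hTc hTn hxT).mono hTΩ

end IsBoundedLipschitzDomain

end LipschitzUpToBoundary

/-! ### Partial derivatives and orders of growth at y -/

section Symbols

open Module Filter Metric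
open scoped NNReal ENNReal Topology

variable {n : ℕ}

/-- The linear form with given coordinates. -/
noncomputable def coordDual : (Fin n → ℝ) →ₗ[ℝ] (EuclideanSpace ℝ (Fin n) →L[ℝ] ℝ) :=
  Fintype.linearCombination ℝ (fun i => EuclideanSpace.proj i)

theorem coordDual_apply (a : Fin n → ℝ) (v : EuclideanSpace ℝ (Fin n)) :
    coordDual a v = ∑ i, a i * v i := by
  simp [coordDual, Fintype.linearCombination_apply]

theorem coordDual_single (a : Fin n → ℝ) (i : Fin n) :
    coordDual a (EuclideanSpace.single i 1) = a i := by
  rw [coordDual_apply, Finset.sum_eq_single i] <;> simp +contextual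

theorem coordDual_eta (L : EuclideanSpace ℝ (Fin n) →L[ℝ] ℝ) :
    coordDual (fun i => L (EuclideanSpace.single i 1)) = L := by
  ext v
  rw [coordDual_apply]
  conv_rhs => rw [← (EuclideanSpace.basisFun (Fin n) ℝ).sum_repr v]
  simp [map_sum, mul_comm]

theorem norm_coordDual_le {a : Fin n → ℝ} {M : ℝ} (h : ∀ i, |a i| ≤ M) :
    ‖coordDual a‖ ≤ n * M := by
  rcases n.eq_zero_or_pos with rfl | hn
  · have : coordDual a = 0 := by ext v; simp [coordDual_apply]
    simp [this]
  have hM : 0 ≤ M := (abs_nonneg _).trans (h ⟨0, hn⟩)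
  refine ContinuousLinearMap.opNorm_le_bound _ (by positivity) fun v => ?_
  rw [coordDual_apply]
  refine (norm_sum_le _ _).trans ?_
  calc _ ≤ ∑ _i : Fin n, M * ‖v‖ := Finset.sum_le_sum fun i _ => by
        rw [norm_mul]
        exact mul_le_mul (h i) (PiLp.norm_apply_le v i) (norm_nonneg _) hM
    _ = _ := by simp; ring

/-- `f` has partial derivatives `a` at `x` (and is differentiable there). -/
def HasPartials (f : EuclideanSpace ℝ (Fin n) → ℝ) (a : Fin n → ℝ)
    (x : EuclideanSpace ℝ (Fin n)) : Prop := HasFDerivAt f (coordDual a) x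

namespace HasPartials

variable {f g : EuclideanSpace ℝ (Fin n) → ℝ} {a b : Fin n → ℝ} {x : EuclideanSpace ℝ (Fin n)}

theorem of_hasFDerivAt {L : EuclideanSpace ℝ (Fin n) →L[ℝ] ℝ} (h : HasFDerivAt f L x) :
    HasPartials f (fun i => L (EuclideanSpace.single i 1)) x := by
  rw [HasPartials, coordDual_eta]; exact h

theorem fderiv_single (h : HasPartials f a x) (i : Fin n) :
    fderiv ℝ f x (EuclideanSpace.single i 1) = a i := by
  rw [HasFDerivAt.fderiv h, coordDual_single]

theorem lineDeriv_single (h : HasPartials f a x) (i : Fin n) :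
    lineDeriv ℝ f x (EuclideanSpace.single i 1) = a i := by
  rw [(HasFDerivAt.hasLineDerivAt h _).lineDeriv, coordDual_single]

theorem const (c : ℝ) : HasPartials (fun _ => c) (fun _ => 0) x := by
  have : coordDual (fun _ : Fin n => (0 : ℝ)) = 0 := map_zero coordDual
  rw [HasPartials, this]; exact hasFDerivAt_const c x

theorem add (hf : HasPartials f a x) (hg : HasPartials g b x) :
    HasPartials (fun z => f z + g z) (fun i => a i + b i) x := by
  have : coordDual (fun i => a i + b i) = coordDual a + coordDual b := map_add coordDual a b
  rw [HasPartials, this]; exact HasFDerivAt.add hf hg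

theorem mul (hf : HasPartials f a x) (hg : HasPartials g b x) :
    HasPartials (fun z => f z * g z) (fun i => a i * g x + f x * b i) x := by
  have : coordDual (fun i => a i * g x + f x * b i) = f x • coordDual b + g x • coordDual a := by
    rw [← map_smul, ← map_smul, ← map_add]
    congr 1
    ext i; simp; ring
  rw [HasPartials, this]; exact HasFDerivAt.mul hf hg

theorem const_mul (c : ℝ) (hf : HasPartials f a x) :
    HasPartials (fun z => c * f z) (fun i => c * a i) x := by
  have := (const c).mul hf
  simpa using this

theorem sum {ι : Type*} {s : Finset ι} {F : ι → EuclideanSpace ℝ (Fin n) → ℝ} {A : ι → Fin n → ℝ}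
    (h : ∀ j ∈ s, HasPartials (F j) (A j) x) :
    HasPartials (fun z => ∑ j ∈ s, F j z) (fun i => ∑ j ∈ s, A j i) x := by
  have : coordDual (fun i => ∑ j ∈ s, A j i) = ∑ j ∈ s, coordDual (A j) := by
    rw [← map_sum]; congr 1; ext i; simp
  rw [HasPartials, this]; exact HasFDerivAt.fun_sum h

theorem comp {φ : ℝ → ℝ} {d : ℝ} (hφ : HasDerivAt φ d (f x)) (hf : HasPartials f a x) :
    HasPartials (fun z => φ (f z)) (fun i => d * a i) x := by
  have : coordDual (fun i => d * a i) = d • coordDual a := by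
    rw [← map_smul]; congr 1
  rw [HasPartials, this]; exact hφ.comp_hasFDerivAt x hf

theorem congr_of_eventuallyEq (hf : HasPartials f a x) (h : g =ᶠ[𝓝 x] f) : HasPartials g a x :=
  HasFDerivAt.congr_of_eventuallyEq hf h

theorem coord (y : EuclideanSpace ℝ (Fin n)) (k : Fin n) :
    HasPartials (fun z => z k - y k) (fun i => if i = k then 1 else 0) x := by
  have h := of_hasFDerivAt ((EuclideanSpace.proj (𝕜 := ℝ) k).hasFDerivAt (x := x) |>.sub_const (y k))
  have h2 : (fun i => if i = k then (1 : ℝ) else 0) =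
      fun i => EuclideanSpace.proj (𝕜 := ℝ) k (EuclideanSpace.single i (1 : ℝ)) := by
    funext i
    change _ = (EuclideanSpace.single i (1 : ℝ) : EuclideanSpace ℝ (Fin n)) k
    simp [eq_comm]
  rw [h2]; exact h

theorem norm_sub_sq (y : EuclideanSpace ℝ (Fin n)) :
    HasPartials (fun z => ‖z - y‖ ^ 2) (fun i => 2 * (x i - y i)) x := by
  have h1 : (fun z : EuclideanSpace ℝ (Fin n) => ‖z - y‖ ^ 2) =
      fun z => ∑ k, (z k - y k) * (z k - y k) := by
    ext z
    rw [EuclideanSpace.real_norm_sq_eq]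
    exact Finset.sum_congr rfl fun k _ => by simp; ring
  rw [h1]
  convert HasPartials.sum (s := Finset.univ) (x := x)
    fun k (_ : k ∈ Finset.univ) => (coord y k).mul (coord (x := x) y k) using 2 with i
  simp [Finset.sum_add_distrib]
  ring

theorem norm_sub_rpow {y : EuclideanSpace ℝ (Fin n)} (hxy : x ≠ y) (β : ℝ) :
    HasPartials (fun z => ‖z - y‖ ^ β) (fun i => β * (x i - y i) * ‖x - y‖ ^ (β - 2)) x := by
  have hpos : 0 < ‖x - y‖ := norm_pos_iff.2 (sub_ne_zero.2 hxy)
  have h1 : (fun z : EuclideanSpace ℝ (Fin n) => ‖z - y‖ ^ β) =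
      fun z => (‖z - y‖ ^ 2) ^ (β / 2) := by
    ext z
    rw [← Real.rpow_natCast, ← Real.rpow_mul (norm_nonneg _)]
    congr 1; push_cast; ring
  rw [h1]
  have h2 := comp (φ := fun s => s ^ (β / 2))
    (Real.hasDerivAt_rpow_const (p := β / 2) (Or.inl (by positivity))) (norm_sub_sq (x := x) y)
  convert h2 using 2 with i
  have h3 : (‖x - y‖ ^ 2) ^ (β / 2 - 1) = ‖x - y‖ ^ (β - 2) := by
    rw [← Real.rpow_natCast, ← Real.rpow_mul (norm_nonneg _)]
    congr 1; push_cast; ring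
  rw [h3]; ring

end HasPartials

/-- A function on `closure Ω ∖ {y}` which is `O(|x - y| ^ k)`, with gradient `f'` in `Ω` which is
`O(|x - y| ^ (k - 1))`. -/
structure IsSymbol (Ω : Set (EuclideanSpace ℝ (Fin n))) (y : EuclideanSpace ℝ (Fin n)) (k : ℝ)
    (f : EuclideanSpace ℝ (Fin n) → ℝ) (f' : Fin n → EuclideanSpace ℝ (Fin n) → ℝ) : Prop where
  continuousOn : ContinuousOn f (closure Ω \ {y})
  hasPartials : ∀ x ∈ Ω, HasPartials f (fun i => f' i x) x
  continuousOn_deriv : ∀ i, ContinuousOn (f' i) Ω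
  bound : ∃ C, ∀ x ∈ closure Ω, x ≠ y → |f x| ≤ C * ‖x - y‖ ^ k
  bound_deriv : ∃ C, ∀ i, ∀ x ∈ Ω, |f' i x| ≤ C * ‖x - y‖ ^ (k - 1)

namespace IsSymbol

variable {Ω : Set (EuclideanSpace ℝ (Fin n))} {y : EuclideanSpace ℝ (Fin n)} {k l : ℝ}
  {f g : EuclideanSpace ℝ (Fin n) → ℝ} {f' g' : Fin n → EuclideanSpace ℝ (Fin n) → ℝ}

theorem congr_deriv (h : IsSymbol Ω y k f f') (hg : ∀ i, ∀ x ∈ Ω, g' i x = f' i x) :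
    IsSymbol Ω y k f g' where
  continuousOn := h.continuousOn
  hasPartials x hx := by
    have : (fun i => g' i x) = fun i => f' i x := funext fun i => hg i x hx
    rw [this]; exact h.hasPartials x hx
  continuousOn_deriv i := (h.continuousOn_deriv i).congr fun x hx => hg i x hx
  bound := h.bound
  bound_deriv := by
    obtain ⟨C, hC⟩ := h.bound_deriv
    exact ⟨C, fun i x hx => by rw [hg i x hx]; exact hC i x hx⟩

theorem congr_exponent (h : IsSymbol Ω y k f f') (hkl : k = l) : IsSymbol Ω y l f f' := hkl ▸ h

theorem continuousOn_interior (h : IsSymbol Ω y k f f') : ContinuousOn f Ω := fun x hx =>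
  (HasFDerivAt.continuousAt (h.hasPartials x hx)).continuousWithinAt

theorem norm_pos_of_ne {x : EuclideanSpace ℝ (Fin n)} (h : x ≠ y) : 0 < ‖x - y‖ :=
  norm_pos_iff.2 (sub_ne_zero.2 h)

theorem add (hf : IsSymbol Ω y k f f') (hg : IsSymbol Ω y k g g') :
    IsSymbol Ω y k (fun x => f x + g x) (fun i x => f' i x + g' i x) where
  continuousOn := hf.continuousOn.add hg.continuousOn
  hasPartials x hx := (hf.hasPartials x hx).add (hg.hasPartials x hx)
  continuousOn_deriv i := (hf.continuousOn_deriv i).add (hg.continuousOn_deriv i)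
  bound := by
    obtain ⟨C, hC⟩ := hf.bound
    obtain ⟨D, hD⟩ := hg.bound
    exact ⟨C + D, fun x hx hxy => (abs_add_le _ _).trans (by
      rw [add_mul]; exact add_le_add (hC x hx hxy) (hD x hx hxy))⟩
  bound_deriv := by
    obtain ⟨C, hC⟩ := hf.bound_deriv
    obtain ⟨D, hD⟩ := hg.bound_deriv
    exact ⟨C + D, fun i x hx => (abs_add_le _ _).trans (by
      rw [add_mul]; exact add_le_add (hC i x hx) (hD i x hx))⟩

theorem const_mul (c : ℝ) (hf : IsSymbol Ω y k f f') :
    IsSymbol Ω y k (fun x => c * f x) (fun i x => c * f' i x) where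
  continuousOn := continuousOn_const.mul hf.continuousOn
  hasPartials x hx := (hf.hasPartials x hx).const_mul c
  continuousOn_deriv i := continuousOn_const.mul (hf.continuousOn_deriv i)
  bound := by
    obtain ⟨C, hC⟩ := hf.bound
    exact ⟨|c| * C, fun x hx hxy => by
      rw [abs_mul, mul_assoc]; exact mul_le_mul_of_nonneg_left (hC x hx hxy) (abs_nonneg c)⟩
  bound_deriv := by
    obtain ⟨C, hC⟩ := hf.bound_deriv
    exact ⟨|c| * C, fun i x hx => by
      rw [abs_mul, mul_assoc]; exact mul_le_mul_of_nonneg_left (hC i x hx) (abs_nonneg c)⟩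

theorem zero : IsSymbol Ω y k (fun _ => 0) (fun _ _ => 0) where
  continuousOn := continuousOn_const
  hasPartials x _ := HasPartials.const 0
  continuousOn_deriv i := continuousOn_const
  bound := ⟨0, fun x _ _ => by simp⟩
  bound_deriv := ⟨0, fun i x _ => by simp⟩

theorem sum {ι : Type*} (s : Finset ι) {F : ι → EuclideanSpace ℝ (Fin n) → ℝ}
    {F' : ι → Fin n → EuclideanSpace ℝ (Fin n) → ℝ} (h : ∀ j ∈ s, IsSymbol Ω y k (F j) (F' j)) :
    IsSymbol Ω y k (fun x => ∑ j ∈ s, F j x) (fun i x => ∑ j ∈ s, F' j i x) := by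
  classical
  induction s using Finset.induction_on with
  | empty => simpa using zero
  | insert j s hj ih =>
    simp only [Finset.sum_insert hj]
    exact (h j (Finset.mem_insert_self _ _)).add
      (ih fun i hi => h i (Finset.mem_insert_of_mem hi))

theorem abs_mul_le {a b C D ρ k l : ℝ} (hρ : 0 < ρ) (ha : |a| ≤ C * ρ ^ k) (hb : |b| ≤ D * ρ ^ l) :
    |a * b| ≤ C * D * ρ ^ (k + l) := by
  rw [abs_mul, Real.rpow_add hρ]
  calc _ ≤ (C * ρ ^ k) * (D * ρ ^ l) :=
        mul_le_mul ha hb (abs_nonneg _) ((abs_nonneg _).trans ha)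
    _ = _ := by ring

theorem mul (hy : y ∉ Ω) (hf : IsSymbol Ω y k f f') (hg : IsSymbol Ω y l g g') :
    IsSymbol Ω y (k + l) (fun x => f x * g x) (fun i x => f' i x * g x + f x * g' i x) where
  continuousOn := hf.continuousOn.mul hg.continuousOn
  hasPartials x hx := (hf.hasPartials x hx).mul (hg.hasPartials x hx)
  continuousOn_deriv i := ((hf.continuousOn_deriv i).mul hg.continuousOn_interior).add
    (hf.continuousOn_interior.mul (hg.continuousOn_deriv i))
  bound := by
    obtain ⟨C, hC⟩ := hf.bound
    obtain ⟨D, hD⟩ := hg.bound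
    exact ⟨C * D, fun x hx hxy => abs_mul_le (norm_pos_of_ne hxy) (hC x hx hxy) (hD x hx hxy)⟩
  bound_deriv := by
    obtain ⟨C, hC⟩ := hf.bound
    obtain ⟨D, hD⟩ := hg.bound
    obtain ⟨C', hC'⟩ := hf.bound_deriv
    obtain ⟨D', hD'⟩ := hg.bound_deriv
    refine ⟨C' * D + C * D', fun i x hx => ?_⟩
    have hxy : x ≠ y := by rintro rfl; exact hy hx
    have hpos := norm_pos_of_ne hxy
    have h1 := abs_mul_le hpos (hC' i x hx) (hD x (subset_closure hx) hxy)
    have h2 := abs_mul_le hpos (hC x (subset_closure hx) hxy) (hD' i x hx)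
    rw [show k - 1 + l = k + l - 1 by ring] at h1
    rw [show k + (l - 1) = k + l - 1 by ring] at h2
    refine (abs_add_le _ _).trans ?_
    rw [add_mul]; exact add_le_add h1 h2

theorem coord (hy : y ∉ Ω) (j : Fin n) : IsSymbol Ω y 1 (fun x => x j - y j)
    (fun i _ => if i = j then 1 else 0) where
  continuousOn := by fun_prop
  hasPartials x _ := HasPartials.coord y j
  continuousOn_deriv i := continuousOn_const
  bound := ⟨1, fun x _ _ => by
    rw [one_mul, Real.rpow_one]; simpa using PiLp.norm_apply_le (x - y) j⟩
  bound_deriv := ⟨1, fun i x hx => by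
    have hxy : x ≠ y := by rintro rfl; exact hy hx
    have := norm_pos_of_ne hxy
    rw [sub_self, Real.rpow_zero]
    split_ifs <;> simp⟩

theorem norm_sub_rpow (hy : y ∉ Ω) (β : ℝ) : IsSymbol Ω y β (fun x => ‖x - y‖ ^ β)
    (fun i x => β * (x i - y i) * ‖x - y‖ ^ (β - 2)) where
  continuousOn x hx := ContinuousAt.continuousWithinAt
    ((by fun_prop : Continuous fun x : EuclideanSpace ℝ (Fin n) => ‖x - y‖).continuousAt.rpow_const
      (Or.inl (norm_pos_of_ne hx.2).ne'))
  hasPartials x hx := HasPartials.norm_sub_rpow (by rintro rfl; exact hy hx) β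
  continuousOn_deriv i x hx := ContinuousAt.continuousWithinAt (by
    have hxy : x ≠ y := by rintro rfl; exact hy hx
    exact ContinuousAt.mul (by fun_prop) ((by fun_prop : Continuous
      fun x : EuclideanSpace ℝ (Fin n) => ‖x - y‖).continuousAt.rpow_const
      (Or.inl (norm_pos_of_ne hxy).ne')))
  bound := ⟨1, fun x _ _ => by rw [one_mul, abs_of_nonneg (by positivity)]⟩
  bound_deriv := ⟨|β|, fun i x hx => by
    have hxy : x ≠ y := by rintro rfl; exact hy hx
    have hpos := norm_pos_of_ne hxy
    have h1 : |x i - y i| ≤ 1 * ‖x - y‖ ^ (1 : ℝ) := by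
      rw [one_mul, Real.rpow_one]; simpa using PiLp.norm_apply_le (x - y) i
    have h2 : |β| ≤ |β| * ‖x - y‖ ^ (0 : ℝ) := by simp
    have h3 : |‖x - y‖ ^ (β - 2)| ≤ 1 * ‖x - y‖ ^ (β - 2) := by
      rw [one_mul, abs_of_nonneg (by positivity)]
    have h4 := abs_mul_le hpos (abs_mul_le hpos h2 h1) h3
    rw [show (0 : ℝ) + 1 + (β - 2) = β - 1 by ring] at h4
    simpa using h4⟩

end IsSymbol

end Symbols

/-! ### Flux identities with a singularity at y -/

section Flux

open Module Filter Metric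
open scoped NNReal ENNReal Topology

variable {n : ℕ}

/-- `G` is integrable on `Ω`, `b` is integrable on the boundary, and their integrals agree. -/
structure HasFlux (Ω : Set (EuclideanSpace ℝ (Fin n))) (G b : EuclideanSpace ℝ (Fin n) → ℝ) :
    Prop where
  integrableOn : IntegrableOn G Ω
  integrable : Integrable b (surfaceMeasure Ω)
  integral_eq : ∫ x in Ω, G x = ∫ x, b x ∂surfaceMeasure Ω

namespace HasFlux

variable {Ω : Set (EuclideanSpace ℝ (Fin n))} {G G' b b' : EuclideanSpace ℝ (Fin n) → ℝ}

theorem add (h : HasFlux Ω G b) (h' : HasFlux Ω G' b') :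
    HasFlux Ω (fun x => G x + G' x) (fun x => b x + b' x) :=
  ⟨h.1.add h'.1, h.2.add h'.2, by
    rw [integral_add h.1 h'.1, integral_add h.2 h'.2, h.3, h'.3]⟩

theorem const_mul (c : ℝ) (h : HasFlux Ω G b) : HasFlux Ω (fun x => c * G x) (fun x => c * b x) :=
  ⟨h.1.const_mul c, h.2.const_mul c, by rw [integral_const_mul, integral_const_mul, h.3]⟩

theorem sum {ι : Type*} (s : Finset ι) {F B : ι → EuclideanSpace ℝ (Fin n) → ℝ}
    (h : ∀ j ∈ s, HasFlux Ω (F j) (B j)) :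
    HasFlux Ω (fun x => ∑ j ∈ s, F j x) (fun x => ∑ j ∈ s, B j x) :=
  ⟨integrable_finsetSum s fun j hj => (h j hj).1, integrable_finsetSum s fun j hj => (h j hj).2, by
    rw [integral_finsetSum s fun j hj => (h j hj).1, integral_finsetSum s fun j hj => (h j hj).2]
    exact Finset.sum_congr rfl fun j hj => (h j hj).3⟩

theorem congr (h : HasFlux Ω G b) (hΩ : MeasurableSet Ω) (hG : ∀ x ∈ Ω, G' x = G x)
    (hb : ∀ᵐ x ∂surfaceMeasure Ω, b' x = b x) : HasFlux Ω G' b' :=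
  ⟨h.1.congr_fun (fun x hx => (hG x hx).symm) hΩ, h.2.congr (hb.mono fun x hx => hx.symm), by
    rw [setIntegral_congr_fun hΩ hG, h.3, integral_congr_ae hb]⟩

end HasFlux

theorem exists_bound_deriv_smoothTransition :
    ∃ B, 0 ≤ B ∧ ∀ t, |deriv Real.smoothTransition t| ≤ B := by
  have hc : Continuous (deriv Real.smoothTransition) :=
    (Real.smoothTransition.contDiff (n := 1)).continuous_deriv le_rfl
  have hs : HasCompactSupport (deriv Real.smoothTransition) := by
    refine HasCompactSupport.intro (K := Icc 0 1) isCompact_Icc fun t ht => ?_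
    rw [mem_Icc, not_and_or, not_le, not_le] at ht
    rcases ht with ht | ht
    · have : Real.smoothTransition =ᶠ[𝓝 t] fun _ => 0 := by
        filter_upwards [Iio_mem_nhds ht] with s hs
        exact Real.smoothTransition.zero_of_nonpos (le_of_lt hs)
      rw [this.deriv_eq, deriv_const]
    · have : Real.smoothTransition =ᶠ[𝓝 t] fun _ => 1 := by
        filter_upwards [Ioi_mem_nhds ht] with s hs
        exact Real.smoothTransition.one_of_one_le (le_of_lt hs)
      rw [this.deriv_eq, deriv_const]
  obtain ⟨B, hB⟩ := hc.bounded_above_of_compact_support hs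
  exact ⟨B, (norm_nonneg _).trans (hB 0), hB⟩

theorem deriv_smoothTransition_of_one_lt {t : ℝ} (ht : 1 < t) :
    deriv Real.smoothTransition t = 0 := by
  have : Real.smoothTransition =ᶠ[𝓝 t] fun _ => 1 := by
    filter_upwards [Ioi_mem_nhds ht] with s hs
    exact Real.smoothTransition.one_of_one_le (le_of_lt hs)
  rw [this.deriv_eq, deriv_const]

/-- A cutoff function vanishing near `y` and equal to `1` away from `y`. -/
noncomputable def punctureCutoff (y : EuclideanSpace ℝ (Fin n)) (ε : ℝ)
    (x : EuclideanSpace ℝ (Fin n)) : ℝ := Real.smoothTransition ((ε ^ 2)⁻¹ * ‖x - y‖ ^ 2 - 1)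

/-- The partial derivatives of `punctureCutoff`. -/
noncomputable def punctureCutoffDeriv (y : EuclideanSpace ℝ (Fin n)) (ε : ℝ) (i : Fin n)
    (x : EuclideanSpace ℝ (Fin n)) : ℝ :=
  deriv Real.smoothTransition ((ε ^ 2)⁻¹ * ‖x - y‖ ^ 2 - 1) * ((ε ^ 2)⁻¹ * (2 * (x i - y i)))

theorem hasPartials_punctureCutoff (y : EuclideanSpace ℝ (Fin n)) (ε : ℝ)
    (x : EuclideanSpace ℝ (Fin n)) :
    HasPartials (punctureCutoff y ε) (fun i => punctureCutoffDeriv y ε i x) x := by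
  have h1 : HasPartials (fun x => (ε ^ 2)⁻¹ * ‖x - y‖ ^ 2 + -1)
      (fun i => (ε ^ 2)⁻¹ * (2 * (x i - y i)) + 0) x :=
    ((HasPartials.norm_sub_sq y).const_mul _).add (HasPartials.const (-1))
  simp only [add_zero, ← sub_eq_add_neg] at h1
  refine HasPartials.comp ?_ h1
  exact ((Real.smoothTransition.contDiff (n := 1)).differentiable (by simp) _).hasDerivAt

theorem punctureCutoff_nonneg (y : EuclideanSpace ℝ (Fin n)) (ε : ℝ)
    (x : EuclideanSpace ℝ (Fin n)) : 0 ≤ punctureCutoff y ε x := Real.smoothTransition.nonneg _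

theorem punctureCutoff_le_one (y : EuclideanSpace ℝ (Fin n)) (ε : ℝ)
    (x : EuclideanSpace ℝ (Fin n)) : punctureCutoff y ε x ≤ 1 := Real.smoothTransition.le_one _

theorem abs_punctureCutoff_le (y : EuclideanSpace ℝ (Fin n)) (ε : ℝ)
    (x : EuclideanSpace ℝ (Fin n)) : |punctureCutoff y ε x| ≤ 1 := by
  rw [abs_of_nonneg (punctureCutoff_nonneg y ε x)]; exact punctureCutoff_le_one y ε x

theorem continuous_punctureCutoff (y : EuclideanSpace ℝ (Fin n)) (ε : ℝ) :
    Continuous (punctureCutoff y ε) :=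
  continuous_iff_continuousAt.2 fun x => HasFDerivAt.continuousAt (hasPartials_punctureCutoff y ε x)

theorem continuous_punctureCutoffDeriv (y : EuclideanSpace ℝ (Fin n)) (ε : ℝ) (i : Fin n) :
    Continuous (punctureCutoffDeriv y ε i) := by
  have hc : Continuous (deriv Real.smoothTransition) :=
    (Real.smoothTransition.contDiff (n := 1)).continuous_deriv le_rfl
  unfold punctureCutoffDeriv
  fun_prop

theorem punctureCutoff_eq_zero {y : EuclideanSpace ℝ (Fin n)} {ε : ℝ} (hε : 0 < ε)
    {x : EuclideanSpace ℝ (Fin n)} (hx : ‖x - y‖ ≤ ε) : punctureCutoff y ε x = 0 := by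
  refine Real.smoothTransition.zero_of_nonpos ?_
  have : ‖x - y‖ ^ 2 ≤ ε ^ 2 := by gcongr
  rw [sub_nonpos, inv_mul_le_iff₀ (by positivity)]; linarith

theorem punctureCutoffDeriv_eq_zero {y : EuclideanSpace ℝ (Fin n)} {ε : ℝ} (hε : 0 < ε)
    {x : EuclideanSpace ℝ (Fin n)} (hx : 2 * ε ^ 2 < ‖x - y‖ ^ 2) (i : Fin n) :
    punctureCutoffDeriv y ε i x = 0 := by
  rw [punctureCutoffDeriv, deriv_smoothTransition_of_one_lt, zero_mul]
  rw [lt_sub_iff_add_lt, lt_inv_mul_iff₀ (by positivity)]; linarith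

/-- The bound is uniform in ε: the derivative has size ρ/ε² and is supported where ρ² ≤ 2ε², so that
1/ε² ≤ 2/ρ². -/
theorem exists_abs_punctureCutoffDeriv_le : ∃ C, 0 ≤ C ∧ ∀ (y : EuclideanSpace ℝ (Fin n)) (ε : ℝ),
    0 < ε → ∀ i x, x ≠ y → |punctureCutoffDeriv y ε i x| ≤ C * ‖x - y‖ ^ (-1 : ℝ) := by
  obtain ⟨B, hB0, hB⟩ := exists_bound_deriv_smoothTransition
  refine ⟨4 * B, by positivity, fun y ε hε i x hxy => ?_⟩
  have hpos : 0 < ‖x - y‖ := IsSymbol.norm_pos_of_ne hxy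
  rw [Real.rpow_neg_one]
  rcases lt_or_ge (2 * ε ^ 2) (‖x - y‖ ^ 2) with h | h
  · rw [punctureCutoffDeriv_eq_zero hε h, abs_zero]; positivity
  · have h1 : |x i - y i| ≤ ‖x - y‖ := by simpa using PiLp.norm_apply_le (x - y) i
    rw [punctureCutoffDeriv, abs_mul, abs_mul, abs_mul, abs_of_pos (by positivity : 0 < (ε ^ 2)⁻¹),
      abs_two]
    have h2 : (ε ^ 2)⁻¹ ≤ 2 * (‖x - y‖ ^ 2)⁻¹ := by
      rw [← div_eq_mul_inv, inv_eq_one_div, div_le_div_iff₀ (by positivity) (by positivity)]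
      linarith
    calc _ ≤ B * (2 * (‖x - y‖ ^ 2)⁻¹ * (2 * ‖x - y‖)) := by
          refine mul_le_mul (hB _) ?_ (by positivity) hB0
          exact mul_le_mul h2 (by linarith) (by positivity) (by positivity)
      _ = _ := by field_simp; ring

variable {Ω : Set (EuclideanSpace ℝ (Fin n))} {y : EuclideanSpace ℝ (Fin n)}

theorem exists_rpow_bound (hΩ : IsBoundedLipschitzDomain Ω) (y : EuclideanSpace ℝ (Fin n))
    {ε : ℝ} (hε : 0 < ε) (k : ℝ) :
    ∃ C, 0 ≤ C ∧ ∀ x ∈ closure Ω, ε ≤ ‖x - y‖ → ‖x - y‖ ^ k ≤ C := by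
  obtain ⟨R, hR⟩ := (hΩ.isCompact_closure.isBounded).subset_closedBall y
  obtain ⟨C, hC⟩ := isCompact_Icc.exists_bound_of_continuousOn (s := Icc ε R)
    (f := fun t : ℝ => t ^ k) (fun t ht =>
      (Real.continuousAt_rpow_const t k (Or.inl (hε.trans_le ht.1).ne')).continuousWithinAt)
  refine ⟨max C 0, le_max_right _ _, fun x hx hxe => ?_⟩
  have h1 := hR hx
  rw [mem_closedBall, dist_eq_norm] at h1
  exact (le_abs_self _).trans ((hC _ ⟨hxe, h1⟩).trans (le_max_left _ _))

/-- The cutoff vanishes near y, and away from y powers of ρ are bounded on the closure. The product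
therefore has bounded gradient, extends to a Lipschitz function, and falls under the divergence
theorem. -/
theorem IsSymbol.mul_punctureCutoff (hΩ : IsBoundedLipschitzDomain Ω) (hn : 2 ≤ n) (hy : y ∉ Ω)
    {k : ℝ} {f : EuclideanSpace ℝ (Fin n) → ℝ} {f' : Fin n → EuclideanSpace ℝ (Fin n) → ℝ}
    (h : IsSymbol Ω y k f f') {ε : ℝ} (hε : 0 < ε) (i : Fin n) :
    ∫ x in Ω, (f' i x * punctureCutoff y ε x + f x * punctureCutoffDeriv y ε i x) =
      ∫ x, f x * punctureCutoff y ε x * outwardNormal Ω x i ∂surfaceMeasure Ω := by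
  obtain ⟨C₁, hC₁⟩ := h.bound
  obtain ⟨C₂, hC₂⟩ := h.bound_deriv
  obtain ⟨D₁, hD₁, hD₁'⟩ := exists_rpow_bound hΩ y hε k
  obtain ⟨D₂, hD₂, hD₂'⟩ := exists_rpow_bound hΩ y hε (k - 1)
  have hne : ∀ x ∈ Ω, x ≠ y := fun x hx => by rintro rfl; exact hy hx
  have hzero : ∀ x ∈ ball y ε, punctureCutoff y ε x = 0 := fun x hx =>
    punctureCutoff_eq_zero hε (by rw [← dist_eq_norm]; exact le_of_lt hx)
  have hcont : ContinuousOn (fun x => f x * punctureCutoff y ε x) (closure Ω) := by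
    intro x hx
    by_cases hxy : x = y
    · subst hxy
      refine ContinuousAt.continuousWithinAt ?_
      refine (continuousAt_const (y := (0 : ℝ))).congr ?_
      filter_upwards [ball_mem_nhds x hε] with z hz
      rw [hzero z hz, mul_zero]
    · have h1 : ContinuousWithinAt f (closure Ω) x := by
        refine (h.continuousOn x ⟨hx, hxy⟩).mono_of_mem_nhdsWithin ?_
        exact inter_mem_nhdsWithin _ (isOpen_compl_singleton.mem_nhds hxy)
      exact h1.mul (continuous_punctureCutoff y ε).continuousWithinAt
  have hpart : ∀ x ∈ Ω, HasPartials (fun x => f x * punctureCutoff y ε x)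
      (fun i => f' i x * punctureCutoff y ε x + f x * punctureCutoffDeriv y ε i x) x :=
    fun x hx => (h.hasPartials x hx).mul (hasPartials_punctureCutoff y ε x)
  obtain ⟨C, hC0, hC⟩ := exists_abs_punctureCutoffDeriv_le (n := n)
  have hbound : ∀ x ∈ Ω, ∀ i, |f' i x * punctureCutoff y ε x + f x * punctureCutoffDeriv y ε i x| ≤
      |C₂| * D₂ + |C₁| * C * D₂ := by
    intro x hx i
    rcases lt_or_ge ‖x - y‖ ε with hlt | hge
    · have h1 : punctureCutoffDeriv y ε i x = 0 := by
        have h2 : punctureCutoff y ε =ᶠ[𝓝 x] fun _ => 0 := by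
          filter_upwards [isOpen_ball.mem_nhds (by rwa [mem_ball, dist_eq_norm] : x ∈ ball y ε)]
            with z hz using hzero z hz
        have h3 := (hasPartials_punctureCutoff y ε x).fderiv_single i
        rw [h2.fderiv_eq] at h3
        simpa using h3.symm
      rw [h1, hzero x (by rwa [mem_ball, dist_eq_norm])]
      simp; positivity
    · have hxc := subset_closure hx
      have hpos := IsSymbol.norm_pos_of_ne (hne x hx)
      have h1 : |f' i x| ≤ |C₂| * D₂ := (hC₂ i x hx).trans
        (mul_le_mul (le_abs_self _) (hD₂' x hxc hge) (by positivity) (abs_nonneg _))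
      have h2 : |f x * punctureCutoffDeriv y ε i x| ≤ |C₁| * C * D₂ := by
        have h3 := IsSymbol.abs_mul_le hpos (hC₁ x hxc (hne x hx)) (hC y ε hε i x (hne x hx))
        rw [← sub_eq_add_neg] at h3
        refine h3.trans (mul_le_mul ?_ (hD₂' x hxc hge) (by positivity) (by positivity))
        exact mul_le_mul_of_nonneg_right (le_abs_self _) hC0
      refine (abs_add_le _ _).trans (add_le_add ?_ h2)
      rw [abs_mul]
      exact (mul_le_of_le_one_right (abs_nonneg _) (abs_punctureCutoff_le y ε x)).trans h1
  obtain ⟨L, G, hG, hGe⟩ := hΩ.exists_lipschitzWith_eqOn hcont hpart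
    (fun x hx => norm_coordDual_le (hbound x hx))
  have h1 := hΩ.integral_lineDeriv hn hG (EuclideanSpace.single i 1)
  calc _ = ∫ x in Ω, lineDeriv ℝ G x (EuclideanSpace.single i 1) := by
        refine setIntegral_congr_fun hΩ.isOpen.measurableSet fun x hx => ?_
        rw [← (hpart x hx).lineDeriv_single i]
        refine EventuallyEq.lineDeriv_eq ?_
        filter_upwards [hΩ.isOpen.mem_nhds hx] with z hz using hGe (subset_closure hz)
    _ = _ := h1
    _ = _ := by
        refine integral_congr_ae ?_
        filter_upwards [IsBoundedLipschitzDomain.ae_mem_frontier Ω] with x hx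
        rw [← hGe (frontier_subset_closure hx), EuclideanSpace.inner_single_left]
        simp

theorem IsSymbol.integrableOn_of_rpow (hΩ : IsBoundedLipschitzDomain Ω) {α : ℝ}
    (hI : IntegrableOn (fun x => ‖x - y‖ ^ (-α)) Ω) {F : EuclideanSpace ℝ (Fin n) → ℝ}
    (hF : ContinuousOn F Ω) {C : ℝ} (hC : ∀ x ∈ Ω, |F x| ≤ C * ‖x - y‖ ^ (-α)) :
    IntegrableOn F Ω := by
  refine (hI.const_mul C).mono' (hF.aestronglyMeasurable hΩ.isOpen.measurableSet) ?_
  filter_upwards [ae_restrict_mem hΩ.isOpen.measurableSet] with x hx using hC x hx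

/-- The flux identity for fields with an integrable singularity at `y`. -/
theorem IsSymbol.hasFlux (hΩ : IsBoundedLipschitzDomain Ω) (hn : 2 ≤ n) (hy : y ∉ Ω) {α : ℝ}
    (hI : IntegrableOn (fun x => ‖x - y‖ ^ (-α)) Ω)
    (hσ : Integrable (fun x => ‖x - y‖ ^ (1 - α)) (surfaceMeasure Ω))
    {f : EuclideanSpace ℝ (Fin n) → ℝ} {f' : Fin n → EuclideanSpace ℝ (Fin n) → ℝ}
    (h : IsSymbol Ω y (1 - α) f f') (i : Fin n) :
    HasFlux Ω (f' i) (fun x => f x * outwardNormal Ω x i) := by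
  obtain ⟨C₁, hC₁⟩ := h.bound
  obtain ⟨C₂, hC₂⟩ := h.bound_deriv
  obtain ⟨C, hC0, hC⟩ := exists_abs_punctureCutoffDeriv_le (n := n)
  have hne : ∀ x ∈ Ω, x ≠ y := fun x hx => by rintro rfl; exact hy hx
  have hΩm := hΩ.isOpen.measurableSet
  have hfm : AEStronglyMeasurable f (surfaceMeasure Ω) := by
    have h1 : (surfaceMeasure Ω).restrict (closure Ω \ {y}) = surfaceMeasure Ω := by
      refine Measure.restrict_eq_self_of_ae_mem ?_
      filter_upwards [IsBoundedLipschitzDomain.ae_mem_frontier Ω,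
        IsBoundedLipschitzDomain.ae_ne_surfaceMeasure hn Ω y] with x hx hxy
      exact ⟨frontier_subset_closure hx, hxy⟩
    rw [← h1]
    exact h.continuousOn.aestronglyMeasurable
      (isClosed_closure.measurableSet.diff (measurableSet_singleton y))
  have hNm : AEStronglyMeasurable (fun x => outwardNormal Ω x i) (surfaceMeasure Ω) :=
    (EuclideanSpace.proj (𝕜 := ℝ) i).continuous.comp_aestronglyMeasurable
      (hΩ.aestronglyMeasurable_outwardNormal hn)
  have hN1 : ∀ x, |outwardNormal Ω x i| ≤ 1 := fun x =>
    (PiLp.norm_apply_le _ i).trans (norm_outwardNormal_le Ω x)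
  have hfσ : ∀ᵐ x ∂surfaceMeasure Ω, |f x| ≤ C₁ * ‖x - y‖ ^ (1 - α) := by
    filter_upwards [IsBoundedLipschitzDomain.ae_mem_frontier Ω,
      IsBoundedLipschitzDomain.ae_ne_surfaceMeasure hn Ω y] with x hx hxy
    exact hC₁ x (frontier_subset_closure hx) hxy
  have hint1 : IntegrableOn (f' i) Ω :=
    IsSymbol.integrableOn_of_rpow hΩ hI (h.continuousOn_deriv i) (C := C₂) fun x hx => by
      simpa using hC₂ i x hx
  have hint2 : Integrable (fun x => f x * outwardNormal Ω x i) (surfaceMeasure Ω) := by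
    refine (hσ.const_mul C₁).mono' (hfm.mul hNm) ?_
    filter_upwards [hfσ] with x hx
    rw [norm_mul]
    exact (mul_le_of_le_one_right (norm_nonneg _) (hN1 x)).trans hx
  refine ⟨hint1, hint2, ?_⟩
  set ε : ℕ → ℝ := fun k => 1 / ((k : ℝ) + 1) with hεdef
  have hε : ∀ k, 0 < ε k := fun k => by positivity
  have hε0 : Tendsto ε atTop (𝓝 0) := tendsto_one_div_add_atTop_nhds_zero_nat
  have hev : ∀ x, x ≠ y → ∀ᶠ k in atTop, 2 * (ε k) ^ 2 < ‖x - y‖ ^ 2 := fun x hxy => by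
    have hpos := IsSymbol.norm_pos_of_ne hxy
    have : Tendsto (fun k => 2 * (ε k) ^ 2) atTop (𝓝 (2 * 0 ^ 2)) := (hε0.pow 2).const_mul 2
    rw [zero_pow two_ne_zero, mul_zero] at this
    exact this.eventually_lt_const (by positivity)
  have hev1 : ∀ x, x ≠ y → ∀ᶠ k in atTop, punctureCutoff y (ε k) x = 1 := fun x hxy => by
    filter_upwards [hev x hxy] with k hk
    refine Real.smoothTransition.one_of_one_le ?_
    have := hε k
    rw [le_sub_iff_add_le, le_inv_mul_iff₀ (by positivity)]; linarith
  -- The factor 1/ρ from the cutoff gradient is absorbed by f = O(ρ^(1-α)), so a multiple of ρ^(-α)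
  -- dominates for every ε. At a fixed x ≠ y the cutoff is eventually 1 and its gradient 0.
  have hlim1 : Tendsto (fun k => ∫ x in Ω, (f' i x * punctureCutoff y (ε k) x +
      f x * punctureCutoffDeriv y (ε k) i x)) atTop (𝓝 (∫ x in Ω, f' i x)) := by
    refine tendsto_integral_of_dominated_convergence
      (fun x => (C₂ + C₁ * C) * ‖x - y‖ ^ (-α)) (fun k => ?_) (hI.const_mul _) (fun k => ?_) ?_
    · refine ContinuousOn.aestronglyMeasurable ?_ hΩm
      exact ((h.continuousOn_deriv i).mul (continuous_punctureCutoff y _).continuousOn).add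
        (h.continuousOn_interior.mul (continuous_punctureCutoffDeriv y _ i).continuousOn)
    · filter_upwards [ae_restrict_mem hΩm] with x hx
      have h1 := IsSymbol.abs_mul_le (IsSymbol.norm_pos_of_ne (hne x hx))
        (hC₁ x (subset_closure hx) (hne x hx)) (hC y _ (hε k) i x (hne x hx))
      rw [show 1 - α + -1 = -α by ring] at h1
      have h2 := hC₂ i x hx
      rw [show 1 - α - 1 = -α by ring] at h2
      refine (norm_add_le _ _).trans ?_
      rw [add_mul]
      refine add_le_add ?_ h1
      rw [norm_mul]
      exact (mul_le_of_le_one_right (norm_nonneg _) (abs_punctureCutoff_le y _ x)).trans h2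
    · filter_upwards [ae_restrict_mem hΩm] with x hx
      refine tendsto_const_nhds.congr' ?_
      filter_upwards [hev x (hne x hx), hev1 x (hne x hx)] with k hk1 hk2
      rw [hk2, punctureCutoffDeriv_eq_zero (hε k) hk1]; simp
  have hlim2 : Tendsto (fun k => ∫ x, f x * punctureCutoff y (ε k) x * outwardNormal Ω x i
      ∂surfaceMeasure Ω) atTop (𝓝 (∫ x, f x * outwardNormal Ω x i ∂surfaceMeasure Ω)) := by
    refine tendsto_integral_of_dominated_convergence
      (fun x => C₁ * ‖x - y‖ ^ (1 - α)) (fun k => ?_) (hσ.const_mul _) (fun k => ?_) ?_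
    · exact (hfm.mul (continuous_punctureCutoff y _).aestronglyMeasurable).mul hNm
    · filter_upwards [hfσ] with x hx
      rw [norm_mul, norm_mul]
      refine (mul_le_of_le_one_right (by positivity) (hN1 x)).trans ?_
      exact (mul_le_of_le_one_right (norm_nonneg _) (abs_punctureCutoff_le y _ x)).trans hx
    · filter_upwards [IsBoundedLipschitzDomain.ae_ne_surfaceMeasure hn Ω y] with x hxy
      refine tendsto_const_nhds.congr' ?_
      filter_upwards [hev1 x hxy] with k hk
      rw [hk, mul_one]
  exact tendsto_nhds_unique (hlim1.congr fun k => h.mul_punctureCutoff hΩ hn hy (hε k) i) hlim2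

end Flux

/-! ### Derivatives up to the boundary and their vanishing -/

section PartialDerivatives

open Module Filter Metric
open scoped NNReal ENNReal Topology

variable {n : ℕ}

/-- The `i`-th partial derivative of `f` within `s`. -/
noncomputable def partialWithin (s : Set (EuclideanSpace ℝ (Fin n))) (i : Fin n)
    (f : EuclideanSpace ℝ (Fin n) → ℝ) (x : EuclideanSpace ℝ (Fin n)) : ℝ :=
  fderivWithin ℝ f s x (EuclideanSpace.single i 1)

theorem ContDiffOn.partialWithin {s : Set (EuclideanSpace ℝ (Fin n))}
    {f : EuclideanSpace ℝ (Fin n) → ℝ} {k m : ℕ} (hf : ContDiffOn ℝ k f s)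
    (hs : UniqueDiffOn ℝ s) (hmk : m + 1 ≤ k) (i : Fin n) :
    ContDiffOn ℝ m (partialWithin s i f) s :=
  (hf.fderivWithin hs (by exact_mod_cast hmk)).clm_apply contDiffOn_const

theorem coordDual_partialWithin (s : Set (EuclideanSpace ℝ (Fin n)))
    (f : EuclideanSpace ℝ (Fin n) → ℝ) (x : EuclideanSpace ℝ (Fin n)) :
    coordDual (fun i => partialWithin s i f x) = fderivWithin ℝ f s x :=
  coordDual_eta _

theorem partialWithin_partialWithin_eq {s : Set (EuclideanSpace ℝ (Fin n))}
    {f : EuclideanSpace ℝ (Fin n) → ℝ} (hf : ContDiffOn ℝ 2 f s)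
    (hs : UniqueDiffOn ℝ s) {x : EuclideanSpace ℝ (Fin n)} (hx : x ∈ s) (i j : Fin n) :
    partialWithin s j (partialWithin s i f) x =
      fderivWithin ℝ (fderivWithin ℝ f s) s x (EuclideanSpace.single j 1)
        (EuclideanSpace.single i 1) := by
  have h1 : DifferentiableWithinAt ℝ (fderivWithin ℝ f s) s x :=
    (hf.fderivWithin hs (m := 1) (by norm_num)).differentiableOn (by simp) x hx
  have h2 := h1.hasFDerivWithinAt.clm_apply
    (hasFDerivWithinAt_const (EuclideanSpace.single i (1 : ℝ)) x s)
  have h3 := h2.fderivWithin (hs x hx)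
  change fderivWithin ℝ (fun z => fderivWithin ℝ f s z (EuclideanSpace.single i 1)) s x _ = _
  rw [h3]
  simp

theorem partialWithin_comm {s : Set (EuclideanSpace ℝ (Fin n))}
    {f : EuclideanSpace ℝ (Fin n) → ℝ} (hf : ContDiffOn ℝ 2 f s)
    (hs : UniqueDiffOn ℝ s) {x : EuclideanSpace ℝ (Fin n)} (hx : x ∈ s)
    (hx' : x ∈ closure (interior s)) (i j : Fin n) :
    partialWithin s j (partialWithin s i f) x = partialWithin s i (partialWithin s j f) x := by
  rw [partialWithin_partialWithin_eq hf hs hx, partialWithin_partialWithin_eq hf hs hx]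
  exact ((hf x hx).isSymmSndFDerivWithinAt (by simp) hs hx' hx) _ _

theorem hessianNormSq_eq {s : Set (EuclideanSpace ℝ (Fin n))}
    {f : EuclideanSpace ℝ (Fin n) → ℝ} (hf : ContDiffOn ℝ 2 f s)
    (hs : UniqueDiffOn ℝ s) {x : EuclideanSpace ℝ (Fin n)} (hx : x ∈ s) :
    hessianNormSq s f x = ∑ i, ∑ j, (partialWithin s i (partialWithin s j f) x) ^ 2 := by
  unfold hessianNormSq
  refine Finset.sum_congr rfl fun i _ => Finset.sum_congr rfl fun j _ => ?_
  rw [iteratedFDerivWithin_two_apply' f hs hx, partialWithin_partialWithin_eq hf hs hx]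

variable {Ω : Set (EuclideanSpace ℝ (Fin n))} {y : EuclideanSpace ℝ (Fin n)}

theorem hasPartials_partialWithin (hΩ : IsOpen Ω) {f : EuclideanSpace ℝ (Fin n) → ℝ}
    (hf : ContDiffOn ℝ 1 f (closure Ω)) {x : EuclideanSpace ℝ (Fin n)} (hx : x ∈ Ω) :
    HasPartials f (fun i => partialWithin (closure Ω) i f x) x := by
  rw [HasPartials, coordDual_partialWithin]
  exact (hf.differentiableOn (by simp) x (subset_closure hx)).hasFDerivWithinAt.hasFDerivAt
    (mem_of_superset (hΩ.mem_nhds hx) subset_closure)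

theorem exists_rpow_bound_of_nonneg (hΩ : IsBoundedLipschitzDomain Ω)
    (y : EuclideanSpace ℝ (Fin n)) {k : ℝ} (hk : 0 ≤ k ∨ y ∉ closure Ω) :
    ∃ C, 0 ≤ C ∧ ∀ x ∈ closure Ω, ‖x - y‖ ^ k ≤ C := by
  rcases hk with hk | hk
  · obtain ⟨R, hR⟩ := (hΩ.isCompact_closure.isBounded).subset_closedBall y
    refine ⟨|R ^ k|, abs_nonneg _, fun x hx => ?_⟩
    have h1 := hR hx
    rw [mem_closedBall, dist_eq_norm] at h1
    exact (Real.rpow_le_rpow (norm_nonneg _) h1 hk).trans (le_abs_self _)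
  · obtain ⟨ε, hε, hsub⟩ := Metric.isOpen_iff.1 isClosed_closure.isOpen_compl y hk
    obtain ⟨C, hC, h⟩ := exists_rpow_bound hΩ y hε k
    refine ⟨C, hC, fun x hx => h x hx ?_⟩
    by_contra hlt
    exact hsub (by rwa [mem_ball, dist_eq_norm, ← not_le]) hx

theorem abs_le_mul_rpow {a M C ρ k : ℝ} (hρ : 0 < ρ) (ha : |a| ≤ M) (hC : ρ ^ (-k) ≤ C) :
    |a| ≤ M * C * ρ ^ k := by
  have h1 : ρ ^ (-k) * ρ ^ k = 1 := by rw [← Real.rpow_add hρ]; simp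
  have hM : 0 ≤ M := (abs_nonneg _).trans ha
  calc |a| ≤ M * (ρ ^ (-k) * ρ ^ k) := by rw [h1, mul_one]; exact ha
    _ ≤ M * (C * ρ ^ k) := by gcongr
    _ = _ := by ring

theorem ContDiffOn.exists_bound_partialWithin (hΩ : IsBoundedLipschitzDomain Ω)
    {f : EuclideanSpace ℝ (Fin n) → ℝ} (hf : ContDiffOn ℝ 1 f (closure Ω)) :
    ∃ M, ∀ i, ∀ x ∈ closure Ω, |_root_.partialWithin (closure Ω) i f x| ≤ M := by
  obtain ⟨M, hM⟩ := hΩ.isCompact_closure.exists_bound_of_continuousOn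
    (hf.continuousOn_fderivWithin hΩ.uniqueDiffOn_closure (by simp))
  refine ⟨M, fun i x hx => ((fderivWithin ℝ f (closure Ω) x).le_opNorm _).trans ?_⟩
  simpa using hM x hx

theorem ContDiffOn.continuousOn_partialWithin (hΩ : IsBoundedLipschitzDomain Ω)
    {f : EuclideanSpace ℝ (Fin n) → ℝ} (hf : ContDiffOn ℝ 1 f (closure Ω)) (i : Fin n) :
    ContinuousOn (_root_.partialWithin (closure Ω) i f) Ω :=
  (ContDiffOn.continuousOn (n := (0 : ℕ))
    (hf.partialWithin (k := 1) hΩ.uniqueDiffOn_closure le_rfl i)).mono subset_closure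

/-- The function and its gradient are bounded, which is stronger than a nonpositive order because ρ
is bounded on the closure. If y is off the closure, ρ is also bounded below and every order is
attained. -/
theorem ContDiffOn.isSymbol (hΩ : IsBoundedLipschitzDomain Ω) (hy : y ∉ Ω)
    {f : EuclideanSpace ℝ (Fin n) → ℝ} (hf : ContDiffOn ℝ 1 f (closure Ω)) {k : ℝ}
    (hk : k ≤ 0 ∨ y ∉ closure Ω) :
    IsSymbol Ω y k f (fun i => _root_.partialWithin (closure Ω) i f) where
  continuousOn := hf.continuousOn.mono sdiff_subset
  hasPartials x hx := hasPartials_partialWithin hΩ.isOpen hf hx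
  continuousOn_deriv i := hf.continuousOn_partialWithin hΩ i
  bound := by
    obtain ⟨M, hM⟩ := hΩ.isCompact_closure.exists_bound_of_continuousOn hf.continuousOn
    obtain ⟨C, -, hC⟩ := exists_rpow_bound_of_nonneg hΩ y (k := -k) (by
      rcases hk with hk | hk
      · left; linarith
      · exact Or.inr hk)
    exact ⟨M * C, fun x hx hxy =>
      abs_le_mul_rpow (IsSymbol.norm_pos_of_ne hxy) (hM x hx) (hC x hx)⟩
  bound_deriv := by
    obtain ⟨M, hM⟩ := hf.exists_bound_partialWithin hΩ
    obtain ⟨C, -, hC⟩ := exists_rpow_bound_of_nonneg hΩ y (k := -(k - 1)) (by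
      rcases hk with hk | hk
      · left; linarith
      · exact Or.inr hk)
    exact ⟨M * C, fun i x hx =>
      abs_le_mul_rpow (IsSymbol.norm_pos_of_ne (by rintro rfl; exact hy hx))
        (hM i x (subset_closure hx)) (hC x (subset_closure hx))⟩

/-- A function that is Lipschitz up to the boundary and vanishes at y is O(ρ). -/
theorem ContDiffOn.isSymbol_one (hΩ : IsBoundedLipschitzDomain Ω) (hy : y ∉ Ω)
    {f : EuclideanSpace ℝ (Fin n) → ℝ} (hf : ContDiffOn ℝ 1 f (closure Ω))
    (h0 : y ∈ frontier Ω → f y = 0) :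
    IsSymbol Ω y 1 f (fun i => _root_.partialWithin (closure Ω) i f) := by
  by_cases hyc : y ∈ closure Ω
  swap
  · exact hf.isSymbol hΩ hy (Or.inr hyc)
  have hyf : y ∈ frontier Ω := ⟨hyc, by rwa [hΩ.isOpen.interior_eq]⟩
  obtain ⟨M, hM⟩ := hf.exists_bound_partialWithin hΩ
  exact {
    continuousOn := hf.continuousOn.mono sdiff_subset
    hasPartials := fun x hx => hasPartials_partialWithin hΩ.isOpen hf hx
    continuousOn_deriv := fun i => hf.continuousOn_partialWithin hΩ i
    bound := by
      obtain ⟨C, g, hg, hfg⟩ := hΩ.exists_lipschitzWith_eqOn hf.continuousOn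
        (fun x hx => hasPartials_partialWithin hΩ.isOpen hf hx)
        (fun x hx => norm_coordDual_le fun i => hM i x (subset_closure hx))
      refine ⟨C, fun x hx _ => ?_⟩
      have h1 := hg.dist_le_mul x y
      rw [← hfg hx, ← hfg hyc, h0 hyf, Real.dist_eq, sub_zero, dist_eq_norm] at h1
      rwa [Real.rpow_one]
    bound_deriv := ⟨M, fun i x hx => by
      rw [sub_self, Real.rpow_zero, mul_one]; exact hM i x (subset_closure hx)⟩ }

theorem fderivWithin_eq_zero_of_gradientWithin {s : Set (EuclideanSpace ℝ (Fin n))}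
    {f : EuclideanSpace ℝ (Fin n) → ℝ} {x : EuclideanSpace ℝ (Fin n)}
    (h : gradientWithin f s x = 0) : fderivWithin ℝ f s x = 0 := by
  rw [gradientWithin] at h
  exact (LinearIsometryEquiv.map_eq_zero_iff _).1 h

/-- Since u and ∇u vanish on the boundary, the extension of u by zero is differentiable everywhere.
Its gradient is O(ρ) by the previous case applied to each ∂ᵢu, and the mean value inequality on the
ball around y through x gives O(ρ²). Extending avoids having to join y to x inside Ω. -/
theorem ContDiffOn.isSymbol_two (hΩ : IsBoundedLipschitzDomain Ω) (hy : y ∉ Ω)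
    {f : EuclideanSpace ℝ (Fin n) → ℝ} (hf : ContDiffOn ℝ 2 f (closure Ω))
    (h0 : ∀ x ∈ frontier Ω, f x = 0) (h1 : ∀ x ∈ frontier Ω, gradientWithin f (closure Ω) x = 0) :
    IsSymbol Ω y 2 f (fun i => _root_.partialWithin (closure Ω) i f) := by
  have hf1 : ContDiffOn ℝ 1 f (closure Ω) := hf.of_le (by norm_num)
  by_cases hyc : y ∈ closure Ω
  swap
  · exact hf1.isSymbol hΩ hy (Or.inr hyc)
  have hyf : y ∈ frontier Ω := ⟨hyc, by rwa [hΩ.isOpen.interior_eq]⟩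
  have hD : ∀ x ∈ frontier Ω, fderivWithin ℝ f (closure Ω) x = 0 := fun x hx =>
    fderivWithin_eq_zero_of_gradientWithin (h1 x hx)
  have hsym : ∀ i, IsSymbol Ω y 1 (_root_.partialWithin (closure Ω) i f) _ := fun i =>
    ContDiffOn.isSymbol_one hΩ hy
      (hf.partialWithin (k := 2) (m := 1) hΩ.uniqueDiffOn_closure le_rfl i)
      (fun _ => by simp [_root_.partialWithin, hD y hyf])
  choose C hC using fun i => (hsym i).bound
  obtain ⟨M, hM⟩ : ∃ M, ∀ i, C i ≤ M := by
    obtain ⟨M, hM⟩ := (Set.finite_range C).bddAbove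
    exact ⟨M, fun i => hM ⟨i, rfl⟩⟩
  have hbd : ∀ i, ∀ x ∈ Ω, |_root_.partialWithin (closure Ω) i f x| ≤ |M| * ‖x - y‖ :=
    fun i x hx => by
      have := hC i x (subset_closure hx) (by rintro rfl; exact hy hx)
      rw [Real.rpow_one] at this
      exact this.trans (mul_le_mul_of_nonneg_right ((hM i).trans (le_abs_self _)) (norm_nonneg _))
  set g := Ω.indicator f with hg
  set A : EuclideanSpace ℝ (Fin n) → EuclideanSpace ℝ (Fin n) →L[ℝ] ℝ :=
    Ω.indicator (fderivWithin ℝ f (closure Ω)) with hA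
  have hgA : ∀ z, HasFDerivAt g (A z) z := by
    intro z
    by_cases hz : z ∈ Ω
    · rw [hA, indicator_of_mem hz, ← coordDual_partialWithin]
      refine HasFDerivAt.congr_of_eventuallyEq (hasPartials_partialWithin hΩ.isOpen hf1 hz) ?_
      filter_upwards [hΩ.isOpen.mem_nhds hz] with w hw
      rw [hg, indicator_of_mem hw]
    rw [hA, indicator_of_notMem hz]
    have hc : HasFDerivWithinAt g (0 : EuclideanSpace ℝ (Fin n) →L[ℝ] ℝ) Ωᶜ z :=
      (hasFDerivWithinAt_const (0 : ℝ) z Ωᶜ).congr (fun w hw => indicator_of_notMem hw _)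
        (indicator_of_notMem hz _)
    by_cases hzc : z ∈ closure Ω
    · have hzf : z ∈ frontier Ω := ⟨hzc, by rwa [hΩ.isOpen.interior_eq]⟩
      have h2 := (hf1.differentiableOn (by simp) z hzc).hasFDerivWithinAt.mono subset_closure
      rw [hD z hzf] at h2
      have h3 : HasFDerivWithinAt g (0 : EuclideanSpace ℝ (Fin n) →L[ℝ] ℝ) Ω z :=
        h2.congr (fun w hw => indicator_of_mem hw _) (by
          rw [hg, indicator_of_notMem hz, h0 z hzf])
      have h4 := h3.union hc
      rwa [union_compl_self, hasFDerivWithinAt_univ] at h4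
    · refine hc.hasFDerivAt ?_
      filter_upwards [isClosed_closure.isOpen_compl.mem_nhds hzc] with w hw hw'
      exact hw (subset_closure hw')
  have hAb : ∀ z, ‖A z‖ ≤ n * (|M| * ‖z - y‖) := by
    intro z
    by_cases hz : z ∈ Ω
    · rw [hA, indicator_of_mem hz, ← coordDual_partialWithin]
      exact norm_coordDual_le fun i => hbd i z hz
    · rw [hA, indicator_of_notMem hz, norm_zero]; positivity
  exact {
    continuousOn := hf.continuousOn.mono sdiff_subset
    hasPartials := fun x hx => hasPartials_partialWithin hΩ.isOpen hf1 hx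
    continuousOn_deriv := fun i => hf1.continuousOn_partialWithin hΩ i
    bound := by
      refine ⟨n * |M|, fun x hx hxy => ?_⟩
      have h2 : g x = f x := by
        by_cases hxΩ : x ∈ Ω
        · rw [hg, indicator_of_mem hxΩ]
        · rw [hg, indicator_of_notMem hxΩ, h0 x ⟨hx, by rwa [hΩ.isOpen.interior_eq]⟩]
      have h3 := (convex_closedBall y ‖x - y‖).norm_image_sub_le_of_norm_hasFDerivWithin_le
        (f := g) (f' := A) (C := n * (|M| * ‖x - y‖)) (x := y) (y := x)
        (fun z _ => (hgA z).hasFDerivWithinAt)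
        (fun z hz => (hAb z).trans (by
          rw [mem_closedBall, dist_eq_norm] at hz; gcongr)) (by simp)
        (by rw [mem_closedBall, dist_eq_norm])
      have h4 : g y = 0 := indicator_of_notMem hy _
      rw [h4, h2, sub_zero] at h3
      rw [Real.rpow_two]
      calc |f x| ≤ _ := h3
        _ = _ := by ring
    bound_deriv := ⟨|M|, fun i x hx => by
      rw [show (2 : ℝ) - 1 = 1 by norm_num, Real.rpow_one]; exact hbd i x hx⟩ }

/-- A function vanishing on the boundary has no tangential derivative where the normal exists. -/
theorem IsOutwardUnitNormal.apply_eq_zero (hΩ : IsOpen Ω) {x ν : EuclideanSpace ℝ (Fin n)}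
    (hx : x ∈ frontier Ω) (hν : IsOutwardUnitNormal Ω x ν) {f : EuclideanSpace ℝ (Fin n) → ℝ}
    {L : EuclideanSpace ℝ (Fin n) →L[ℝ] ℝ} (hf : HasFDerivWithinAt f L (closure Ω) x)
    (h0 : ∀ z ∈ frontier Ω, f z = 0) {τ : EuclideanSpace ℝ (Fin n)} (hτ : ⟪τ, ν⟫_ℝ = 0) :
    L τ = 0 := by
  have key : ∀ δ : ℝ, 0 < δ → δ ≤ 1 → |L τ| ≤ δ * (‖L‖ + ‖τ‖ + 1) := by
    intro δ hδ hδ1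
    -- With this aperture the points x + tτ - tδν and x + tτ + tδν lie inside and outside Ω. The
    -- segment between them meets the frontier, where f = 0, and at that point the first-order
    -- expansion forces |L τ| = O(δ).
    set ε := δ / (2 * (‖τ‖ + δ)) with hε
    have hε0 : 0 < ε := by positivity
    have hεδ : ε * (‖τ‖ + δ) = δ / 2 := by rw [hε]; field_simp
    obtain ⟨r, hr, hr'⟩ := hν.2 ε hε0
    have h1 := hf.isLittleO.def hδ
    rw [eventually_nhdsWithin_iff] at h1
    obtain ⟨r₂, hr₂, hr₂'⟩ := Metric.eventually_nhds_iff_ball.1 h1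
    set t := min r r₂ / (2 * (‖τ‖ + δ)) with ht
    have hmin : 0 < min r r₂ := lt_min hr hr₂
    have ht0 : 0 < t := by positivity
    have htm : t * (‖τ‖ + δ) = min r r₂ / 2 := by rw [ht]; field_simp
    have hpt : ∀ s ∈ Icc (-δ) δ, ‖t • τ + (t * s) • ν‖ ≤ t * (‖τ‖ + δ) := fun s hs => by
      refine (norm_add_le _ _).trans ?_
      rw [norm_smul, norm_smul, hν.1, mul_one, Real.norm_of_nonneg ht0.le, norm_mul,
        Real.norm_of_nonneg ht0.le, mul_add]
      have : ‖s‖ ≤ δ := abs_le.2 hs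
      gcongr
    have hball : ∀ s ∈ Icc (-δ) δ, x + (t • τ + (t * s) • ν) ∈ ball x r ∩ ball x r₂ := fun s hs => by
      have := hpt s hs
      rw [mem_inter_iff, mem_ball, mem_ball, dist_eq_norm, add_sub_cancel_left]
      constructor <;> linarith [min_le_left r r₂, min_le_right r r₂]
    have hinner : ∀ s : ℝ, ⟪x + (t • τ + (t * s) • ν) - x, ν⟫_ℝ = t * s := fun s => by
      rw [add_sub_cancel_left, inner_add_left, real_inner_smul_left, real_inner_smul_left, hτ,
        real_inner_self_eq_norm_sq, hν.1]; ring
    have hsmall : ∀ s ∈ Icc (-δ) δ, ε * ‖x + (t • τ + (t * s) • ν) - x‖ < t * δ := fun s hs => by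
      rw [add_sub_cancel_left]
      have := mul_le_mul_of_nonneg_left (hpt s hs) hε0.le
      nlinarith
    have hm : -δ ∈ Icc (-δ) δ := ⟨le_rfl, by linarith⟩
    have hp : δ ∈ Icc (-δ) δ := ⟨by linarith, le_rfl⟩
    have hin : x + (t • τ + (t * -δ) • ν) ∈ Ω := by
      refine (hr' _ (hball _ hm).1).1 ?_
      rw [hinner]; have := hsmall _ hm; linarith
    have hout : x + (t • τ + (t * δ) • ν) ∉ Ω := by
      refine (hr' _ (hball _ hp).1).2 ?_
      rw [hinner]; exact hsmall _ hp
    obtain ⟨p, ⟨a, b, ha, hb, hab, rfl⟩, hpf⟩ := exists_mem_segment_frontier hΩ hin hout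
    have hs : (b - a) * δ ∈ Icc (-δ) δ := ⟨by nlinarith, by nlinarith⟩
    have hpe : a • (x + (t • τ + (t * -δ) • ν)) + b • (x + (t • τ + (t * δ) • ν)) =
        x + (t • τ + (t * ((b - a) * δ)) • ν) := by
      have : a = 1 - b := by linarith
      rw [this]; module
    rw [hpe] at hpf
    have h2 := hr₂' _ (hball _ hs).2 (frontier_subset_closure hpf)
    rw [h0 _ hpf, h0 _ hx, sub_self, zero_sub, norm_neg, add_sub_cancel_left] at h2
    have h3 := h2.trans (mul_le_mul_of_nonneg_left (hpt _ hs) hδ.le)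
    have h4 : t * L τ = L (t • τ + (t * ((b - a) * δ)) • ν) - (t * ((b - a) * δ)) * L ν := by
      rw [map_add, map_smul, map_smul]; simp
    have h5 : |L ν| ≤ ‖L‖ := by simpa [hν.1] using L.le_opNorm ν
    have h6 : |(t * ((b - a) * δ)) * L ν| ≤ t * δ * ‖L‖ := by
      rw [abs_mul, abs_mul, abs_of_pos ht0]
      have : |(b - a) * δ| ≤ δ := abs_le.2 hs
      gcongr
    have h7 : t * |L τ| ≤ t * (δ * (‖L‖ + ‖τ‖ + 1)) := by
      rw [← abs_of_pos ht0, ← abs_mul, abs_of_pos ht0, h4]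
      refine (abs_sub _ _).trans ?_
      have h8 : t * (δ * δ) ≤ t * (δ * 1) := by gcongr
      rw [Real.norm_eq_abs] at h3
      nlinarith
    exact le_of_mul_le_mul_left h7 ht0
  have hlim : Tendsto (fun δ : ℝ => δ * (‖L‖ + ‖τ‖ + 1)) (𝓝[>] 0) (𝓝 0) := by
    have : Continuous fun δ : ℝ => δ * (‖L‖ + ‖τ‖ + 1) := by fun_prop
    simpa using (this.tendsto 0).mono_left nhdsWithin_le_nhds
  have h1 : |L τ| ≤ 0 := by
    refine ge_of_tendsto hlim ?_
    filter_upwards [Ioc_mem_nhdsGT (zero_lt_one' ℝ)] with δ hδ using key δ hδ.1 hδ.2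
  exact abs_nonpos_iff.1 h1

/-- Where `u` and `∇u` vanish on the boundary, the Hessian is a multiple of `N ⊗ N`. -/
theorem exists_hessian_eq (hΩ : IsBoundedLipschitzDomain Ω) {u : EuclideanSpace ℝ (Fin n) → ℝ}
    (hu : ContDiffOn ℝ 2 u (closure Ω))
    (hu₁ : ∀ x ∈ frontier Ω, gradientWithin u (closure Ω) x = 0) {x ν : EuclideanSpace ℝ (Fin n)}
    (hx : x ∈ frontier Ω) (hν : IsOutwardUnitNormal Ω x ν) :
    ∃ c : ℝ, ∀ i j, partialWithin (closure Ω) j (partialWithin (closure Ω) i u) x =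
      c * ν i * ν j := by
  have hs := hΩ.uniqueDiffOn_closure
  have hxc := frontier_subset_closure hx
  have hν2 : ∑ j, ν j * ν j = 1 := by
    have := EuclideanSpace.real_norm_sq_eq ν
    rw [hν.1] at this
    simp only [← pow_two]; rw [← this]; norm_num
  have h1 : ∀ i, ∃ c, ∀ j,
      partialWithin (closure Ω) j (partialWithin (closure Ω) i u) x = c * ν j := by
    intro i
    have hd : ContDiffOn ℝ 1 (partialWithin (closure Ω) i u) (closure Ω) :=
      hu.partialWithin (k := 2) (m := 1) hs le_rfl i
    set L := fderivWithin ℝ (partialWithin (closure Ω) i u) (closure Ω) x with hL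
    have hL' := (hd.differentiableOn (by simp) x hxc).hasFDerivWithinAt
    have h0 : ∀ z ∈ frontier Ω, partialWithin (closure Ω) i u z = 0 := fun z hz => by
      simp [partialWithin, fderivWithin_eq_zero_of_gradientWithin (hu₁ z hz)]
    refine ⟨L ν, fun j => ?_⟩
    -- The tangential part of the j-th basis vector.
    have h2 := hν.apply_eq_zero hΩ.isOpen hx hL' h0
      (τ := EuclideanSpace.single j 1 - ν j • ν) (by
        rw [inner_sub_left, real_inner_smul_left, real_inner_self_eq_norm_sq, hν.1,
          EuclideanSpace.inner_single_left]; simp)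
    rw [map_sub, map_smul, sub_eq_zero] at h2
    rw [partialWithin, h2, smul_eq_mul, mul_comm]
  -- So ∇²u = c ⊗ ν for a vector c. Symmetry makes c parallel to ν, namely c = (c·ν) ν.
  choose c hc using h1
  have hsymm : ∀ i j, c i * ν j = c j * ν i := fun i j => by
    rw [← hc, ← hc]
    refine partialWithin_comm hu hs hxc ?_ i j
    exact closure_mono (interior_maximal subset_closure hΩ.isOpen) hxc
  refine ⟨∑ j, c j * ν j, fun i j => ?_⟩
  rw [hc]
  congr 1
  calc c i = c i * ∑ j, ν j * ν j := by rw [hν2, mul_one]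
    _ = ∑ j, (c j * ν j) * ν i := by
      rw [Finset.mul_sum]
      exact Finset.sum_congr rfl fun j _ => by rw [← mul_assoc, hsymm i j]; ring
    _ = _ := by rw [Finset.sum_mul]

end PartialDerivatives

/-! ### The vector fields of the identity and their divergences -/

section Fields

variable {n : ℕ}

/-- The contraction of the vector field `F` with `x - y`. -/
noncomputable def radContract (y : EuclideanSpace ℝ (Fin n))
    (F : Fin n → EuclideanSpace ℝ (Fin n) → ℝ) (x : EuclideanSpace ℝ (Fin n)) : ℝ :=
  ∑ k, (x k - y k) * F k x

/-- The pointwise scalar product of two vector fields. -/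
noncomputable def pairing (F G : Fin n → EuclideanSpace ℝ (Fin n) → ℝ)
    (x : EuclideanSpace ℝ (Fin n)) : ℝ := ∑ k, F k x * G k x

variable {Ω : Set (EuclideanSpace ℝ (Fin n))} {y : EuclideanSpace ℝ (Fin n)} {α k l : ℝ}
  {f : EuclideanSpace ℝ (Fin n) → ℝ} {f' : Fin n → EuclideanSpace ℝ (Fin n) → ℝ}
  {F G : Fin n → EuclideanSpace ℝ (Fin n) → ℝ}
  {F' G' : Fin n → Fin n → EuclideanSpace ℝ (Fin n) → ℝ}

namespace IsSymbol

theorem radContract (hy : y ∉ Ω) (hF : ∀ j, IsSymbol Ω y k (F j) (F' j)) :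
    IsSymbol Ω y (1 + k) (radContract y F)
      (fun i x => F i x + _root_.radContract y (fun j => F' j i) x) := by
  refine (IsSymbol.sum Finset.univ fun j _ => (IsSymbol.coord hy j).mul hy (hF j)).congr_deriv ?_
  intro i x _
  simp [_root_.radContract, Finset.sum_add_distrib]

theorem pairing (hy : y ∉ Ω) (hF : ∀ j, IsSymbol Ω y k (F j) (F' j))
    (hG : ∀ j, IsSymbol Ω y l (G j) (G' j)) :
    IsSymbol Ω y (k + l) (pairing F G)
      (fun i x => _root_.pairing (fun j => F' j i) G x + _root_.pairing F (fun j => G' j i) x) := by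
  refine (IsSymbol.sum Finset.univ fun j _ => (hF j).mul hy (hG j)).congr_deriv ?_
  intro i x _
  simp [_root_.pairing, Finset.sum_add_distrib]

theorem integrableOn (hΩ : IsBoundedLipschitzDomain Ω) (hy : y ∉ Ω)
    (hI : IntegrableOn (fun x => ‖x - y‖ ^ (-α)) Ω) (h : IsSymbol Ω y (-α) f f') :
    IntegrableOn f Ω := by
  obtain ⟨C, hC⟩ := h.bound
  exact integrableOn_of_rpow hΩ hI h.continuousOn_interior fun x hx =>
    hC x (subset_closure hx) (by rintro rfl; exact hy hx)

theorem hasFlux_sum (hΩ : IsBoundedLipschitzDomain Ω) (hn : 2 ≤ n) (hy : y ∉ Ω)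
    (hI : IntegrableOn (fun x => ‖x - y‖ ^ (-α)) Ω)
    (hσ : Integrable (fun x => ‖x - y‖ ^ (1 - α)) (surfaceMeasure Ω))
    (h : ∀ i, IsSymbol Ω y (1 - α) (F i) (F' i)) :
    HasFlux Ω (fun x => ∑ i, F' i i x) (fun x => ∑ i, F i x * outwardNormal Ω x i) :=
  HasFlux.sum Finset.univ fun i _ => (h i).hasFlux hΩ hn hy hI hσ i

theorem hasFlux_smul (hΩ : IsBoundedLipschitzDomain Ω) (hn : 2 ≤ n) (hy : y ∉ Ω)
    (hI : IntegrableOn (fun x => ‖x - y‖ ^ (-α)) Ω)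
    (hσ : Integrable (fun x => ‖x - y‖ ^ (1 - α)) (surfaceMeasure Ω))
    (hf : IsSymbol Ω y k f f') (hF : ∀ i, IsSymbol Ω y l (F i) (F' i)) (hkl : k + l = 1 - α) :
    HasFlux Ω (fun x => _root_.pairing f' F x + f x * ∑ i, F' i i x)
      (fun x => f x * ∑ i, F i x * outwardNormal Ω x i) := by
  refine (hasFlux_sum hΩ hn hy hI hσ fun i =>
    (hf.mul hy (hF i)).congr_exponent hkl).congr hΩ.isOpen.measurableSet ?_ ?_
  · intro x _
    simp [_root_.pairing, Finset.sum_add_distrib, Finset.mul_sum]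
  · filter_upwards with x
    simp [Finset.mul_sum, mul_assoc]

theorem hasFlux_radial (hΩ : IsBoundedLipschitzDomain Ω) (hn : 2 ≤ n) (hy : y ∉ Ω)
    (hI : IntegrableOn (fun x => ‖x - y‖ ^ (-α)) Ω)
    (hσ : Integrable (fun x => ‖x - y‖ ^ (1 - α)) (surfaceMeasure Ω))
    (hf : IsSymbol Ω y (-α) f f') :
    HasFlux Ω (fun x => n * f x + _root_.radContract y f' x)
      (fun x => f x * ∑ i, (x i - y i) * outwardNormal Ω x i) := by
  refine (hasFlux_smul hΩ hn hy hI hσ hf (IsSymbol.coord hy) (by ring)).congr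
    hΩ.isOpen.measurableSet ?_ ?_
  · intro x _
    simp only [_root_.pairing, _root_.radContract, if_true, Finset.sum_const, Finset.card_univ,
      Fintype.card_fin, nsmul_eq_mul, mul_one, mul_comm]
    ring
  · filter_upwards with x using rfl

end IsSymbol

/-- `U1, …, U4` are the successive partial derivatives of `u`, which vanishes to second order
at `y`. -/
structure IsJet (Ω : Set (EuclideanSpace ℝ (Fin n))) (y : EuclideanSpace ℝ (Fin n))
    (u : EuclideanSpace ℝ (Fin n) → ℝ) (U1 : Fin n → EuclideanSpace ℝ (Fin n) → ℝ)
    (U2 : Fin n → Fin n → EuclideanSpace ℝ (Fin n) → ℝ)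
    (U3 : Fin n → Fin n → Fin n → EuclideanSpace ℝ (Fin n) → ℝ)
    (U4 : Fin n → Fin n → Fin n → Fin n → EuclideanSpace ℝ (Fin n) → ℝ) : Prop where
  notMem : y ∉ Ω
  zero : IsSymbol Ω y 2 u U1
  one : ∀ i, IsSymbol Ω y 1 (U1 i) (U2 i)
  two : ∀ i j, IsSymbol Ω y 0 (U2 i j) (U3 i j)
  three : ∀ i j k, IsSymbol Ω y (-1) (U3 i j k) (U4 i j k)
  symm : ∀ x ∈ closure Ω, ∀ i j, U2 i j x = U2 j i x
  symm_left : ∀ x ∈ closure Ω, ∀ i j k, U3 i j k x = U3 j i k x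
  symm_right : ∀ x ∈ closure Ω, ∀ i j k, U3 i j k x = U3 i k j x

section Jet

variable {u : EuclideanSpace ℝ (Fin n) → ℝ} {U1 : Fin n → EuclideanSpace ℝ (Fin n) → ℝ}
  {U2 : Fin n → Fin n → EuclideanSpace ℝ (Fin n) → ℝ}
  {U3 : Fin n → Fin n → Fin n → EuclideanSpace ℝ (Fin n) → ℝ}
  {U4 : Fin n → Fin n → Fin n → Fin n → EuclideanSpace ℝ (Fin n) → ℝ}

theorem sum_sub_mul_self (x y : EuclideanSpace ℝ (Fin n)) :
    ∑ i, (x i - y i) * (x i - y i) = ‖x - y‖ ^ 2 := by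
  rw [EuclideanSpace.real_norm_sq_eq]
  exact Finset.sum_congr rfl fun i _ => by simp; ring

theorem rpow_eq_sq_mul {ρ : ℝ} (hρ : 0 < ρ) (β : ℝ) : ρ ^ β = ρ ^ 2 * ρ ^ (β - 2) := by
  rw [← Real.rpow_natCast, ← Real.rpow_add hρ]
  congr 1; push_cast; ring

namespace IsJet

variable (J : IsJet Ω y u U1 U2 U3 U4)
include J

theorem ne {x : EuclideanSpace ℝ (Fin n)} (hx : x ∈ Ω) : x ≠ y := by
  rintro rfl; exact J.notMem hx

/-- The radial derivative `(x - y) · ∇u`. -/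
theorem rad : IsSymbol Ω y 2 (radContract y U1) (fun i x => U1 i x + radContract y (U2 i) x) :=
  ((IsSymbol.radContract J.notMem J.one).congr_exponent (by norm_num)).congr_deriv fun i x hx => by
    simp only [radContract]
    congr 1
    exact Finset.sum_congr rfl fun j _ => by rw [J.symm x (subset_closure hx) i j]

/-- The vector `∇²u (x - y)`. -/
theorem hessRad (i : Fin n) : IsSymbol Ω y 1 (radContract y (U2 i))
    (fun j x => U2 i j x + radContract y (U3 i j) x) :=
  ((IsSymbol.radContract J.notMem (J.two i)).congr_exponent (by norm_num)).congr_deriv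
    fun j x hx => by
      simp only [radContract]
      congr 1
      exact Finset.sum_congr rfl fun k _ => by rw [J.symm_right x (subset_closure hx) i j k]

theorem lap : IsSymbol Ω y 0 (fun x => ∑ i, U2 i i x) (fun k x => ∑ i, U3 i i k x) :=
  IsSymbol.sum Finset.univ fun i _ => J.two i i

theorem gradLap (k : Fin n) : IsSymbol Ω y (-1) (fun x => ∑ i, U3 i i k x)
    (fun l x => ∑ i, U4 i i k l x) :=
  IsSymbol.sum Finset.univ fun i _ => J.three i i k

theorem hessSq : IsSymbol Ω y 0 (fun x => ∑ i, pairing (U2 i) (U2 i) x)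
    (fun k x => ∑ i, 2 * pairing (U2 i) (fun j => U3 i j k) x) := by
  refine ((IsSymbol.sum Finset.univ fun i _ =>
    IsSymbol.pairing J.notMem (J.two i) (J.two i)).congr_exponent (by norm_num)).congr_deriv ?_
  intro k x _
  refine Finset.sum_congr rfl fun i _ => ?_
  rw [two_mul]
  congr 1
  exact Finset.sum_congr rfl fun j _ => mul_comm _ _

theorem gradSq : IsSymbol Ω y 2 (pairing U1 U1) (fun k x => 2 * ∑ i, U1 i x * U2 i k x) := by
  refine ((IsSymbol.pairing J.notMem J.one J.one).congr_exponent (by norm_num)).congr_deriv ?_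
  intro k x _
  simp only [pairing, two_mul]
  congr 1
  exact Finset.sum_congr rfl fun j _ => mul_comm _ _

theorem weight : IsSymbol Ω y (-α) (fun x => ‖x - y‖ ^ (-α))
    (fun i x => -α * (x i - y i) * ‖x - y‖ ^ (-α - 2)) :=
  IsSymbol.norm_sub_rpow J.notMem _

/-- The function `ρ^(-α) (x - y) · ∇u`. -/
theorem mult : IsSymbol Ω y (2 - α) (fun x => radContract y U1 x * ‖x - y‖ ^ (-α))
    (fun i x => (U1 i x + radContract y (U2 i) x) * ‖x - y‖ ^ (-α) +
      radContract y U1 x * (-α * (x i - y i) * ‖x - y‖ ^ (-α - 2))) :=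
  (J.rad.mul J.notMem J.weight).congr_exponent (by ring)

/-- The gradient of ρ^(-α) h is differentiated once more. Of the two copies of `U2 i j`, one comes
from ∇u and one from differentiating x - y in ∇²u (x - y). -/
theorem gradMult (i : Fin n) : IsSymbol Ω y (1 - α)
    (fun x => (U1 i x + radContract y (U2 i) x) * ‖x - y‖ ^ (-α) +
      radContract y U1 x * (-α * (x i - y i) * ‖x - y‖ ^ (-α - 2)))
    (fun j x => (2 * U2 i j x + radContract y (U3 i j) x) * ‖x - y‖ ^ (-α)
      - α * ‖x - y‖ ^ (-α - 2) * ((U1 i x + radContract y (U2 i) x) * (x j - y j) +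
        (U1 j x + radContract y (U2 j) x) * (x i - y i) +
        radContract y U1 x * (if j = i then 1 else 0))
      + α * (α + 2) * radContract y U1 x * (x i - y i) * (x j - y j) *
        ‖x - y‖ ^ (-α - 2 - 2)) := by
  have h1 := (((J.one i).add (J.hessRad i)).mul J.notMem (J.weight (α := α))).congr_exponent
    (l := 1 - α) (by ring)
  have h2 : IsSymbol Ω y (-α - 1) (fun x => -α * (x i - y i) * ‖x - y‖ ^ (-α - 2)) _ :=
    (((IsSymbol.coord J.notMem i).const_mul (-α)).mul J.notMem
      (IsSymbol.norm_sub_rpow J.notMem (-α - 2))).congr_exponent (by ring)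
  refine (h1.add ((J.rad.mul J.notMem h2).congr_exponent (by ring))).congr_deriv ?_
  intro j x _
  ring

section Divergence

variable (hΩ : IsBoundedLipschitzDomain Ω) (hn : 2 ≤ n)
  (hI : IntegrableOn (fun x => ‖x - y‖ ^ (-α)) Ω)
  (hσ : Integrable (fun x => ‖x - y‖ ^ (1 - α)) (surfaceMeasure Ω))
include hΩ hn hI hσ

/-- Flux of ρ^(-α) h ∇Δu, which takes the first derivative off Δ²u. -/
theorem hasFlux_gradLap_mul : HasFlux Ω
    (fun x => pairing (fun i x => (U1 i x + radContract y (U2 i) x) * ‖x - y‖ ^ (-α) +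
      radContract y U1 x * (-α * (x i - y i) * ‖x - y‖ ^ (-α - 2)))
        (fun k x => ∑ i, U3 i i k x) x +
      radContract y U1 x * ‖x - y‖ ^ (-α) * ∑ k, ∑ i, U4 i i k k x)
    (fun x => radContract y U1 x * ‖x - y‖ ^ (-α) *
      ∑ k, (∑ i, U3 i i k x) * outwardNormal Ω x k) :=
  IsSymbol.hasFlux_smul hΩ hn J.notMem hI hσ J.mult J.gradLap (by ring)

/-- Flux of ∇²u ∇(ρ^(-α) h). Its divergence is ∇Δu·∇(ρ^(-α) h) + ∇²u : ∇²(ρ^(-α) h); the first term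
is the one left over by `hasFlux_gradLap_mul`, and the second is expanded here. -/
theorem hasFlux_hess_gradMult : HasFlux Ω
    (fun x => pairing (fun i x => (U1 i x + radContract y (U2 i) x) * ‖x - y‖ ^ (-α) +
      radContract y U1 x * (-α * (x i - y i) * ‖x - y‖ ^ (-α - 2)))
        (fun k x => ∑ i, U3 i i k x) x +
      (‖x - y‖ ^ (-α) * (2 * ∑ i, pairing (U2 i) (U2 i) x +
          ∑ i, pairing (U2 i) (fun j => radContract y (U3 i j)) x)
        - 2 * α * ‖x - y‖ ^ (-α - 2) * (pairing U1 (fun i => radContract y (U2 i)) x +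
          pairing (fun i => radContract y (U2 i)) (fun i => radContract y (U2 i)) x)
        - α * ‖x - y‖ ^ (-α - 2) * radContract y U1 x * ∑ i, U2 i i x
        + α * (α + 2) * ‖x - y‖ ^ (-α - 2 - 2) * radContract y U1 x *
          radContract y (fun i => radContract y (U2 i)) x))
    (fun x => ∑ i, pairing (U2 i)
      (fun i x => (U1 i x + radContract y (U2 i) x) * ‖x - y‖ ^ (-α) +
        radContract y U1 x * (-α * (x i - y i) * ‖x - y‖ ^ (-α - 2))) x *
          outwardNormal Ω x i) := by
  refine (IsSymbol.hasFlux_sum hΩ hn J.notMem hI hσ fun i => (IsSymbol.pairing J.notMem (J.two i)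
    (J.gradMult (α := α))).congr_exponent (by ring)).congr hΩ.isOpen.measurableSet ?_ ?_
  swap; · filter_upwards with x using rfl
  intro x hx
  have hxc := subset_closure hx
  -- The rows of the Hessian have divergence ∇Δu, by symmetry of third derivatives.
  have hL : ∀ v : Fin n → ℝ, ∑ i, ∑ j, U3 i j i x * v j = ∑ j, v j * ∑ i, U3 i i j x := by
    intro v
    rw [Finset.sum_comm]
    refine Finset.sum_congr rfl fun j _ => ?_
    rw [Finset.mul_sum]
    exact Finset.sum_congr rfl fun i _ => by rw [J.symm_right x hxc i j i, mul_comm]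
  rw [Finset.sum_add_distrib]
  congr 1
  · simp only [pairing]
    rw [hL]
  set s : Fin n → ℝ := fun i => radContract y (U2 i) x with hs
  have hs1 : ∀ i, ∑ j, U2 i j x * (x j - y j) = s i := fun i =>
    Finset.sum_congr rfl fun j _ => mul_comm _ _
  have hs2 : ∀ i, ∑ j, (x j - y j) * U2 j i x = s i := fun i =>
    Finset.sum_congr rfl fun j _ => by rw [J.symm x hxc j i]
  set h := radContract y U1 x with hh
  set w := ‖x - y‖ ^ (-α)
  set v := ‖x - y‖ ^ (-α - 2)
  set q := ‖x - y‖ ^ (-α - 2 - 2)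
  have h1 : ∀ i, pairing (U2 i) (fun j x => (2 * U2 j i x + radContract y (U3 j i) x) *
        ‖x - y‖ ^ (-α)
      - α * ‖x - y‖ ^ (-α - 2) * ((U1 j x + radContract y (U2 j) x) * (x i - y i) +
        (U1 i x + radContract y (U2 i) x) * (x j - y j) +
        radContract y U1 x * (if i = j then 1 else 0))
      + α * (α + 2) * radContract y U1 x * (x j - y j) * (x i - y i) *
        ‖x - y‖ ^ (-α - 2 - 2)) x =
      w * (2 * pairing (U2 i) (U2 i) x + pairing (U2 i) (fun j => radContract y (U3 i j)) x)
      - α * v * (∑ j, (U1 j x + s j) * ((x i - y i) * U2 i j x) + (U1 i x + s i) * s i +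
        h * U2 i i x) + α * (α + 2) * q * h * ((x i - y i) * s i) := by
    intro i
    have e1 : ∀ j, radContract y (U3 j i) x = radContract y (U3 i j) x := fun j => by
      simp only [radContract]
      exact Finset.sum_congr rfl fun k _ => by rw [J.symm_left x hxc j i k]
    calc _ = ∑ j, (w * (2 * (U2 i j x * U2 i j x) + U2 i j x * radContract y (U3 i j) x)
          - α * v * ((U1 j x + s j) * ((x i - y i) * U2 i j x) +
            (U1 i x + s i) * (U2 i j x * (x j - y j)) + h * (if i = j then U2 i j x else 0))
          + α * (α + 2) * q * h * ((x i - y i) * (U2 i j x * (x j - y j)))) := by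
          refine Finset.sum_congr rfl fun j _ => ?_
          dsimp only
          rw [J.symm x hxc j i, e1 j]
          change U2 i j x * ((2 * U2 i j x + radContract y (U3 i j) x) * w
            - α * v * ((U1 j x + s j) * (x i - y i) + (U1 i x + s i) * (x j - y j) +
              h * (if i = j then 1 else 0))
            + α * (α + 2) * h * (x j - y j) * (x i - y i) * q) = _
          split_ifs <;> ring
      _ = _ := by
          simp only [Finset.sum_add_distrib, Finset.sum_sub_distrib, ← Finset.mul_sum, hs1,
            Finset.sum_ite_eq, Finset.mem_univ, if_true]
          rfl
  rw [Finset.sum_congr rfl fun i _ => h1 i]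
  have h2 : ∑ i, ∑ j, (U1 j x + s j) * ((x i - y i) * U2 i j x) =
      ∑ j, (U1 j x * s j + s j * s j) := by
    rw [Finset.sum_comm]
    refine Finset.sum_congr rfl fun j _ => ?_
    rw [← Finset.mul_sum, hs2]; ring
  have h3 : ∑ i, (U1 i x + s i) * s i = ∑ j, (U1 j x * s j + s j * s j) :=
    Finset.sum_congr rfl fun i _ => by ring
  simp only [Finset.sum_add_distrib, Finset.sum_sub_distrib, ← Finset.mul_sum, h2, h3]
  change w * (2 * ∑ i, pairing (U2 i) (U2 i) x +
      ∑ i, pairing (U2 i) (fun j => radContract y (U3 i j)) x)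
    - 2 * α * v * (∑ i, U1 i x * s i + ∑ i, s i * s i) - α * v * h * ∑ i, U2 i i x
    + α * (α + 2) * q * h * ∑ i, (x i - y i) * s i = _
  ring

/-- The radial derivative of |∇²u|² is twice the third-order term in `hasFlux_hess_gradMult`, so
this radial flux eliminates it. -/
theorem hasFlux_radial_hessSq : HasFlux Ω
    (fun x => (n - α) * (‖x - y‖ ^ (-α) * ∑ i, pairing (U2 i) (U2 i) x) +
      2 * ‖x - y‖ ^ (-α) * ∑ i, pairing (U2 i) (fun j => radContract y (U3 i j)) x)
    (fun x => ‖x - y‖ ^ (-α) * (∑ i, pairing (U2 i) (U2 i) x) *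
      ∑ i, (x i - y i) * outwardNormal Ω x i) := by
  refine (IsSymbol.hasFlux_radial hΩ hn J.notMem hI hσ
    ((J.weight.mul J.notMem J.hessSq).congr_exponent (add_zero _))).congr
    hΩ.isOpen.measurableSet ?_ ?_
  swap; · filter_upwards with x using rfl
  intro x hx
  have h1 : ∑ k, (x k - y k) * ∑ i, 2 * pairing (U2 i) (fun j => U3 i j k) x =
      2 * ∑ i, pairing (U2 i) (fun j => radContract y (U3 i j)) x := by
    simp only [pairing, radContract, Finset.mul_sum]
    rw [Finset.sum_comm]
    refine Finset.sum_congr rfl fun i _ => ?_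
    rw [Finset.sum_comm]
    refine Finset.sum_congr rfl fun j _ => ?_
    exact Finset.sum_congr rfl fun k _ => by ring
  have h2 := rpow_eq_sq_mul (IsSymbol.norm_pos_of_ne (J.ne hx)) (-α)
  have h3 : radContract y (fun i x => -α * (x i - y i) * ‖x - y‖ ^ (-α - 2) *
        (∑ i, pairing (U2 i) (U2 i) x) +
      ‖x - y‖ ^ (-α) * ∑ j, 2 * pairing (U2 j) (fun k => U3 j k i) x) x =
      -α * ‖x - y‖ ^ (-α - 2) * (∑ i, pairing (U2 i) (U2 i) x) * ‖x - y‖ ^ 2 +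
      ‖x - y‖ ^ (-α) * (2 * ∑ i, pairing (U2 i) (fun j => radContract y (U3 i j)) x) := by
    rw [← h1, ← sum_sub_mul_self, Finset.mul_sum Finset.univ _ (_ * _ * _),
      Finset.mul_sum Finset.univ _ (‖x - y‖ ^ (-α)), ← Finset.sum_add_distrib, radContract]
    exact Finset.sum_congr rfl fun k _ => by ring
  rw [h3]
  linear_combination (-α * ∑ i, pairing (U2 i) (U2 i) x) * h2

/-- For Δu ∇u - ∇²u ∇u the third derivatives cancel in the divergence, leaving (Δu)² - |∇²u|²; the
weight adds only terms of lower order in u. -/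
theorem hasFlux_lap_grad_sub : HasFlux Ω
    (fun x => -α * ‖x - y‖ ^ (-α - 2) * (radContract y U1 x * (∑ i, U2 i i x) -
        pairing U1 (fun i => radContract y (U2 i)) x) +
      ‖x - y‖ ^ (-α) * ((∑ i, U2 i i x) ^ 2 - ∑ i, pairing (U2 i) (U2 i) x))
    (fun x => ‖x - y‖ ^ (-α) * ∑ i, ((∑ k, U2 k k x) * U1 i x + -1 * pairing (U2 i) U1 x) *
      outwardNormal Ω x i) := by
  refine (IsSymbol.hasFlux_smul hΩ hn J.notMem hI hσ J.weight (fun i =>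
    ((J.lap.mul J.notMem (J.one i)).congr_exponent (zero_add 1)).add
      (((IsSymbol.pairing J.notMem (J.two i) J.one).congr_exponent (zero_add 1)).const_mul (-1)))
    (by ring)).congr hΩ.isOpen.measurableSet ?_ ?_
  swap; · filter_upwards with x using rfl
  intro x hx
  have hxc := subset_closure hx
  congr 1
  · have h1 : ∑ i, (x i - y i) * pairing (U2 i) U1 x =
        pairing U1 (fun i => radContract y (U2 i)) x := by
      simp only [pairing, radContract, Finset.mul_sum]
      rw [Finset.sum_comm]
      refine Finset.sum_congr rfl fun i _ => Finset.sum_congr rfl fun j _ => ?_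
      rw [J.symm x hxc i j]; ring
    rw [← h1, pairing, radContract, Finset.sum_mul, ← Finset.sum_sub_distrib, Finset.mul_sum]
    exact Finset.sum_congr rfl fun k _ => by ring
  · congr 1
    have h1 : ∀ i, pairing (fun j => U3 i j i) U1 x + pairing (U2 i) (fun j => U2 j i) x =
        ∑ j, U3 i i j x * U1 j x + pairing (U2 i) (U2 i) x := fun i => by
      congr 1
      · exact Finset.sum_congr rfl fun j _ => by dsimp only; rw [J.symm_right x hxc i j i]
      · exact Finset.sum_congr rfl fun j _ => by dsimp only; rw [J.symm x hxc i j]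
    simp only [h1, Finset.sum_add_distrib, ← Finset.mul_sum]
    rw [Finset.sum_comm (f := fun i j => U3 i i j x * U1 j x)]
    simp only [← Finset.sum_mul]
    ring

theorem hasFlux_radial_gradSq : HasFlux Ω
    (fun x => (n - α - 2) * (‖x - y‖ ^ (-α - 2) * pairing U1 U1 x) +
      2 * ‖x - y‖ ^ (-α - 2) * pairing U1 (fun i => radContract y (U2 i)) x)
    (fun x => ‖x - y‖ ^ (-α - 2) * pairing U1 U1 x *
      ∑ i, (x i - y i) * outwardNormal Ω x i) := by
  refine (IsSymbol.hasFlux_radial hΩ hn J.notMem hI hσ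
    (((IsSymbol.norm_sub_rpow J.notMem (-α - 2)).mul J.notMem J.gradSq).congr_exponent
      (by ring))).congr hΩ.isOpen.measurableSet ?_ ?_
  swap; · filter_upwards with x using rfl
  intro x hx
  have h1 : ∑ k, (x k - y k) * ∑ i, U1 i x * U2 i k x =
      pairing U1 (fun i => radContract y (U2 i)) x := by
    simp only [pairing, radContract, Finset.mul_sum]
    rw [Finset.sum_comm]
    refine Finset.sum_congr rfl fun i _ => Finset.sum_congr rfl fun j _ => ?_
    ring
  have h2 := rpow_eq_sq_mul (IsSymbol.norm_pos_of_ne (J.ne hx)) (-α - 2)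
  have h3 : radContract y (fun i x => (-α - 2) * (x i - y i) * ‖x - y‖ ^ (-α - 2 - 2) *
        pairing U1 U1 x + ‖x - y‖ ^ (-α - 2) * (2 * ∑ j, U1 j x * U2 j i x)) x =
      (-α - 2) * ‖x - y‖ ^ (-α - 2 - 2) * pairing U1 U1 x * ‖x - y‖ ^ 2 +
      ‖x - y‖ ^ (-α - 2) * 2 * pairing U1 (fun i => radContract y (U2 i)) x := by
    rw [← h1, ← sum_sub_mul_self, Finset.mul_sum, Finset.mul_sum, ← Finset.sum_add_distrib,
      radContract]
    exact Finset.sum_congr rfl fun k _ => by ring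
  rw [h3]
  linear_combination ((-α - 2) * pairing U1 U1 x) * h2

theorem hasFlux_rad_grad : HasFlux Ω
    (fun x => -(α + 2) * ‖x - y‖ ^ (-α - 2 - 2) * radContract y U1 x ^ 2 +
      ‖x - y‖ ^ (-α - 2) * (pairing U1 U1 x + pairing U1 (fun i => radContract y (U2 i)) x) +
      ‖x - y‖ ^ (-α - 2) * radContract y U1 x * ∑ i, U2 i i x)
    (fun x => ‖x - y‖ ^ (-α - 2) * radContract y U1 x *
      ∑ i, U1 i x * outwardNormal Ω x i) := by
  refine (IsSymbol.hasFlux_smul hΩ hn J.notMem hI hσ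
    ((IsSymbol.norm_sub_rpow J.notMem (-α - 2)).mul J.notMem J.rad) J.one (by ring)).congr
    hΩ.isOpen.measurableSet ?_ ?_
  swap; · filter_upwards with x using rfl
  intro x hx
  congr 1
  calc _ = -(α + 2) * ‖x - y‖ ^ (-α - 2 - 2) * radContract y U1 x * radContract y U1 x +
        ‖x - y‖ ^ (-α - 2) * (pairing U1 U1 x + pairing U1 (fun i => radContract y (U2 i)) x) := by
        ring
    _ = _ := by
        conv_lhs =>
          rw [pairing, pairing, ← Finset.sum_add_distrib, Finset.mul_sum]
          enter [1, 2]
          rw [radContract]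
        rw [Finset.mul_sum, ← Finset.sum_add_distrib, pairing]
        exact Finset.sum_congr rfl fun k _ => by ring

theorem hasFlux_self_grad : HasFlux Ω
    (fun x => -(α + 2) * ‖x - y‖ ^ (-α - 2 - 2) * u x * radContract y U1 x +
      ‖x - y‖ ^ (-α - 2) * pairing U1 U1 x +
      ‖x - y‖ ^ (-α - 2) * u x * ∑ i, U2 i i x)
    (fun x => ‖x - y‖ ^ (-α - 2) * u x * ∑ i, U1 i x * outwardNormal Ω x i) := by
  refine (IsSymbol.hasFlux_smul hΩ hn J.notMem hI hσ
    ((IsSymbol.norm_sub_rpow J.notMem (-α - 2)).mul J.notMem J.zero) J.one (by ring)).congr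
    hΩ.isOpen.measurableSet ?_ ?_
  swap; · filter_upwards with x using rfl
  intro x hx
  congr 1
  rw [pairing, pairing, radContract, Finset.mul_sum, Finset.mul_sum, ← Finset.sum_add_distrib]
  exact Finset.sum_congr rfl fun k _ => by ring

theorem hasFlux_radial_sq {g : EuclideanSpace ℝ (Fin n) → ℝ}
    {g' : Fin n → EuclideanSpace ℝ (Fin n) → ℝ} (hg : IsSymbol Ω y 2 g g') : HasFlux Ω
    (fun x => (n - α - 4) * (‖x - y‖ ^ (-α - 2 - 2) * g x ^ 2) +
      2 * ‖x - y‖ ^ (-α - 2 - 2) * g x * radContract y g' x)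
    (fun x => ‖x - y‖ ^ (-α - 2 - 2) * (g x * g x) *
      ∑ i, (x i - y i) * outwardNormal Ω x i) := by
  refine (IsSymbol.hasFlux_radial hΩ hn J.notMem hI hσ
    (((IsSymbol.norm_sub_rpow J.notMem (-α - 2 - 2)).mul J.notMem
      (hg.mul J.notMem hg)).congr_exponent (by ring))).congr hΩ.isOpen.measurableSet ?_ ?_
  swap; · filter_upwards with x using rfl
  intro x hx
  have h2 := rpow_eq_sq_mul (IsSymbol.norm_pos_of_ne (J.ne hx)) (-α - 2 - 2)
  have h3 : radContract y (fun i x => (-α - 2 - 2) * (x i - y i) * ‖x - y‖ ^ (-α - 2 - 2 - 2) *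
        (g x * g x) + ‖x - y‖ ^ (-α - 2 - 2) * (g' i x * g x + g x * g' i x)) x =
      (-α - 2 - 2) * ‖x - y‖ ^ (-α - 2 - 2 - 2) * (g x * g x) * ‖x - y‖ ^ 2 +
      ‖x - y‖ ^ (-α - 2 - 2) * 2 * g x * radContract y g' x := by
    rw [← sum_sub_mul_self, radContract, radContract, Finset.mul_sum, Finset.mul_sum,
      ← Finset.sum_add_distrib]
    exact Finset.sum_congr rfl fun k _ => by ring
  rw [h3]
  linear_combination ((-α - 2 - 2) * g x * g x) * h2

end Divergence

end IsJet

end Jet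

end Fields

/-! ### Summation of the fluxes -/

section Identity

variable {n : ℕ} {Ω : Set (EuclideanSpace ℝ (Fin n))} {y : EuclideanSpace ℝ (Fin n)} {α : ℝ}
  {u : EuclideanSpace ℝ (Fin n) → ℝ} {U1 : Fin n → EuclideanSpace ℝ (Fin n) → ℝ}
  {U2 : Fin n → Fin n → EuclideanSpace ℝ (Fin n) → ℝ}
  {U3 : Fin n → Fin n → Fin n → EuclideanSpace ℝ (Fin n) → ℝ}
  {U4 : Fin n → Fin n → Fin n → Fin n → EuclideanSpace ℝ (Fin n) → ℝ}

namespace IsJet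

variable (J : IsJet Ω y u U1 U2 U3 U4) (hΩ : IsBoundedLipschitzDomain Ω)
  (hI : IntegrableOn (fun x => ‖x - y‖ ^ (-α)) Ω)
include J hΩ hI

theorem integrableOn_lap_mul : IntegrableOn (fun x => (∑ i, U2 i i x) *
    (‖x - y‖ ^ (-α) * (∑ i, U2 i i x) - 2 * α * ‖x - y‖ ^ (-α - 2) * radContract y U1 x +
      α * (α + 2 - n) * ‖x - y‖ ^ (-α - 2) * u x)) Ω := by
  have hv := IsSymbol.norm_sub_rpow (Ω := Ω) J.notMem (-α - 2)
  have h1 := J.lap.mul J.notMem (((((J.weight (α := α)).mul J.notMem J.lap).congr_exponent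
    (add_zero _)).add (((hv.mul J.notMem J.rad).const_mul (-2 * α)).congr_exponent (by ring))).add
    (((hv.mul J.notMem J.zero).const_mul (α * (α + 2 - n))).congr_exponent (by ring)))
  refine ((h1.congr_exponent (zero_add _)).integrableOn hΩ J.notMem hI).congr_fun ?_
    hΩ.isOpen.measurableSet
  intro x _
  ring

theorem integrableOn_gradSq : IntegrableOn (fun x => ‖x - y‖ ^ (-α - 2) *
    (pairing (fun i => radContract y (U2 i)) (fun i => radContract y (U2 i)) x +
      (n - α - 2) * pairing U1 (fun i => radContract y (U2 i)) x +
      (n - α - 2) ^ 2 / 4 * pairing U1 U1 x)) Ω := by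
  have hv := IsSymbol.norm_sub_rpow (Ω := Ω) J.notMem (-α - 2)
  have h1 := hv.mul J.notMem
    ((((IsSymbol.pairing J.notMem J.hessRad J.hessRad).congr_exponent (l := 2) (by norm_num)).add
      (((IsSymbol.pairing J.notMem J.one J.hessRad).congr_exponent (by norm_num)).const_mul
        (n - α - 2))).add (J.gradSq.const_mul ((n - α - 2) ^ 2 / 4)))
  exact (h1.congr_exponent (by ring)).integrableOn hΩ J.notMem hI

theorem integrableOn_radSq : IntegrableOn (fun x => ‖x - y‖ ^ (-α - 2 - 2) *
    (radContract y U1 x + (n - α - 4) / 2 * u x) ^ 2) Ω := by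
  have hq := IsSymbol.norm_sub_rpow (Ω := Ω) J.notMem (-α - 2 - 2)
  have h0 := J.rad.add (J.zero.const_mul ((n - α - 4) / 2))
  refine (((hq.mul J.notMem (h0.mul J.notMem h0)).congr_exponent (by ring)).integrableOn hΩ
    J.notMem hI).congr_fun ?_ hΩ.isOpen.measurableSet
  intro x _
  ring

variable (hn : 2 ≤ n) (hσ : Integrable (fun x => ‖x - y‖ ^ (1 - α)) (surfaceMeasure Ω))
include hn hσ

/-- In `IsJet` fourth derivatives appear only as derivatives of third ones. Integrability is
therefore read off from the flux that contains Δ²u, after subtracting a term of order -α. -/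
theorem integrableOn_bilap_mul : IntegrableOn
    (fun x => (∑ k, ∑ i, U4 i i k k x) * (‖x - y‖ ^ (-α) * radContract y U1 x)) Ω := by
  have h1 := (J.hasFlux_gradLap_mul hΩ hn hI hσ).integrableOn
  have h2 := ((IsSymbol.pairing J.notMem (J.gradMult (α := α))
    J.gradLap).congr_exponent (l := -α) (by ring)).integrableOn hΩ J.notMem hI
  refine (h1.sub h2).congr_fun ?_ hΩ.isOpen.measurableSet
  intro x _
  simp only [Pi.sub_apply]
  ring

theorem hasFlux_rellich (hb : ∀ᵐ x ∂surfaceMeasure Ω, u x = 0 ∧ (∀ i, U1 i x = 0) ∧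
      ∃ c, ∀ i j, U2 i j x = c * outwardNormal Ω x i * outwardNormal Ω x j) :
    HasFlux Ω (fun x => (α + 4 - n) * ((∑ i, U2 i i x) *
      (‖x - y‖ ^ (-α) * (∑ i, U2 i i x) - 2 * α * ‖x - y‖ ^ (-α - 2) * radContract y U1 x +
        α * (α + 2 - n) * ‖x - y‖ ^ (-α - 2) * u x))
      - 2 * ((∑ k, ∑ i, U4 i i k k x) * (‖x - y‖ ^ (-α) * radContract y U1 x))
      - 4 * α * (‖x - y‖ ^ (-α - 2) *
        (pairing (fun i => radContract y (U2 i)) (fun i => radContract y (U2 i)) x +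
          (n - α - 2) * pairing U1 (fun i => radContract y (U2 i)) x +
          (n - α - 2) ^ 2 / 4 * pairing U1 U1 x))
      - 2 * α * (α + 2) * (n - α - 2) * (‖x - y‖ ^ (-α - 2 - 2) *
        (radContract y U1 x + (n - α - 4) / 2 * u x) ^ 2))
    (fun x => (∑ i, pairing (U2 i) (U2 i) x) * (∑ i, (x i - y i) * outwardNormal Ω x i) *
      ‖x - y‖ ^ (-α)) := by
  -- The coefficients -2 and 2 cancel ∇Δu·∇(ρ^(-α) h). The coefficient -1 of `F3` cancels third
  -- derivatives and leaves 4 - (n - α) = α + 4 - n in front of ρ^(-α) |∇²u|², which dictates the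
  -- coefficient of `F4`.
  have F1 := (J.hasFlux_gradLap_mul hΩ hn hI hσ).const_mul (-2)
  have F2 := (J.hasFlux_hess_gradMult hΩ hn hI hσ).const_mul 2
  have F3 := (J.hasFlux_radial_hessSq hΩ hn hI hσ).const_mul (-1)
  have F4 := (J.hasFlux_lap_grad_sub hΩ hn hI hσ).const_mul (α + 4 - n)
  -- With m = n - α - 2: `F6` is fixed by the coefficient of h Δu, then `F5` by that of ∇u·s, and
  -- `F7` by that of u Δu. The coefficient of |∇u|² then comes out as -α m², as the first square
  -- requires.
  have F5 := (J.hasFlux_radial_gradSq hΩ hn hI hσ).const_mul (α * (1 - 2 * (n - α - 2)))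
  have F6 := (J.hasFlux_rad_grad hΩ hn hI hσ).const_mul (α * (n - α - 2))
  have F7 := (J.hasFlux_self_grad hΩ hn hI hσ).const_mul (α * (n - α - 2) * (n - α - 4))
  -- `F9` cancels the term h ⟨x - y, s⟩ of `F2`; `F8` supplies u² and completes the second square.
  have F8 := (J.hasFlux_radial_sq hΩ hn hI hσ J.zero).const_mul
    (-α * (α + 2) * (n - α - 2) * (n - α - 4) / 2)
  have F9 := (J.hasFlux_radial_sq hΩ hn hI hσ J.rad).const_mul (-α * (α + 2))
  refine ((((((((F1.add F2).add F3).add F4).add F5).add F6).add F7).add F8).add F9).congr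
    hΩ.isOpen.measurableSet ?_ ?_
  · intro x hx
    have h1 : radContract y (fun i x => U1 i x + radContract y (U2 i) x) x =
        radContract y U1 x + radContract y (fun i => radContract y (U2 i)) x := by
      rw [radContract, radContract, radContract, ← Finset.sum_add_distrib]
      exact Finset.sum_congr rfl fun i _ => mul_add _ _ _
    rw [h1]
    ring
  -- At the boundary every flux except `F2` and `F3` carries a factor u or ∇u. There ∇(ρ^(-α) h)
  -- reduces to ρ^(-α) s = ρ^(-α) c t N, so `F2` and `F3` give 2c²t ρ^(-α) and -c²t ρ^(-α).
  · filter_upwards [hb, IsBoundedLipschitzDomain.ae_isOutwardUnitNormal hΩ hn] with x hx hν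
    obtain ⟨h0, h1, c, h2⟩ := hx
    set N := outwardNormal Ω x with hN
    have hN1 : ∑ i, N i * N i = 1 := by
      have h3 := EuclideanSpace.real_norm_sq_eq N
      rw [hν.1] at h3
      simp only [← pow_two]
      rw [← h3]; norm_num
    have e1 : radContract y U1 x = 0 := by simp [radContract, h1]
    have e2 : pairing U1 U1 x = 0 := by simp [pairing, h1]
    have e3 : ∀ i, pairing (U2 i) U1 x = 0 := fun i => by simp [pairing, h1]
    set t := ∑ i, (x i - y i) * N i with ht
    have e4 : ∀ i, radContract y (U2 i) x = c * t * N i := fun i => by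
      rw [radContract, ht, Finset.mul_sum, Finset.sum_mul]
      exact Finset.sum_congr rfl fun j _ => by rw [h2]; ring
    have e5 : ∀ i, pairing (U2 i) (U2 i) x = c ^ 2 * (N i * N i) := fun i => by
      calc _ = ∑ j, c ^ 2 * (N i * N i) * (N j * N j) :=
            Finset.sum_congr rfl fun j _ => by rw [h2]; ring
        _ = _ := by rw [← Finset.mul_sum, hN1, mul_one]
    have e6 : ∑ i, pairing (U2 i) (U2 i) x = c ^ 2 := by
      simp only [e5, ← Finset.mul_sum, hN1, mul_one]
    have e7 : ∑ i, pairing (U2 i) (fun i x => (U1 i x + radContract y (U2 i) x) * ‖x - y‖ ^ (-α) +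
        radContract y U1 x * (-α * (x i - y i) * ‖x - y‖ ^ (-α - 2))) x * N i =
        c ^ 2 * t * ‖x - y‖ ^ (-α) := by
      have : ∀ i, pairing (U2 i) (fun i x => (U1 i x + radContract y (U2 i) x) * ‖x - y‖ ^ (-α) +
        radContract y U1 x * (-α * (x i - y i) * ‖x - y‖ ^ (-α - 2))) x =
          c ^ 2 * t * ‖x - y‖ ^ (-α) * N i := fun i => by
        calc _ = ∑ j, c ^ 2 * t * ‖x - y‖ ^ (-α) * N i * (N j * N j) :=
              Finset.sum_congr rfl fun j _ => by dsimp only; rw [h2, e4, e1, h1]; ring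
          _ = _ := by rw [← Finset.mul_sum, hN1, mul_one]
      rw [Finset.sum_congr rfl fun i _ => congrArg (· * N i) (this i)]
      simp only [mul_assoc (_ * _ * _), ← Finset.mul_sum, hN1, mul_one]
    have e8 : ∑ i, ((∑ k, U2 k k x) * U1 i x + -1 * pairing (U2 i) U1 x) * N i = 0 := by
      simp [e3, h1]
    rw [e7, e8, e6, e1, e2, h0]
    ring

end IsJet

end Identity

/-! ### Integrands in terms of partial derivatives -/

section Pointwise

open Filter
open scoped Topology

variable {n : ℕ} {Ω : Set (EuclideanSpace ℝ (Fin n))} {x y : EuclideanSpace ℝ (Fin n)}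
  {f : EuclideanSpace ℝ (Fin n) → ℝ} {a : Fin n → ℝ}

theorem laplacian_eq_sum (hΩ : IsOpen Ω) {f' : Fin n → EuclideanSpace ℝ (Fin n) → ℝ}
    {f'' : Fin n → Fin n → EuclideanSpace ℝ (Fin n) → ℝ}
    (hf : ∀ z ∈ Ω, HasPartials f (fun i => f' i z) z)
    (hf' : ∀ i, ∀ z ∈ Ω, HasPartials (f' i) (fun j => f'' i j z) z) (hx : x ∈ Ω) :
    Δ f x = ∑ i, f'' i i x := by
  rw [InnerProductSpace.laplacian_eq_iteratedFDeriv_orthonormalBasis f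
    (EuclideanSpace.basisFun (Fin n) ℝ)]
  have h1 : fderiv ℝ f =ᶠ[𝓝 x] fun z => coordDual (fun i => f' i z) := by
    filter_upwards [hΩ.mem_nhds hx] with z hz using HasFDerivAt.fderiv (hf z hz)
  have h2 : HasFDerivAt (fun z => fun i => f' i z)
      (ContinuousLinearMap.pi fun i => coordDual (fun j => f'' i j x)) x :=
    hasFDerivAt_pi.2 fun i => hf' i x hx
  have h3 : HasFDerivAt (fun z => coordDual (fun i => f' i z))
      ((LinearMap.toContinuousLinearMap (coordDual (n := n))).comp
        (ContinuousLinearMap.pi fun i => coordDual (fun j => f'' i j x))) x :=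
    ((LinearMap.toContinuousLinearMap (coordDual (n := n))).hasFDerivAt).comp x h2
  refine Finset.sum_congr rfl fun i _ => ?_
  rw [iteratedFDeriv_two_apply, h1.fderiv_eq, h3.fderiv]
  simp [coordDual_single]

theorem HasPartials.radialDeriv_eq (h : HasPartials f a x) :
    radialDeriv y f x = ‖x - y‖⁻¹ * ∑ k, (x k - y k) * a k := by
  rw [radialDeriv, HasFDerivAt.fderiv h, coordDual_apply, Finset.mul_sum]
  exact Finset.sum_congr rfl fun k _ => by simp; ring

theorem radialDeriv_apply_eq {F : EuclideanSpace ℝ (Fin n) → EuclideanSpace ℝ (Fin n)}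
    {A : Fin n → Fin n → ℝ} (h : ∀ i, HasPartials (fun z => F z i) (A i) x) (i : Fin n) :
    radialDeriv y F x i = ‖x - y‖⁻¹ * ∑ k, (x k - y k) * A i k := by
  have h0 : DifferentiableAt ℝ F x := by
    rw [differentiableAt_euclidean]
    exact fun i => HasFDerivAt.differentiableAt (h i)
  have h1 : HasFDerivAt (fun z => F z i) ((EuclideanSpace.proj (𝕜 := ℝ) i).comp (fderiv ℝ F x)) x :=
    (EuclideanSpace.proj (𝕜 := ℝ) i).hasFDerivAt.comp x h0.hasFDerivAt
  rw [← (h i).radialDeriv_eq, radialDeriv, radialDeriv, h1.fderiv]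
  rfl

theorem HasPartials.gradient_apply (h : HasPartials f a x) (i : Fin n) : (∇ f x) i = a i := by
  rw [← h.fderiv_single i, ← toDual_gradient, InnerProductSpace.toDual_apply_apply,
    EuclideanSpace.inner_single_right]
  simp

theorem rpow_sq_div {ρ : ℝ} (hρ : 0 < ρ) (β m : ℝ) :
    (ρ⁻¹ * ρ ^ β) ^ 2 / ρ ^ m = ρ ^ (2 * β - 2 - m) := by
  rw [Real.rpow_sub hρ, Real.rpow_sub hρ, mul_pow, ← Real.rpow_natCast (ρ ^ β),
    ← Real.rpow_mul hρ.le, mul_comm β]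
  norm_num
  ring

variable {u : EuclideanSpace ℝ (Fin n) → ℝ} {U1 : Fin n → EuclideanSpace ℝ (Fin n) → ℝ}
  {U2 : Fin n → Fin n → EuclideanSpace ℝ (Fin n) → ℝ}
  {U3 : Fin n → Fin n → Fin n → EuclideanSpace ℝ (Fin n) → ℝ}
  {U4 : Fin n → Fin n → Fin n → Fin n → EuclideanSpace ℝ (Fin n) → ℝ}

namespace IsJet

variable (J : IsJet Ω y u U1 U2 U3 U4)
include J

theorem laplacian_eq (hΩ : IsOpen Ω) (hx : x ∈ Ω) : Δ u x = ∑ i, U2 i i x :=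
  laplacian_eq_sum hΩ J.zero.hasPartials (fun i => (J.one i).hasPartials) hx

theorem laplacian_laplacian_eq (hΩ : IsOpen Ω) (hx : x ∈ Ω) :
    Δ (Δ u) x = ∑ k, ∑ i, U4 i i k k x := by
  have h1 : Δ u =ᶠ[𝓝 x] fun z => ∑ i, U2 i i z := by
    filter_upwards [hΩ.mem_nhds hx] with z hz using J.laplacian_eq hΩ hz
  rw [(InnerProductSpace.laplacian_congr_nhds h1).eq_of_nhds]
  exact laplacian_eq_sum hΩ J.lap.hasPartials (fun k => (J.gradLap k).hasPartials) hx

/-- The product rule, with ∇ρ^(-α) = -α ρ^(-α-2) (x - y) and Δρ^(-α) = α (α + 2 - n) ρ^(-α-2). -/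
theorem laplacian_div_rpow (hΩ : IsOpen Ω) (α : ℝ) (hx : x ∈ Ω) :
    Δ (fun z => u z / ‖z - y‖ ^ α) x = ‖x - y‖ ^ (-α) * (∑ i, U2 i i x)
      - 2 * α * ‖x - y‖ ^ (-α - 2) * radContract y U1 x
      + α * (α + 2 - n) * ‖x - y‖ ^ (-α - 2) * u x := by
  have h1 : (fun z => u z / ‖z - y‖ ^ α) = fun z => u z * ‖z - y‖ ^ (-α) := by
    ext z
    rw [Real.rpow_neg (norm_nonneg _), div_eq_mul_inv]
  have hw := J.weight (α := α)
  rw [h1, laplacian_eq_sum hΩ (J.zero.mul J.notMem hw).hasPartials (fun i =>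
    (((J.one i).mul J.notMem hw).hasPartials · · |>.add ((J.zero.mul J.notMem
      (((IsSymbol.coord J.notMem i).const_mul (-α)).mul J.notMem
        (IsSymbol.norm_sub_rpow J.notMem (-α - 2)))).hasPartials _ ‹_›))) hx]
  have h2 := rpow_eq_sq_mul (IsSymbol.norm_pos_of_ne (J.ne hx)) (-α - 2)
  calc _ = ∑ i, (‖x - y‖ ^ (-α) * U2 i i x
        - 2 * α * ‖x - y‖ ^ (-α - 2) * ((x i - y i) * U1 i x)
        - α * ‖x - y‖ ^ (-α - 2) * u x
        + α * (α + 2) * ‖x - y‖ ^ (-α - 2 - 2) * u x * ((x i - y i) * (x i - y i))) :=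
        Finset.sum_congr rfl fun i _ => by simp only [if_true]; ring
    _ = _ := by
        simp only [Finset.sum_add_distrib, Finset.sum_sub_distrib, ← Finset.mul_sum,
          sum_sub_mul_self, Finset.sum_const, Finset.card_univ, Fintype.card_fin, nsmul_eq_mul,
          radContract]
        linear_combination (-α * (α + 2) * u x) * h2

theorem radialDeriv_eq (hx : x ∈ Ω) : radialDeriv y u x = ‖x - y‖⁻¹ * radContract y U1 x :=
  (J.zero.hasPartials x hx).radialDeriv_eq

theorem radialDeriv_div_rpow (α : ℝ) (hx : x ∈ Ω) :
    radialDeriv y u x / ‖x - y‖ ^ (α - 1) = ‖x - y‖ ^ (-α) * radContract y U1 x := by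
  have hρ := IsSymbol.norm_pos_of_ne (J.ne hx)
  rw [J.radialDeriv_eq hx, Real.rpow_sub hρ, Real.rpow_neg hρ.le, Real.rpow_one]
  field_simp

/-- The radial derivative of ρ^β u is ρ^(β-1) (h + β u). With β = (n - α - 4)/2 the total power 2β -
2 - (n - 2) is -α - 4, free of n. -/
theorem sq_radialDeriv_rpow_mul (α : ℝ) (hx : x ∈ Ω) :
    |radialDeriv y (fun z => ‖z - y‖ ^ (((n : ℝ) - α - 4) / 2) * u z) x| ^ 2 /
      ‖x - y‖ ^ ((n : ℝ) - 2) =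
    ‖x - y‖ ^ (-α - 2 - 2) * (radContract y U1 x + (n - α - 4) / 2 * u x) ^ 2 := by
  have hρ := IsSymbol.norm_pos_of_ne (J.ne hx)
  set β := ((n : ℝ) - α - 4) / 2 with hβ
  have h1 := ((HasPartials.norm_sub_rpow (J.ne hx) β).mul
    (J.zero.hasPartials x hx)).radialDeriv_eq (y := y)
  have h2 : ∑ k, (x k - y k) * (β * (x k - y k) * ‖x - y‖ ^ (β - 2) * u x +
      ‖x - y‖ ^ β * U1 k x) = ‖x - y‖ ^ β * (radContract y U1 x + β * u x) := by
    calc _ = ∑ k, (β * ‖x - y‖ ^ (β - 2) * u x * ((x k - y k) * (x k - y k)) +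
          ‖x - y‖ ^ β * ((x k - y k) * U1 k x)) := Finset.sum_congr rfl fun k _ => by ring
      _ = _ := by
          rw [Finset.sum_add_distrib, ← Finset.mul_sum, ← Finset.mul_sum, sum_sub_mul_self,
            rpow_eq_sq_mul hρ β, radContract]
          ring
  rw [h1, h2, sq_abs, ← mul_assoc, mul_pow, mul_div_right_comm, rpow_sq_div hρ]
  congr 2
  rw [hβ]; ring

/-- The same computation for each component of ∇u, with β = (n - α - 2)/2 and total power -α - 2. -/
theorem sq_norm_radialDeriv_rpow_smul (hΩ : IsOpen Ω) (α : ℝ) (hx : x ∈ Ω) :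
    ‖radialDeriv y (fun z => ‖z - y‖ ^ (((n : ℝ) - α - 2) / 2) • ∇ u z) x‖ ^ 2 /
      ‖x - y‖ ^ ((n : ℝ) - 2) =
    ‖x - y‖ ^ (-α - 2) *
      (pairing (fun i => radContract y (U2 i)) (fun i => radContract y (U2 i)) x +
        (n - α - 2) * pairing U1 (fun i => radContract y (U2 i)) x +
        (n - α - 2) ^ 2 / 4 * pairing U1 U1 x) := by
  have hρ := IsSymbol.norm_pos_of_ne (J.ne hx)
  set β := ((n : ℝ) - α - 2) / 2 with hβ
  have h0 : ∀ i, HasPartials (fun z => (‖z - y‖ ^ β • ∇ u z) i)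
      (fun k => β * (x k - y k) * ‖x - y‖ ^ (β - 2) * U1 i x + ‖x - y‖ ^ β * U2 i k x) x :=
    fun i => ((HasPartials.norm_sub_rpow (J.ne hx) β).mul
      ((J.one i).hasPartials x hx)).congr_of_eventuallyEq (by
        filter_upwards [hΩ.mem_nhds hx] with z hz
        rw [PiLp.smul_apply, (J.zero.hasPartials z hz).gradient_apply, smul_eq_mul])
  have h2 : ∀ i, ∑ k, (x k - y k) * (β * (x k - y k) * ‖x - y‖ ^ (β - 2) * U1 i x +
      ‖x - y‖ ^ β * U2 i k x) = ‖x - y‖ ^ β * (radContract y (U2 i) x + β * U1 i x) := by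
    intro i
    calc _ = ∑ k, (β * ‖x - y‖ ^ (β - 2) * U1 i x * ((x k - y k) * (x k - y k)) +
          ‖x - y‖ ^ β * ((x k - y k) * U2 i k x)) := Finset.sum_congr rfl fun k _ => by ring
      _ = _ := by
          rw [Finset.sum_add_distrib, ← Finset.mul_sum, ← Finset.mul_sum, sum_sub_mul_self,
            rpow_eq_sq_mul hρ β, radContract]
          ring
  have h3 : ‖radialDeriv y (fun z => ‖z - y‖ ^ β • ∇ u z) x‖ ^ 2 =
      (‖x - y‖⁻¹ * ‖x - y‖ ^ β) ^ 2 * ∑ i, (radContract y (U2 i) x + β * U1 i x) ^ 2 := by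
    rw [EuclideanSpace.real_norm_sq_eq, Finset.mul_sum]
    refine Finset.sum_congr rfl fun i _ => ?_
    rw [radialDeriv_apply_eq h0 i, h2]
    ring
  rw [h3, mul_div_right_comm, rpow_sq_div hρ]
  congr 1
  · congr 1
    rw [hβ]; ring
  · simp only [pairing, Finset.mul_sum, ← Finset.sum_add_distrib]
    refine Finset.sum_congr rfl fun i _ => ?_
    rw [hβ]; ring

end IsJet

theorem boundary_integrand_eq (α : ℝ) (hxy : x ≠ y) (K : ℝ) (N : EuclideanSpace ℝ (Fin n)) :
    K * ⟪‖x - y‖⁻¹ • (x - y), N⟫_ℝ / ‖x - y‖ ^ (α - 1) =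
      K * (∑ i, (x i - y i) * N i) * ‖x - y‖ ^ (-α) := by
  have hρ := IsSymbol.norm_pos_of_ne hxy
  have h1 : ⟪x - y, N⟫_ℝ = ∑ i, (x i - y i) * N i := by
    rw [PiLp.inner_apply]
    exact Finset.sum_congr rfl fun i _ => by simp [mul_comm]
  rw [real_inner_smul_left, h1, Real.rpow_sub hρ, Real.rpow_neg hρ.le, Real.rpow_one]
  field_simp

/-- The partial derivatives of a function of class `C⁴` vanishing to first order on the boundary. -/
theorem isJet_of_contDiffOn (hΩ : IsBoundedLipschitzDomain Ω)
    (hu : ContDiffOn ℝ 4 u (closure Ω)) (hu₀ : ∀ x ∈ frontier Ω, u x = 0)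
    (hu₁ : ∀ x ∈ frontier Ω, gradientWithin u (closure Ω) x = 0) (hy : y ∉ Ω) :
    IsJet Ω y u (fun i => partialWithin (closure Ω) i u)
      (fun i j => partialWithin (closure Ω) j (partialWithin (closure Ω) i u))
      (fun i j k => partialWithin (closure Ω) k
        (partialWithin (closure Ω) j (partialWithin (closure Ω) i u)))
      (fun i j k l => partialWithin (closure Ω) l (partialWithin (closure Ω) k
        (partialWithin (closure Ω) j (partialWithin (closure Ω) i u)))) := by
  have hs := hΩ.uniqueDiffOn_closure
  have hint : closure Ω ⊆ closure (interior (closure Ω)) :=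
    closure_mono (interior_maximal subset_closure hΩ.isOpen)
  have d1 : ∀ i, ContDiffOn ℝ (3 : ℕ) (partialWithin (closure Ω) i u) (closure Ω) := fun i =>
    ContDiffOn.partialWithin (k := 4) hu hs le_rfl i
  have d2 : ∀ i j, ContDiffOn ℝ (2 : ℕ)
      (partialWithin (closure Ω) j (partialWithin (closure Ω) i u)) (closure Ω) := fun i j =>
    (d1 i).partialWithin hs le_rfl j
  have d3 : ∀ i j k, ContDiffOn ℝ (1 : ℕ) (partialWithin (closure Ω) k
      (partialWithin (closure Ω) j (partialWithin (closure Ω) i u))) (closure Ω) := fun i j k =>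
    (d2 i j).partialWithin hs le_rfl k
  have hsymm : ∀ x ∈ closure Ω, ∀ i j,
      partialWithin (closure Ω) j (partialWithin (closure Ω) i u) x =
      partialWithin (closure Ω) i (partialWithin (closure Ω) j u) x := fun x hx i j =>
    partialWithin_comm (hu.of_le (by norm_num)) hs hx (hint hx) i j
  refine ⟨hy, ContDiffOn.isSymbol_two hΩ hy (hu.of_le (by norm_num)) hu₀ hu₁, fun i => ?_,
    fun i j => ?_, fun i j k => ?_, hsymm, ?_, ?_⟩
  · refine ContDiffOn.isSymbol_one hΩ hy ((d1 i).of_le (by norm_num)) fun h => ?_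
    simp [partialWithin, fderivWithin_eq_zero_of_gradientWithin (hu₁ y h)]
  · exact ContDiffOn.isSymbol hΩ hy ((d2 i j).of_le (by norm_num)) (Or.inl le_rfl)
  -- Third derivatives are in fact bounded; order -1 is all the flux identities need and keeps the
  -- orders 2, 1, 0, -1 in step.
  · exact ContDiffOn.isSymbol hΩ hy ((d3 i j k).of_le (by norm_num)) (Or.inl (by norm_num))
  · intro x hx i j k
    -- The symmetry of second derivatives holds on the whole closure, so it may be differentiated
    -- within it.
    rw [partialWithin, partialWithin, fderivWithin_congr (fun z hz => hsymm z hz i j)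
      (hsymm x hx i j)]
  · intro x hx i j k
    exact partialWithin_comm ((d1 i).of_le (by norm_num)) hs hx (hint hx) j k

end Pointwise

/-! ### Conclusion -/

theorem integral_linear_combination {X : Type*} [MeasurableSpace X] {μ : Measure X}
    {f g h k : X → ℝ} (hf : Integrable f μ) (hg : Integrable g μ) (hh : Integrable h μ)
    (hk : Integrable k μ) (a b c d : ℝ) :
    ∫ x, a * f x - b * g x - c * h x - d * k x ∂μ =
      a * ∫ x, f x ∂μ - b * ∫ x, g x ∂μ - c * ∫ x, h x ∂μ - d * ∫ x, k x ∂μ := by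
  have hab := (hf.const_mul a).sub (hg.const_mul b)
  rw [integral_sub (f := fun x => a * f x - b * g x - c * h x) (hab.sub (hh.const_mul c))
    (hk.const_mul d), integral_sub (f := fun x => a * f x - b * g x) hab (hh.const_mul c),
    integral_sub (hf.const_mul a) (hg.const_mul b)]
  simp only [integral_const_mul]

theorem lemma3p21 {n : ℕ} (hn : 2 ≤ n) {Ω : Set (EuclideanSpace ℝ (Fin n))}
    (hΩ : IsBoundedLipschitzDomain Ω) {u : EuclideanSpace ℝ (Fin n) → ℝ}
    (hu : ContDiffOn ℝ 4 u (closure Ω))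
    (hu₀ : ∀ x ∈ frontier Ω, u x = 0)
    (hu₁ : ∀ x ∈ frontier Ω, gradientWithin u (closure Ω) x = 0)
    (α : ℝ) (y : EuclideanSpace ℝ (Fin n))
    (hy : (y ∈ frontier Ω ∧ α < n) ∨ y ∉ closure Ω) :
    -- all integrals converge absolutely
    IntegrableOn (fun x => Δ u x * Δ (fun z => u z / ‖z - y‖ ^ α) x) Ω ∧
    IntegrableOn (fun x => Δ (Δ u) x * radialDeriv y u x / ‖x - y‖ ^ (α - 1)) Ω ∧
    Integrable (fun x => hessianNormSq (closure Ω) u x *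
      ⟪‖x - y‖⁻¹ • (x - y), outwardNormal Ω x⟫_ℝ / ‖x - y‖ ^ (α - 1)) (surfaceMeasure Ω) ∧
    IntegrableOn (fun x =>
      ‖radialDeriv y (fun z => ‖z - y‖ ^ (((n : ℝ) - α - 2) / 2) • ∇ u z) x‖ ^ 2 /
        ‖x - y‖ ^ ((n : ℝ) - 2)) Ω ∧
    IntegrableOn (fun x =>
      |radialDeriv y (fun z => ‖z - y‖ ^ (((n : ℝ) - α - 4) / 2) * u z) x| ^ 2 /
        ‖x - y‖ ^ ((n : ℝ) - 2)) Ω ∧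
    -- the identity
    (α + 4 - n) * (∫ x in Ω, Δ u x * Δ (fun z => u z / ‖z - y‖ ^ α) x)
      - 2 * (∫ x in Ω, Δ (Δ u) x * radialDeriv y u x / ‖x - y‖ ^ (α - 1))
    = (∫ x, hessianNormSq (closure Ω) u x *
        ⟪‖x - y‖⁻¹ • (x - y), outwardNormal Ω x⟫_ℝ / ‖x - y‖ ^ (α - 1) ∂(surfaceMeasure Ω))
      + 4 * α * (∫ x in Ω,
        ‖radialDeriv y (fun z => ‖z - y‖ ^ (((n : ℝ) - α - 2) / 2) • ∇ u z) x‖ ^ 2 /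
          ‖x - y‖ ^ ((n : ℝ) - 2))
      + 2 * α * (α + 2) * (n - α - 2) * (∫ x in Ω,
        |radialDeriv y (fun z => ‖z - y‖ ^ (((n : ℝ) - α - 4) / 2) * u z) x| ^ 2 /
          ‖x - y‖ ^ ((n : ℝ) - 2)) := by
  have hs := hΩ.uniqueDiffOn_closure
  have hyΩ : y ∉ Ω := by
    rcases hy with hy | hy
    · exact hΩ.disjoint_frontier hy.1
    · exact fun h => hy (subset_closure h)
  -- When y is on the boundary, α < n is used twice: as -α > -n in Ω and as 1 - α > -(n - 1) on ∂Ω.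
  have hI : IntegrableOn (fun x => ‖x - y‖ ^ (-α)) Ω :=
    hΩ.integrableOn_norm_sub_rpow hn (hy.imp (fun h => ⟨h.1, by linarith [h.2]⟩) id)
  have hσ : Integrable (fun x => ‖x - y‖ ^ (1 - α)) (surfaceMeasure Ω) :=
    hΩ.integrable_norm_sub_rpow hn fun hf => by
      rcases hy with hy | hy
      · linarith [hy.2]
      · exact absurd (frontier_subset_closure hf) hy
  have J := isJet_of_contDiffOn hΩ hu hu₀ hu₁ hyΩ
  have hu2 : ContDiffOn ℝ 2 u (closure Ω) := hu.of_le (by norm_num)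
  have hb : ∀ᵐ x ∂surfaceMeasure Ω, u x = 0 ∧ (∀ i, partialWithin (closure Ω) i u x = 0) ∧
      ∃ c, ∀ i j, partialWithin (closure Ω) j (partialWithin (closure Ω) i u) x =
        c * outwardNormal Ω x i * outwardNormal Ω x j := by
    filter_upwards [IsBoundedLipschitzDomain.ae_mem_frontier Ω,
      IsBoundedLipschitzDomain.ae_isOutwardUnitNormal hΩ hn] with x hx hν
    exact ⟨hu₀ x hx, fun i => by
      simp [partialWithin, fderivWithin_eq_zero_of_gradientWithin (hu₁ x hx)],
      exists_hessian_eq hΩ hu2 hu₁ hx hν⟩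
  have hF := J.hasFlux_rellich hΩ hI hn hσ hb
  have hm := hΩ.isOpen.measurableSet
  have i₁ := J.integrableOn_lap_mul hΩ hI
  have i₂ := J.integrableOn_bilap_mul hΩ hI hn hσ
  have i₃ := J.integrableOn_gradSq hΩ hI
  have i₄ := J.integrableOn_radSq hΩ hI
  have e₁ : EqOn (fun x => Δ u x * Δ (fun z => u z / ‖z - y‖ ^ α) x) _ Ω := fun x hx =>
    congrArg₂ (· * ·) (J.laplacian_eq hΩ.isOpen hx) (J.laplacian_div_rpow hΩ.isOpen α hx)
  have e₂ : EqOn (fun x => Δ (Δ u) x * radialDeriv y u x / ‖x - y‖ ^ (α - 1)) _ Ω := fun x hx =>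
    (mul_div_assoc _ _ _).trans <| congrArg₂ (· * ·) (J.laplacian_laplacian_eq hΩ.isOpen hx)
      (J.radialDeriv_div_rpow α hx)
  have e₃ : EqOn (fun x => ‖radialDeriv y (fun z => ‖z - y‖ ^ (((n : ℝ) - α - 2) / 2) • ∇ u z) x‖ ^ 2
      / ‖x - y‖ ^ ((n : ℝ) - 2)) _ Ω := fun x hx =>
    J.sq_norm_radialDeriv_rpow_smul hΩ.isOpen α hx
  have e₄ : EqOn (fun x => |radialDeriv y (fun z => ‖z - y‖ ^ (((n : ℝ) - α - 4) / 2) * u z) x| ^ 2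
      / ‖x - y‖ ^ ((n : ℝ) - 2)) _ Ω := fun x hx => J.sq_radialDeriv_rpow_mul α hx
  have e₅ : (fun x => hessianNormSq (closure Ω) u x *
      ⟪‖x - y‖⁻¹ • (x - y), outwardNormal Ω x⟫_ℝ / ‖x - y‖ ^ (α - 1)) =ᵐ[surfaceMeasure Ω]
      fun x => (∑ i, pairing (fun j => partialWithin (closure Ω) j (partialWithin (closure Ω) i u))
        (fun j => partialWithin (closure Ω) j (partialWithin (closure Ω) i u)) x) *
        (∑ i, (x i - y i) * outwardNormal Ω x i) * ‖x - y‖ ^ (-α) := by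
    filter_upwards [IsBoundedLipschitzDomain.ae_mem_frontier Ω,
      IsBoundedLipschitzDomain.ae_ne_surfaceMeasure hn Ω y] with x hx hxy
    rw [boundary_integrand_eq α hxy, hessianNormSq_eq hu2 hs (frontier_subset_closure hx),
      Finset.sum_comm]
    simp only [pow_two]
    rfl
  refine ⟨i₁.congr_fun e₁.symm hm, i₂.congr_fun e₂.symm hm, hF.integrable.congr e₅.symm,
    i₃.congr_fun e₃.symm hm, i₄.congr_fun e₄.symm hm, ?_⟩
  rw [setIntegral_congr_fun hm e₁, setIntegral_congr_fun hm e₂, setIntegral_congr_fun hm e₃,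
    setIntegral_congr_fun hm e₄, integral_congr_ae e₅, ← hF.integral_eq]
  rw [integral_linear_combination i₁ i₂ i₃ i₄]
  ring
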